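/- Let $n\ge 1$. Let $\mathrm{conv}(\mathbb R^n)$ be the set of nonempty convex compact subsets of $\mathbb R^n$ with Minkowski addition, nonnegative dilations and the Hausdorff metric, and identify $u\in\mathrm{conv}(\mathbb R^n)$ with its support function $h_u(p)=\sup_{x\in u}\langle x,p\rangle$ in $C(S^{n-1})$; write $\|u\|=\|h_u\|_{C(S^{n-1})}$. Let $V[u]$ be the volume of $u$, let $V[u_1,\dots,u_n]$ be the mixed volume, and let $V_1[u,w]=V[u,\dots,u,w]$ (with $n-1$ copies of $u$). Let $\mathbb R_+=[0,\infty)$, let $A$ be a linear operator on $\mathbb R^n$ with operator norms taken with respect to the Euclidean norm, and put $\exp\{\mathcal A t\}u=e^{At}u$ (the image of $u$ under $e^{At}$). Let $\varphi:\mathbb R_+\to\mathbb R_+$ and $F:\mathbb R_+\times\mathrm{conv}(\mathbb R^n)\to\mathrm{conv}(\mathbb R^n)$ be locally Lipschitz, i.e. Lipschitz in a neighbourhood of every point of their domains. For $u_0\in\mathrm{conv}(\mathbb R^n)$ a solution on $[0,T)$ is a continuous $u:[0,T)\to\mathrm{conv}(\mathbb R^n)$ such that, for all $t\in[0,T)$,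 as an identity in $C(S^{n-1})$, $$u(t)=\exp\Big\{\mathcal A\int_0^t\varphi(V[u(s)])\,ds\Big\}u_0+\int_0^t\exp\Big\{\mathcal A\int_s^t\varphi(V[u(\tau)])\,d\tau\Big\}F(V[u(s)],u(s))\,ds .$$ One says that $\mathfrak F^t(u_0)$ exists if some solution is defined on a half-interval $[0,T)$ with $T>t$ and the value $u(t)$ is the same for all such solutions; then $\mathfrak F^t(u_0)=u(t)$. Fix $u_0\in\mathrm{conv}(\mathbb R^n)$ and assume: (1) there are constants $N>0$ and $\alpha\in\mathbb R$ with $\|e^{At}\|\le Ne^{\alpha t}$ for all $t\ge0$; (2) there are locally Lipschitz functions $g_*,g^*:\mathbb R_+\to\mathbb R_+$ with $g_*(V[u])\le nV_1[u,F(V[u],u)]\le g^*(V[u])$ for all $u\in\mathrm{conv}(\mathbb R^n)$; (3) the maximal solution $\zeta^+$ of $\frac{d\zeta}{dt}=\operatorname{tr}A\,\varphi(\zeta)\zeta+g^*(\zeta)$, $\zeta(0)=V[u_0]$, and the minimal solution $\chi_-$ of $\frac{d\chi}{dt}=\operatorname{tr}A\,\varphi(\chi)\chi+g_*(\chi)$,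 $\chi(0)=V[u_0]$, are defined on all of $\mathbb R_+$; (4) there is a continuous function $F^+:\mathbb R_+\times\mathbb R_+\to\mathbb R_+$ (which may depend on $V[u_0]$), with $F^+(t,\cdot)$ nondecreasing for every $t\ge 0$, such that $\sup_{\chi_-(t)\le s\le\zeta^+(t)}\|F(s,u)\|\le F^+(t,\|u\|)$ for all $(t,u)\in\mathbb R_+\times\mathrm{conv}(\mathbb R^n)$; (5) the maximal solution $\omega^+$ of $\frac{d\omega}{dt}=\alpha\Lambda(t)\omega+F^+(t,N\omega)$, $\omega(0)=\|u_0\|$, is defined on all of $\mathbb R_+$, where $\Lambda(t)=\max_{\chi_-(t)\le r\le\zeta^+(t)}\varphi(r)$ if $\alpha>0$ and $\Lambda(t)=\min_{\chi_-(t)\le r\le\zeta^+(t)}\varphi(r)$ if $\alpha\le0$. Here solutions of the comparison equations take values in $\mathbb R_+$, and a solution on $\mathbb R_+$ is called maximal (minimal) if on every $[0,T)$ it is an upper (lower) bound for every solution on $[0,T)$ of the same initial value problem. Then $\mathfrak F^t(u_0)$ exists for every $t\ge0$. -/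

import Mathlib

set_option maxSynthPendingDepth 3

open Set MeasureTheory
open scoped NNReal

noncomputable section

namespace ConvFlow

/-- The Euclidean space `ℝⁿ`. -/
abbrev Euc (n : ℕ) : Type := EuclideanSpace ℝ (Fin n)

/-- `conv(ℝⁿ)`: the nonempty convex compact subsets of `ℝⁿ`, with Minkowski addition,
nonnegative dilations and the Hausdorff metric. -/
abbrev Conv (n : ℕ) : Type := ConvexBody (Euc n)

variable {n : ℕ}

/-- The value `h_u(p) = sup_{x ∈ u} ⟨x, p⟩` of the support function. -/
def supportValue (u : Conv n) (p : Euc n) : ℝ :=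
  sSup ((fun x : Euc n => inner ℝ x p) '' (u : Set (Euc n)))

theorem bddAbove_inner_image (u : Conv n) (p : Euc n) :
    BddAbove ((fun x : Euc n => inner ℝ x p) '' (u : Set (Euc n))) :=
  (u.isCompact.image (by fun_prop)).bddAbove

theorem continuous_supportValue (u : Conv n) : Continuous (supportValue u) := by
  obtain ⟨C, hC0, hC⟩ := u.isBounded.exists_pos_norm_le
  have key : ∀ p q : Euc n, supportValue u p ≤ supportValue u q + C * dist p q := by
    intro p q
    refine csSup_le (u.nonempty.image _) ?_
    rintro _ ⟨x, hx, rfl⟩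
    have h1 : inner ℝ x q ≤ supportValue u q :=
      le_csSup (bddAbove_inner_image u q) ⟨x, hx, rfl⟩
    have h2 : inner ℝ x (p - q) ≤ C * dist p q := by
      rw [dist_eq_norm]
      exact (real_inner_le_norm _ _).trans
        (mul_le_mul_of_nonneg_right (hC x hx) (norm_nonneg _))
    rw [inner_sub_right] at h2
    have h3 : inner ℝ x p ≤ supportValue u q + C * dist p q := by linarith
    exact h3
  refine (LipschitzWith.of_le_add_mul' C key).continuous

/-- The support function of `u` as an element of the Banach space `C(Sⁿ⁻¹)`. -/
def supp (u : Conv n) : C(Metric.sphere (0 : Euc n) 1, ℝ) where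
  toFun p := supportValue u p
  continuous_toFun := (continuous_supportValue u).comp continuous_subtype_val

/-- `‖u‖`, the norm of the support function of `u` in `C(Sⁿ⁻¹)`. -/
def bodyNorm (u : Conv n) : ℝ≥0 := ‖supp u‖₊

/-- The volume `V[u]`. -/
def vol (u : Conv n) : ℝ≥0 := (volume (u : Set (Euc n))).toNNReal

/-- The mixed volume `V[K₁, …, Kₙ]`, i.e. the symmetric coefficient in Minkowski's expansion
`V[∑ λₖ Kₖ] = ∑ V[K_{k₁}, …, K_{kₙ}] λ_{k₁} ⋯ λ_{kₙ}`, written out by polarization: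
`V[K₁, …, Kₙ] = (1 / n!) ∑_{S ⊆ {1, …, n}} (-1)^{n - |S|} V[∑_{i ∈ S} Kᵢ]`. -/
def mixedVolume (K : Fin n → Conv n) : ℝ :=
  (∑ S : Finset (Fin n), (-1 : ℝ) ^ (n - S.card) * (vol (∑ i ∈ S, K i) : ℝ)) / n.factorial

/-- `V_k[u, w] = V[u, …, u, w, …, w]` with `k` arguments equal to `w`. -/
def mixedVolumeTwo (k : ℕ) (u w : Conv n) : ℝ :=
  mixedVolume (fun i : Fin n => if (i : ℕ) < n - k then u else w)

/-- The image of a convex body under a linear operator. -/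
def imageBody (B : Euc n →L[ℝ] Euc n) (u : Conv n) : Conv n where
  carrier := B '' (u : Set (Euc n))
  convex' := u.convex.linear_image B.toLinearMap
  isCompact' := u.isCompact.image B.continuous
  nonempty' := u.nonempty.image _

/-- The semigroup `exp{𝒜 t}` on `conv(ℝⁿ)`: `u ↦ e^{At} u`. -/
def expBody (A : Euc n →L[ℝ] Euc n) (t : ℝ) (u : Conv n) : Conv n :=
  imageBody (NormedSpace.exp (t • A)) u

/-- `∫ₛᵗ φ(V[u(τ)]) dτ`. -/
def clock (φ : ℝ≥0 → ℝ≥0) (u : ℝ → Conv n) (s t : ℝ) : ℝ :=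
  ∫ τ in s..t, (φ (vol (u τ)) : ℝ)

/-- `u` is a continuous solution on `[0, T)` of the integral equation
`u(t) = exp{𝒜 ∫₀ᵗ φ(V[u])} u₀ + ∫₀ᵗ exp{𝒜 ∫ₛᵗ φ(V[u])} F(V[u(s)], u(s)) ds`,
where convex bodies are identified with their support functions and the integral is that of a
`C(Sⁿ⁻¹)`-valued function. -/
def IsSolution (A : Euc n →L[ℝ] Euc n) (φ : ℝ≥0 → ℝ≥0) (F : ℝ≥0 → Conv n → Conv n)
    (u₀ : Conv n) (T : ℝ) (u : ℝ → Conv n) : Prop :=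
  ContinuousOn u (Ico 0 T) ∧
    ∀ t ∈ Ico 0 T,
      supp (u t) = supp (expBody A (clock φ u 0 t) u₀) +
        ∫ s in (0 : ℝ)..t, supp (expBody A (clock φ u s t) (F (vol (u s)) (u s)))

/-- `v = 𝔉ᵗ(u₀)`: some solution of the integral equation with initial value `u₀` lives on a
half-interval `[0, T)` that contains `t`, and takes the value `v` at time `t`. -/
def IsFlowValue (A : Euc n →L[ℝ] Euc n) (φ : ℝ≥0 → ℝ≥0) (F : ℝ≥0 → Conv n → Conv n)
    (t : ℝ) (u₀ v : Conv n) : Prop :=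
  ∃ T > t, ∃ u : ℝ → Conv n, IsSolution A φ F u₀ T u ∧ u t = v

/-- `x` is a (nonnegative) solution on the interval `I`, with left end point `0`, of the initial
value problem `dx/dt = f(t, x)`, `x(0) = x₀`. -/
def IsODESolution (f : ℝ → ℝ≥0 → ℝ) (x₀ : ℝ≥0) (I : Set ℝ) (x : ℝ → ℝ≥0) : Prop :=
  x 0 = x₀ ∧ ∀ t ∈ I, HasDerivWithinAt (fun s => (x s : ℝ)) (f t (x t)) I t

/-- `x` is the maximal solution of the initial value problem and is defined on all of `[0, ∞)`. -/
def IsGlobalMaximalSolution (f : ℝ → ℝ≥0 → ℝ) (x₀ : ℝ≥0) (x : ℝ → ℝ≥0) : Prop :=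
  IsODESolution f x₀ (Ici 0) x ∧
    ∀ T > 0, ∀ y : ℝ → ℝ≥0, IsODESolution f x₀ (Ico 0 T) y → ∀ t ∈ Ico 0 T, y t ≤ x t

/-- `x` is the minimal solution of the initial value problem and is defined on all of `[0, ∞)`. -/
def IsGlobalMinimalSolution (f : ℝ → ℝ≥0 → ℝ) (x₀ : ℝ≥0) (x : ℝ → ℝ≥0) : Prop :=
  IsODESolution f x₀ (Ici 0) x ∧
    ∀ T > 0, ∀ y : ℝ → ℝ≥0, IsODESolution f x₀ (Ico 0 T) y → ∀ t ∈ Ico 0 T, x t ≤ y t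

/-- The right-hand side `tr A · φ(x) x + g(x)` of the comparison equations for the volume. -/
def volumeRHS (A : Euc n →L[ℝ] Euc n) (φ g : ℝ≥0 → ℝ≥0) (_t : ℝ) (x : ℝ≥0) : ℝ :=
  LinearMap.trace ℝ (Euc n) (A : Euc n →ₗ[ℝ] Euc n) * φ x * x + g x

open Classical in
/-- `Λ⁺(t) = max_{χ(t) ≤ r ≤ ζ(t)} φ(r)` if `α > 0`, and
`Λ⁻(t) = min_{χ(t) ≤ r ≤ ζ(t)} φ(r)` if `α ≤ 0`. -/
def rateBound (α : ℝ) (φ : ℝ≥0 → ℝ≥0) (χ ζ : ℝ → ℝ≥0) (t : ℝ) : ℝ≥0 :=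
  if 0 < α then sSup (φ '' Icc (χ t) (ζ t)) else sInf (φ '' Icc (χ t) (ζ t))

/-- The right-hand side `α Λ^±(t) w + F⁺(t, N w)` of the comparison equation for the norm. -/
def normRHS (α : ℝ) (N : ℝ≥0) (φ : ℝ≥0 → ℝ≥0) (χ ζ : ℝ → ℝ≥0) (Fplus : ℝ → ℝ≥0 → ℝ≥0)
    (t : ℝ) (w : ℝ≥0) : ℝ :=
  α * rateBound α φ χ ζ t * w + Fplus t (N * w)

end ConvFlow

end

noncomputable section

namespace ConvFlow

variable {n : ℕ}

/-! ### Support functions -/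

/-! The substitution $w(t)=\exp\{-\mathcal A c(t)\}u(t)$, with clock $c(t)=\int_0^t\varphi(V[u])$,
removes the semigroup from the integral equation. It becomes the autonomous equation
$c'=\varphi(V[u])$, $w'=\exp\{-\mathcal A c\}F(V[u],u)$ with $u=\exp\{\mathcal A c\}w$, on $\mathbb
R\times\mathrm{conv}(\mathbb R^n)$. This space embeds isometrically as a closed convex cone in
$\mathbb R\times C(S^{n-1})$. Integrals of cone-valued curves stay in the cone, so Picard iteration
works there, and a Gronwall argument gives uniqueness. What remains is to bound the vector field
along every solution on a bounded interval: the solution is then Lipschitz, has a limit at the end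
point and can be continued (`exists_isCurve_of_bounded`).

The bound comes in two stages. Since $V[e^{Ac}w]=e^{c\,\mathrm{tr}A}V[w]$ and the right derivative
of $V[w]$ is $nV_1[w,w']$, the volume satisfies $\dot V=\mathrm{tr}A\,\varphi(V)V+nV_1[u,F]$ and
stays between $\chi_-$ and $\zeta^+$. With the volume so confined, the integral equation gives an
integral inequality for $\|u\|$ whose kernel is monotone. Monotone iteration produces a genuine
solution above $\|u\|$, and maximality of $\omega^+$ yields $\|u\|\le N\omega^+$, which bounds $F$.

Both the regularity of the field and the volume equation rest on Minkowski's theorem that $t\mapsto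
V[u+tw]$ is a polynomial (`vol_add_smul_eq_sum`). Support functions are mollified and made strictly
convex. The gradient of such a function maps $\mathbb R^n$ injectively onto a set close to the body,
so the volume is approximated by the integral of a Hessian determinant, which is polynomial in $t$.
Polynomiality gives the local Lipschitz bound on the volume, and polarization identifies the linear
coefficient with $nV_1$. -/

theorem inner_le_supportValue {u : Conv n} {x : Euc n} (hx : x ∈ u) (p : Euc n) :
    inner ℝ x p ≤ supportValue u p :=
  le_csSup (bddAbove_inner_image u p) ⟨x, hx, rfl⟩

theorem supportValue_le {u : Conv n} {p : Euc n} {r : ℝ} (h : ∀ x ∈ u, inner ℝ x p ≤ r) :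
    supportValue u p ≤ r :=
  csSup_le (u.nonempty.image _) (by rintro _ ⟨x, hx, rfl⟩; exact h x hx)

theorem exists_inner_eq_supportValue (u : Conv n) (p : Euc n) :
    ∃ x ∈ u, inner ℝ x p = supportValue u p := by
  have := (u.isCompact.image (f := fun x : Euc n => inner ℝ x p) (by fun_prop)).sSup_mem
    (u.nonempty.image _)
  obtain ⟨x, hx, h⟩ := this
  exact ⟨x, hx, h⟩

theorem supportValue_add (u v : Conv n) (p : Euc n) :
    supportValue (u + v) p = supportValue u p + supportValue v p := by
  apply le_antisymm
  · refine supportValue_le ?_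
    intro z hz
    have hz' : z ∈ ((u + v : Conv n) : Set (Euc n)) := hz
    rw [ConvexBody.coe_add] at hz'
    obtain ⟨x, hx, y, hy, rfl⟩ := hz'
    rw [inner_add_left]
    exact add_le_add (inner_le_supportValue hx p) (inner_le_supportValue hy p)
  · obtain ⟨x, hx, h1⟩ := exists_inner_eq_supportValue u p
    obtain ⟨y, hy, h2⟩ := exists_inner_eq_supportValue v p
    rw [← h1, ← h2, ← inner_add_left]
    refine inner_le_supportValue ?_ p
    exact Set.add_mem_add hx hy

theorem supportValue_smul (c : ℝ≥0) (u : Conv n) (p : Euc n) :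
    supportValue (c • u) p = c * supportValue u p := by
  apply le_antisymm
  · refine supportValue_le ?_
    intro z hz
    have hz' : z ∈ ((c • u : Conv n) : Set (Euc n)) := hz
    rw [ConvexBody.coe_smul'] at hz'
    obtain ⟨x, hx, rfl⟩ := hz'
    simp only [real_inner_smul_left]
    exact mul_le_mul_of_nonneg_left (inner_le_supportValue hx p) c.2
  · obtain ⟨x, hx, h1⟩ := exists_inner_eq_supportValue u p
    rw [← h1, ← real_inner_smul_left]
    refine inner_le_supportValue ?_ p
    exact Set.smul_mem_smul_set (a := c) hx

theorem supportValue_imageBody (B : Euc n →L[ℝ] Euc n) (u : Conv n) (p : Euc n) :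
    supportValue (imageBody B u) p = supportValue u (B.adjoint p) := by
  apply le_antisymm
  · refine supportValue_le ?_
    rintro _ ⟨x, hx, rfl⟩
    rw [← ContinuousLinearMap.adjoint_inner_right]
    exact inner_le_supportValue hx _
  · refine supportValue_le ?_
    intro x hx
    rw [ContinuousLinearMap.adjoint_inner_right]
    exact inner_le_supportValue (u := imageBody B u) (mem_image_of_mem B hx) _

theorem supportValue_smul_right (u : Conv n) {c : ℝ} (hc : 0 ≤ c) (p : Euc n) :
    supportValue u (c • p) = c * supportValue u p := by
  apply le_antisymm
  · refine supportValue_le fun x hx => ?_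
    rw [real_inner_smul_right]
    exact mul_le_mul_of_nonneg_left (inner_le_supportValue hx p) hc
  · obtain ⟨x, hx, h1⟩ := exists_inner_eq_supportValue u p
    rw [← h1, ← real_inner_smul_right]
    exact inner_le_supportValue hx _

theorem supportValue_zero_right (u : Conv n) : supportValue u 0 = 0 := by
  simpa using supportValue_smul_right u le_rfl 0

theorem supportValue_add_right_le (u : Conv n) (p q : Euc n) :
    supportValue u (p + q) ≤ supportValue u p + supportValue u q := by
  refine supportValue_le fun x hx => ?_
  rw [inner_add_right]
  exact add_le_add (inner_le_supportValue hx p) (inner_le_supportValue hx q)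

/-- A point outside the closed convex set `u` is strictly separated from it by a functional, whose
Riesz representative is a direction violating the inequality. -/
theorem mem_of_forall_inner_le_supportValue {u : Conv n} {x : Euc n}
    (h : ∀ p, inner ℝ x p ≤ supportValue u p) : x ∈ u := by
  by_contra hx
  obtain ⟨f, s, hf, hs⟩ := geometric_hahn_banach_closed_point u.convex u.isClosed hx
  have hfi : ∀ y, inner ℝ y ((InnerProductSpace.toDual ℝ (Euc n)).symm f) = f y := fun y => by
    rw [real_inner_comm, InnerProductSpace.toDual_symm_apply]
  have h1 := h ((InnerProductSpace.toDual ℝ (Euc n)).symm f)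
  rw [hfi] at h1
  have h2 : supportValue u ((InnerProductSpace.toDual ℝ (Euc n)).symm f) ≤ s :=
    supportValue_le fun y hy => by rw [hfi]; exact (hf y hy).le
  linarith

theorem subset_of_supportValue_le {u v : Conv n} (h : ∀ p, supportValue u p ≤ supportValue v p) :
    (u : Set (Euc n)) ⊆ v := fun _ hx =>
  mem_of_forall_inner_le_supportValue fun p => (inner_le_supportValue hx p).trans (h p)

theorem eq_of_supportValue_eq {u v : Conv n} (h : ∀ p, supportValue u p = supportValue v p) :
    u = v :=
  ConvexBody.ext (Subset.antisymm (subset_of_supportValue_le fun p => (h p).le)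
    (subset_of_supportValue_le fun p => (h p).ge))

/-- The closed unit ball as a convex body. -/
def unitBall (n : ℕ) : Conv n where
  carrier := Metric.closedBall 0 1
  convex' := convex_closedBall _ _
  isCompact' := isCompact_closedBall _ _
  nonempty' := ⟨0, by simp⟩

theorem mem_unitBall {x : Euc n} : x ∈ unitBall n ↔ ‖x‖ ≤ 1 := by
  change x ∈ Metric.closedBall (0 : Euc n) 1 ↔ _
  simp

theorem supportValue_unitBall (p : Euc n) : supportValue (unitBall n) p = ‖p‖ := by
  apply le_antisymm
  · refine supportValue_le fun x hx => (real_inner_le_norm _ _).trans ?_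
    have := mem_unitBall.1 hx
    nlinarith [norm_nonneg p]
  · rcases eq_or_ne p 0 with rfl | hp
    · simp [supportValue_zero_right]
    · have h0 : ‖p‖ ≠ 0 := norm_ne_zero_iff.2 hp
      have : inner ℝ (‖p‖⁻¹ • p) p ≤ supportValue (unitBall n) p :=
        inner_le_supportValue (mem_unitBall.2 (by rw [norm_smul]; simp [h0])) p
      rw [real_inner_smul_left, real_inner_self_eq_norm_sq] at this
      have e : ‖p‖⁻¹ * ‖p‖ ^ 2 = ‖p‖ := by field_simp
      linarith

theorem exists_dist_le_of_mem {u v : Conv n} {x : Euc n} (hx : x ∈ u) :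
    ∃ y ∈ v, dist x y ≤ dist u v := by
  obtain ⟨y, hy, h⟩ := v.isCompact.exists_infDist_eq_dist v.nonempty x
  refine ⟨y, hy, ?_⟩
  rw [← h]
  exact Metric.infDist_le_hausdorffDist_of_mem hx ConvexBody.hausdorffEDist_ne_top

theorem supportValue_le_add_dist (u v : Conv n) (p : Euc n) :
    supportValue u p ≤ supportValue v p + dist u v * ‖p‖ := by
  refine supportValue_le fun x hx => ?_
  obtain ⟨y, hy, h⟩ := exists_dist_le_of_mem (v := v) hx
  have h1 := inner_le_supportValue hy p
  have h2 : inner ℝ (x - y) p ≤ dist u v * ‖p‖ :=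
    (real_inner_le_norm _ _).trans (by rw [← dist_eq_norm]; gcongr)
  rw [inner_sub_left] at h2
  linarith

/-- The ball of radius `r` has support function `r * ‖p‖`, so the hypothesis gives `u ⊆ v + r B` and
`v ⊆ u + r B`, which is Hausdorff distance at most `r`. -/
theorem dist_le_of_supportValue {u v : Conv n} {r : ℝ} (hr : 0 ≤ r)
    (h : ∀ p, |supportValue u p - supportValue v p| ≤ r * ‖p‖) : dist u v ≤ r := by
  lift r to ℝ≥0 using hr
  have key : ∀ u v : Conv n, (∀ p, supportValue u p - supportValue v p ≤ r * ‖p‖) →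
      ∀ x ∈ u, ∃ y ∈ v, dist x y ≤ r := by
    intro u v h x hx
    have hsub : (u : Set (Euc n)) ⊆ (v + r • unitBall n : Conv n) := by
      refine subset_of_supportValue_le fun p => ?_
      rw [supportValue_add, supportValue_smul, supportValue_unitBall]
      have := h p
      linarith
    have hx' := hsub hx
    rw [ConvexBody.coe_add] at hx'
    obtain ⟨y, hy, z, hz, rfl⟩ := hx'
    rw [ConvexBody.coe_smul'] at hz
    obtain ⟨w, hw, rfl⟩ := hz
    refine ⟨y, hy, ?_⟩
    have := mem_unitBall.1 hw
    change dist (y + (r : ℝ) • w) y ≤ r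
    rw [dist_eq_norm, add_sub_cancel_left, norm_smul, Real.norm_of_nonneg r.coe_nonneg]
    exact mul_le_of_le_one_right r.2 this
  exact Metric.hausdorffDist_le_of_mem_dist r.2
    (key u v fun p => (le_abs_self _).trans (h p))
    (key v u fun p => by
      have := (neg_le_abs _).trans (h p)
      linarith)

/-! ### The cone of support functions in `C(Sⁿ⁻¹)` -/

/-- The value at `p` of the positively homogeneous extension of a function on the sphere. -/
def homEval (p : Euc n) : C(Metric.sphere (0 : Euc n) 1, ℝ) →L[ℝ] ℝ :=
  if h : p = 0 then 0 else
    ‖p‖ • ContinuousMap.evalCLM ℝ ⟨‖p‖⁻¹ • p, by simp [norm_smul, h]⟩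

theorem homEval_zero (g : C(Metric.sphere (0 : Euc n) 1, ℝ)) : homEval 0 g = 0 := by
  simp [homEval]

theorem homEval_of_ne_zero {p : Euc n} (h : p ≠ 0) (g : C(Metric.sphere (0 : Euc n) 1, ℝ)) :
    homEval p g = ‖p‖ * g ⟨‖p‖⁻¹ • p, by simp [norm_smul, h]⟩ := by
  simp [homEval, h]

theorem homEval_sphere (p : Metric.sphere (0 : Euc n) 1)
    (g : C(Metric.sphere (0 : Euc n) 1, ℝ)) : homEval (p : Euc n) g = g p := by
  have hp : ‖(p : Euc n)‖ = 1 := by simp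
  have h0 : (p : Euc n) ≠ 0 := by rw [← norm_ne_zero_iff, hp]; simp
  rw [homEval_of_ne_zero h0]
  simp only [hp, one_mul, inv_one, one_smul]

theorem homEval_smul {c : ℝ} (hc : 0 < c) (p : Euc n) (g : C(Metric.sphere (0 : Euc n) 1, ℝ)) :
    homEval (c • p) g = c * homEval p g := by
  rcases eq_or_ne p 0 with rfl | hp
  · simp [homEval_zero]
  · rw [homEval_of_ne_zero (smul_ne_zero hc.ne' hp), homEval_of_ne_zero hp, ← mul_assoc]
    have h1 : ‖c • p‖ = c * ‖p‖ := by rw [norm_smul, Real.norm_of_nonneg hc.le]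
    have h2 : ‖c • p‖⁻¹ • c • p = ‖p‖⁻¹ • p := by
      rw [h1, smul_smul]
      congr 1
      field_simp
    simp only [h2]
    exact congrArg (· * _) h1

theorem homEval_supp (p : Euc n) (u : Conv n) : homEval p (supp u) = supportValue u p := by
  rcases eq_or_ne p 0 with rfl | hp
  · simp [homEval_zero, supportValue_zero_right]
  · rw [homEval_of_ne_zero hp]
    change ‖p‖ * supportValue u (‖p‖⁻¹ • p) = _
    rw [supportValue_smul_right _ (by positivity), ← mul_assoc,
      mul_inv_cancel₀ (norm_ne_zero_iff.2 hp), one_mul]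

theorem abs_homEval_le (p : Euc n) (g : C(Metric.sphere (0 : Euc n) 1, ℝ)) :
    |homEval p g| ≤ ‖g‖ * ‖p‖ := by
  rcases eq_or_ne p 0 with rfl | hp
  · simp [homEval_zero]
  · rw [homEval_of_ne_zero hp, abs_mul, abs_norm, mul_comm]
    gcongr
    exact g.norm_coe_le_norm _

theorem ext_homEval {g k : C(Metric.sphere (0 : Euc n) 1, ℝ)}
    (h : ∀ p : Euc n, homEval p g = homEval p k) : g = k := by
  ext p
  rw [← homEval_sphere, ← homEval_sphere, h]

theorem abs_supportValue_le (u : Conv n) (p : Euc n) : |supportValue u p| ≤ bodyNorm u * ‖p‖ := by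
  rw [← homEval_supp]
  exact abs_homEval_le p _

theorem norm_le_bodyNorm {u : Conv n} {x : Euc n} (hx : x ∈ u) : ‖x‖ ≤ bodyNorm u := by
  rcases eq_or_ne x 0 with rfl | h0
  · simp
  have h1 := (inner_le_supportValue hx x).trans ((le_abs_self _).trans (abs_supportValue_le u x))
  rw [real_inner_self_eq_norm_sq] at h1
  have : 0 < ‖x‖ := norm_pos_iff.2 h0
  nlinarith

theorem bodyNorm_le_of_forall_mem {u : Conv n} {r : ℝ} (hr : 0 ≤ r) (h : ∀ x ∈ u, ‖x‖ ≤ r) :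
    (bodyNorm u : ℝ) ≤ r := by
  change ‖supp u‖ ≤ r
  rw [ContinuousMap.norm_le _ hr]
  intro p
  change |supportValue u p| ≤ r
  have hp : ‖(p : Euc n)‖ = 1 := by simp
  obtain ⟨x, hx, hxp⟩ := exists_inner_eq_supportValue u p
  rw [← hxp]
  refine (abs_real_inner_le_norm _ _).trans ?_
  rw [hp, mul_one]
  exact h x hx

theorem isometry_supp : Isometry (supp : Conv n → C(Metric.sphere (0 : Euc n) 1, ℝ)) := by
  refine Isometry.of_dist_eq fun u v => le_antisymm ?_ ?_
  · rw [ContinuousMap.dist_le dist_nonneg]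
    intro p
    have hp : ‖(p : Euc n)‖ = 1 := by simp
    change |supportValue u p - supportValue v p| ≤ _
    have h1 := supportValue_le_add_dist u v p
    have h2 := supportValue_le_add_dist v u p
    rw [dist_comm v u] at h2
    rw [hp] at h1 h2
    rw [abs_le]
    constructor <;> linarith
  · refine dist_le_of_supportValue dist_nonneg fun p => ?_
    rw [← homEval_supp, ← homEval_supp, ← map_sub, dist_eq_norm]
    exact abs_homEval_le _ _

/-- A sublinear function is the supremum of the linear functionals below it: Hahn–Banach produces,
for each `p`, one that touches it at `p`. The body is the set of all these functionals. -/
theorem mem_range_supp_iff {g : C(Metric.sphere (0 : Euc n) 1, ℝ)} :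
    g ∈ range (supp : Conv n → _) ↔
      ∀ p q : Euc n, homEval (p + q) g ≤ homEval p g + homEval q g := by
  constructor
  · rintro ⟨u, rfl⟩ p q
    simp only [homEval_supp]
    exact supportValue_add_right_le u p q
  · intro h
    have hom : ∀ (c : ℝ), 0 < c → ∀ p : Euc n, homEval (c • p) g = c * homEval p g :=
      fun c hc p => homEval_smul hc p g
    have key : ∀ p : Euc n, ∃ x : Euc n, inner ℝ x p = homEval p g ∧
        ∀ q, inner ℝ x q ≤ homEval q g := by
      intro p
      rcases eq_or_ne p 0 with rfl | hp
      -- At `p = 0` the zero functional on the trivial subspace is extended; the result also shows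
      -- that the body is nonempty.
      · obtain ⟨f, -, hf⟩ := exists_extension_of_le_sublinear
          (⟨⊥, 0⟩ : Euc n →ₗ.[ℝ] ℝ) (fun q => homEval q g) hom h
          (by rintro ⟨x, hx⟩; simp [(Submodule.mem_bot ℝ).1 hx, homEval_zero])
        refine ⟨(InnerProductSpace.toDual ℝ (Euc n)).symm (LinearMap.toContinuousLinearMap f), ?_,
          fun q => ?_⟩
        · simp [homEval_zero]
        · rw [InnerProductSpace.toDual_symm_apply]
          exact hf q
      · obtain ⟨f, hf1, hf⟩ := exists_extension_of_le_sublinear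
          (LinearPMap.mkSpanSingleton p (homEval p g) hp) (fun q => homEval q g) hom h (by
            rintro ⟨x, hx⟩
            obtain ⟨c, rfl⟩ := Submodule.mem_span_singleton.1 hx
            refine (LinearPMap.mkSpanSingleton'_apply _ _ _ c hx).le.trans ?_
            change c • homEval p g ≤ homEval (c • p) g
            -- For negative `c`, domination on the line through `p` follows from subadditivity
            -- applied to `c • p` and `-c • p`, whose sum is `0`.
            rcases lt_trichotomy c 0 with hc | rfl | hc
            · have h1 := h (c • p) (-c • p)
              rw [hom (-c) (by linarith), neg_smul, add_neg_cancel, homEval_zero] at h1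
              rw [smul_eq_mul]
              linarith
            · simp [homEval_zero]
            · rw [hom c hc, smul_eq_mul])
        refine ⟨(InnerProductSpace.toDual ℝ (Euc n)).symm (LinearMap.toContinuousLinearMap f), ?_,
          fun q => ?_⟩
        · rw [InnerProductSpace.toDual_symm_apply]
          have := hf1 ⟨p, Submodule.mem_span_singleton_self p⟩
          exact this.trans (LinearPMap.mkSpanSingleton_apply ℝ ℝ hp (homEval p g))
        · rw [InnerProductSpace.toDual_symm_apply]
          exact hf q
    have hcl : IsClosed {x : Euc n | ∀ q, inner ℝ x q ≤ homEval q g} := by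
      rw [ofPred_forall]
      exact isClosed_iInter fun q => isClosed_le (by fun_prop) continuous_const
    have hbd : {x : Euc n | ∀ q, inner ℝ x q ≤ homEval q g} ⊆ Metric.closedBall 0 ‖g‖ := by
      intro x hx
      rw [mem_closedBall_zero_iff]
      rcases eq_or_ne x 0 with rfl | h0
      · simp
      have h1 := (hx x).trans ((le_abs_self _).trans (abs_homEval_le x g))
      rw [real_inner_self_eq_norm_sq] at h1
      have : 0 < ‖x‖ := norm_pos_iff.2 h0
      nlinarith
    let u : Conv n :=
      { carrier := {x : Euc n | ∀ q, inner ℝ x q ≤ homEval q g}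
        convex' := by
          intro x hx y hy a b ha hb hab q
          rw [inner_add_left, real_inner_smul_left, real_inner_smul_left]
          have h1 := mul_le_mul_of_nonneg_left (hx q) ha
          have h2 := mul_le_mul_of_nonneg_left (hy q) hb
          calc _ ≤ a * homEval q g + b * homEval q g := add_le_add h1 h2
            _ = homEval q g := by rw [← add_mul, hab, one_mul]
        isCompact' := (isCompact_closedBall _ _).of_isClosed_subset hcl hbd
        nonempty' := ⟨_, (key 0).choose_spec.2⟩ }
    refine ⟨u, ext_homEval fun p => ?_⟩
    rw [homEval_supp]
    obtain ⟨x, hx1, hx2⟩ := key p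
    apply le_antisymm
    · exact supportValue_le fun y hy => hy p
    · rw [← hx1]
      exact inner_le_supportValue (u := u) hx2 p

/-- Sublinearity is a family of non-strict inequalities between continuous linear functionals of
`g`. Closedness gives completeness of `Conv n` and keeps Picard integrals inside the cone. -/
theorem isClosed_range_supp :
    IsClosed (range (supp : Conv n → C(Metric.sphere (0 : Euc n) 1, ℝ))) := by
  have : range (supp : Conv n → C(Metric.sphere (0 : Euc n) 1, ℝ)) =
      ⋂ p : Euc n, ⋂ q : Euc n, {g | homEval (p + q) g ≤ homEval p g + homEval q g} := by
    ext g
    simp only [mem_range_supp_iff, mem_iInter, mem_ofPred_eq]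
  rw [this]
  exact isClosed_iInter fun p => isClosed_iInter fun q => isClosed_le (by fun_prop) (by fun_prop)

theorem supp_add (u v : Conv n) : supp (u + v) = supp u + supp v :=
  ext_homEval fun p => by simp only [map_add, homEval_supp, supportValue_add]

theorem supp_smul (c : ℝ≥0) (u : Conv n) : supp (c • u) = (c : ℝ) • supp u :=
  ext_homEval fun p => by
    simp only [map_smul, homEval_supp, supportValue_smul, smul_eq_mul]

instance : CompleteSpace (Conv n) := by
  rw [completeSpace_iff_isComplete_range isometry_supp.isUniformInducing]
  exact isClosed_range_supp.isComplete

/-! ### Smooth convex functions whose gradient maps onto a convex body up to small error -/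

/-- `f` is a `C²` convex function with the same growth as the sublinear function `h`. -/
structure IsSmoothApprox (f h : Euc n → ℝ) : Prop where
  contDiff : ContDiff ℝ 2 f
  convex : ConvexOn ℝ univ f
  add_le : ∀ p v, f (p + v) ≤ f p + h v
  exists_le : ∃ C, ∀ p, h p - C ≤ f p

theorem IsSmoothApprox.add {f g h k : Euc n → ℝ} (hf : IsSmoothApprox f h)
    (hg : IsSmoothApprox g k) : IsSmoothApprox (f + g) (h + k) where
  contDiff := hf.contDiff.add hg.contDiff
  convex := hf.convex.add hg.convex
  add_le p v := by
    have h1 := hf.add_le p v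
    have h2 := hg.add_le p v
    simp only [Pi.add_apply]
    linarith
  exists_le := by
    obtain ⟨C, hC⟩ := hf.exists_le
    obtain ⟨D, hD⟩ := hg.exists_le
    refine ⟨C + D, fun p => ?_⟩
    have h1 := hC p
    have h2 := hD p
    simp only [Pi.add_apply]
    linarith

theorem IsSmoothApprox.smul {f h : Euc n → ℝ} (hf : IsSmoothApprox f h) {c : ℝ} (hc : 0 ≤ c) :
    IsSmoothApprox (c • f) (c • h) where
  contDiff := contDiff_const.smul hf.contDiff
  convex := hf.convex.smul hc
  add_le p v := by
    have h1 := mul_le_mul_of_nonneg_left (hf.add_le p v) hc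
    simp only [Pi.smul_apply, smul_eq_mul]
    linarith
  exists_le := by
    obtain ⟨C, hC⟩ := hf.exists_le
    refine ⟨c * C, fun p => ?_⟩
    have h1 := mul_le_mul_of_nonneg_left (hC p) hc
    simp only [Pi.smul_apply, smul_eq_mul]
    linarith

/-- Mollification: convolving with a nonnegative bump of mass one smooths the support function, and
each required inequality holds pointwise under the integral by sublinearity. -/
theorem exists_isSmoothApprox (u : Conv n) : ∃ f, IsSmoothApprox f (supportValue u) := by
  let ρ : ContDiffBump (0 : Euc n) := ⟨1, 2, one_pos, one_lt_two⟩
  have hρ0 : ∀ y, 0 ≤ ρ.normed volume y := fun y => ρ.nonneg_normed y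
  have hρ1 : ∫ y, ρ.normed volume y = 1 := ρ.integral_normed
  have hh := continuous_supportValue u
  have hρc : Continuous (ρ.normed volume) := (ρ.contDiff_normed (n := 0)).continuous
  have hρint : Integrable (ρ.normed volume) :=
    hρc.integrable_of_hasCompactSupport ρ.hasCompactSupport_normed
  have hint : ∀ p : Euc n, Integrable fun y => ρ.normed volume y * supportValue u (p - y) :=
    fun p => (hρc.mul (hh.comp (by fun_prop))).integrable_of_hasCompactSupport
      (ρ.hasCompactSupport_normed.mul_right)
  let f : Euc n → ℝ := convolution (ρ.normed volume) (supportValue u)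
    (ContinuousLinearMap.lsmul ℝ ℝ) volume
  have hf : ∀ p, f p = ∫ y, ρ.normed volume y * supportValue u (p - y) := fun p => rfl
  refine ⟨f, ?_, ⟨convex_univ, ?_⟩, ?_, ?_⟩
  · exact ρ.hasCompactSupport_normed.contDiff_convolution_left _ (n := 2) ρ.contDiff_normed
      hh.locallyIntegrable
  · intro p _ q _ a b ha hb hab
    rw [hf, hf, hf, smul_eq_mul, smul_eq_mul, ← integral_const_mul, ← integral_const_mul,
      ← integral_add ((hint p).const_mul a) ((hint q).const_mul b)]
    refine integral_mono (hint _) (((hint p).const_mul a).add ((hint q).const_mul b)) fun y => ?_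
    have e : a • p + b • q - y = a • (p - y) + b • (q - y) := by
      have : y = a • y + b • y := by rw [← add_smul, hab, one_smul]
      nth_rewrite 1 [this]
      module
    have h1 : supportValue u (a • p + b • q - y) ≤
        a * supportValue u (p - y) + b * supportValue u (q - y) := by
      rw [e, ← supportValue_smul_right u ha, ← supportValue_smul_right u hb]
      exact supportValue_add_right_le u _ _
    have := mul_le_mul_of_nonneg_left h1 (hρ0 y)
    dsimp only
    linarith
  · intro p v
    have e : supportValue u v = ∫ y, ρ.normed volume y * supportValue u v := by
      rw [integral_mul_const, hρ1, one_mul]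
    rw [hf, hf, e, ← integral_add (hint p) (hρint.mul_const _)]
    refine integral_mono (hint _) ((hint p).add (hρint.mul_const _)) fun y => ?_
    have h1 : supportValue u (p + v - y) ≤ supportValue u (p - y) + supportValue u v := by
      rw [show p + v - y = (p - y) + v by abel]
      exact supportValue_add_right_le u _ _
    have := mul_le_mul_of_nonneg_left h1 (hρ0 y)
    dsimp only
    linarith
  -- The bump is supported in the ball of radius 2, where shifting the argument changes the support
  -- function by at most `bodyNorm u * 2`.
  · refine ⟨bodyNorm u * 2, fun p => ?_⟩
    have e : supportValue u p - bodyNorm u * 2 =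
        ∫ y, ρ.normed volume y * (supportValue u p - bodyNorm u * 2) := by
      rw [integral_mul_const, hρ1, one_mul]
    rw [hf, e]
    refine integral_mono (hρint.mul_const _) (hint _) fun y => ?_
    dsimp only
    by_cases hy : ρ.normed volume y = 0
    · simp [hy]
    · have hy' : y ∈ Function.support (ρ.normed volume) := hy
      rw [ρ.support_normed_eq, mem_ball_zero_iff] at hy'
      have hy2 : ‖y‖ < 2 := hy'
      refine mul_le_mul_of_nonneg_left ?_ (hρ0 y)
      have h1 := supportValue_add_right_le u (p - y) y
      rw [sub_add_cancel] at h1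
      have h2 := (le_abs_self _).trans (abs_supportValue_le u y)
      have h3 : (bodyNorm u : ℝ) * ‖y‖ ≤ bodyNorm u * 2 := by gcongr
      linarith

/-- The strictly convex function `√(1 + ‖p‖²)`. -/
def softNorm (p : Euc n) : ℝ := √(1 + ‖p‖ ^ 2)

theorem softNorm_pos (p : Euc n) : 0 < softNorm p := Real.sqrt_pos.2 (by positivity)

theorem softNorm_sq (p : Euc n) : softNorm p ^ 2 = 1 + ‖p‖ ^ 2 := Real.sq_sqrt (by positivity)

/-- Strict Cauchy–Schwarz for the vectors $(1,p)$ and $(1,q)$: the difference of the squares is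
$\|p-q\|^2$ plus the Gram determinant of $p,q$. -/
theorem one_add_inner_lt_softNorm_mul {p q : Euc n} (h : p ≠ q) :
    1 + inner ℝ p q < softNorm p * softNorm q := by
  refine lt_of_pow_lt_pow_left₀ 2 (mul_pos (softNorm_pos p) (softNorm_pos q)).le ?_
  rw [mul_pow, softNorm_sq, softNorm_sq]
  have h1 : 0 < ‖p - q‖ ^ 2 := by
    have := norm_pos_iff.2 (sub_ne_zero.2 h)
    positivity
  rw [norm_sub_sq_real] at h1
  have h2 : inner ℝ p q ^ 2 ≤ (‖p‖ * ‖q‖) ^ 2 := by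
    rw [← sq_abs]
    exact pow_le_pow_left₀ (abs_nonneg _) (abs_real_inner_le_norm p q) 2
  nlinarith

theorem strictConvexOn_softNorm : StrictConvexOn ℝ univ (softNorm : Euc n → ℝ) := by
  refine ⟨convex_univ, ?_⟩
  intro p _ q _ hpq a b ha hb hab
  have h := one_add_inner_lt_softNorm_mul hpq
  refine lt_of_pow_lt_pow_left₀ 2 ?_ ?_
  · have := softNorm_pos p
    have := softNorm_pos q
    simp only [smul_eq_mul]
    positivity
  · rw [softNorm_sq, norm_add_sq_real, norm_smul, norm_smul, real_inner_smul_left,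
      real_inner_smul_right, Real.norm_of_nonneg ha.le, Real.norm_of_nonneg hb.le]
    have e : (a • softNorm p + b • softNorm q) ^ 2 =
        a ^ 2 * (1 + ‖p‖ ^ 2) + b ^ 2 * (1 + ‖q‖ ^ 2) + 2 * (a * b) * (softNorm p * softNorm q) := by
      rw [← softNorm_sq, ← softNorm_sq]
      simp only [smul_eq_mul]
      ring
    rw [e]
    have h2 := mul_lt_mul_of_pos_left h (show 0 < 2 * (a * b) by positivity)
    have h3 : (a + b) ^ 2 = 1 := by rw [hab, one_pow]
    nlinarith

theorem isSmoothApprox_softNorm : IsSmoothApprox (softNorm : Euc n → ℝ) norm where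
  contDiff := ContDiff.sqrt (contDiff_const.add (contDiff_norm_sq ℝ)) fun x => by positivity
  convex := strictConvexOn_softNorm.convexOn
  add_le p v := by
    have h0 := softNorm_pos p
    have h1 := softNorm_sq p
    have h2 := softNorm_sq (p + v)
    have h3 : inner ℝ p v ≤ softNorm p * ‖v‖ := (real_inner_le_norm p v).trans (by
      gcongr
      exact le_of_pow_le_pow_left₀ two_ne_zero h0.le (by rw [h1]; linarith))
    rw [norm_add_sq_real] at h2
    refine le_of_pow_le_pow_left₀ two_ne_zero (by positivity) ?_
    nlinarith
  exists_le := ⟨0, fun p => by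
    rw [sub_zero]
    refine le_of_pow_le_pow_left₀ two_ne_zero (softNorm_pos p).le ?_
    rw [softNorm_sq]
    linarith⟩

/-! ### Gradient maps of convex functions -/

theorem add_fderiv_le_of_convexOn {f : Euc n → ℝ} (hf : ConvexOn ℝ univ f) {p : Euc n}
    (hd : DifferentiableAt ℝ f p) (q : Euc n) : f p + fderiv ℝ f p (q - p) ≤ f q := by
  have h1 : ConvexOn ℝ univ (f ∘ AffineMap.lineMap p q : ℝ → ℝ) := by
    simpa using hf.comp_affineMap (AffineMap.lineMap (k := ℝ) p q)
  have h2 : HasDerivAt (f ∘ AffineMap.lineMap p q : ℝ → ℝ) (fderiv ℝ f p (q - p)) 0 := by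
    refine HasFDerivAt.comp_hasDerivAt (0 : ℝ) ?_ AffineMap.hasDerivAt_lineMap
    simpa using hd.hasFDerivAt
  have h3 := h1.le_slope_of_hasDerivAt (mem_univ 0) (mem_univ 1) one_pos h2
  simp [slope_def_field] at h3
  rw [map_sub]
  linarith

/-- If the derivatives at two points agree, adding the two tangent inequalities at the midpoint
contradicts strict convexity there. -/
theorem fderiv_injective_of_strictConvexOn {f : Euc n → ℝ} (hf : StrictConvexOn ℝ univ f)
    (hd : Differentiable ℝ f) : Function.Injective (fderiv ℝ f) := by
  intro p q h
  by_contra hpq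
  have h1 := add_fderiv_le_of_convexOn hf.convexOn (hd p) ((1 / 2 : ℝ) • p + (1 / 2 : ℝ) • q)
  have h2 := add_fderiv_le_of_convexOn hf.convexOn (hd q) ((1 / 2 : ℝ) • p + (1 / 2 : ℝ) • q)
  have h3 := hf.2 (mem_univ p) (mem_univ q) hpq (show (0 : ℝ) < 1 / 2 by norm_num)
    (show (0 : ℝ) < 1 / 2 by norm_num) (by norm_num)
  rw [← h] at h2
  have e : fderiv ℝ f p ((1 / 2 : ℝ) • p + (1 / 2 : ℝ) • q - p) +
      fderiv ℝ f p ((1 / 2 : ℝ) • p + (1 / 2 : ℝ) • q - q) = 0 := by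
    rw [← map_add, show (1 / 2 : ℝ) • p + (1 / 2 : ℝ) • q - p +
      ((1 / 2 : ℝ) • p + (1 / 2 : ℝ) • q - q) = 0 by module, map_zero]
  simp only [smul_eq_mul] at h3
  linarith

theorem differentiable_gradient {f : Euc n → ℝ} (hf : ContDiff ℝ 2 f) :
    Differentiable ℝ (gradient f) :=
  (InnerProductSpace.toDual ℝ (Euc n)).symm.toContinuousLinearEquiv.toContinuousLinearMap
    |>.differentiable.comp ((hf.fderiv_right (m := 1) (by norm_num)).differentiable (by norm_num))

/-- The gradient of a convex function is monotone along lines, so the derivative of its component in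
the direction of the line is nonnegative. -/
theorem inner_fderiv_gradient_nonneg {f : Euc n → ℝ} (hf : ContDiff ℝ 2 f)
    (hc : ConvexOn ℝ univ f) (p v : Euc n) : 0 ≤ inner ℝ (fderiv ℝ (gradient f) p v) v := by
  have hd : Differentiable ℝ f := hf.differentiable (by norm_num)
  have hmono : Monotone fun s : ℝ => inner ℝ (gradient f (p + s • v)) v := by
    intro s t hst
    have h1 := add_fderiv_le_of_convexOn hc (hd (p + s • v)) (p + t • v)
    have h2 := add_fderiv_le_of_convexOn hc (hd (p + t • v)) (p + s • v)
    rw [show p + t • v - (p + s • v) = (t - s) • v by module, map_smul, smul_eq_mul] at h1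
    rw [show p + s • v - (p + t • v) = (-(t - s)) • v by module, map_smul, smul_eq_mul] at h2
    simp only [inner_gradient_left]
    rcases hst.eq_or_lt with rfl | hlt
    · rfl
    · have h3 : 0 < t - s := sub_pos.2 hlt
      by_contra! h4
      nlinarith
  have hder : HasDerivAt (fun s : ℝ => inner ℝ (gradient f (p + s • v)) v)
      (inner ℝ (fderiv ℝ (gradient f) p v) v) 0 := by
    have h1 : HasDerivAt (fun s : ℝ => p + s • v) v 0 := by
      simpa using ((hasDerivAt_id (0 : ℝ)).smul_const v).const_add p
    have h2 : HasFDerivAt (gradient f) (fderiv ℝ (gradient f) p) (p + (0 : ℝ) • v) := by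
      simpa using (differentiable_gradient hf p).hasFDerivAt
    have h3 := (h2.comp_hasDerivAt (0 : ℝ) h1).inner ℝ (hasDerivAt_const (0 : ℝ) v)
    simpa using h3
  rw [← hder.deriv]
  exact hmono.deriv_nonneg

/-- On the segment from the identity to `T`, every operator before the end point has a positive
definite quadratic form and is invertible. The determinant therefore cannot change sign, and
symmetry of `T` plays no role. -/
theorem det_nonneg_of_inner_nonneg {T : Euc n →L[ℝ] Euc n} (h : ∀ v, 0 ≤ inner ℝ (T v) v) :
    0 ≤ T.det := by
  by_contra! hT
  let g : ℝ → ℝ := fun θ => ((1 - θ) • ContinuousLinearMap.id ℝ (Euc n) + θ • T).det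
  have hg : Continuous g := ContinuousLinearMap.continuous_det.comp (by fun_prop)
  have h0 : g 0 = 1 := by
    simp only [g, sub_zero, one_smul, zero_smul, add_zero]
    exact LinearMap.det_id
  have h1 : g 1 = T.det := by simp [g]
  obtain ⟨θ, hθ, hθ0⟩ := intermediate_value_Icc' zero_le_one hg.continuousOn
    (show (0 : ℝ) ∈ Icc (g 1) (g 0) by rw [h0, h1]; exact ⟨hT.le, zero_le_one⟩)
  have hθ1 : θ ≠ 1 := by
    rintro rfl
    rw [h1] at hθ0
    exact hT.ne hθ0
  have hlt : 0 < 1 - θ := sub_pos.2 (lt_of_le_of_ne hθ.2 hθ1)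
  obtain ⟨v, hv, hv0⟩ := (Submodule.ne_bot_iff _).1
    (LinearMap.bot_lt_ker_of_det_eq_zero (f := (((1 - θ) • ContinuousLinearMap.id ℝ (Euc n) +
      θ • T : Euc n →L[ℝ] Euc n) : Euc n →ₗ[ℝ] Euc n)) hθ0).ne'
  have hv' : (1 - θ) • v + θ • T v = 0 := by simpa using hv
  have h2 : inner ℝ ((1 - θ) • v + θ • T v) v = (0 : ℝ) := by rw [hv', inner_zero_left]
  rw [inner_add_left, real_inner_smul_left, real_inner_smul_left, real_inner_self_eq_norm_sq] at h2
  have h3 := mul_nonneg hθ.1 (h v)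
  have h4 : 0 < (1 - θ) * ‖v‖ ^ 2 := mul_pos hlt (pow_pos (norm_pos_iff.2 hv0) 2)
  linarith

theorem gradient_mem_of_add_le {f : Euc n → ℝ} {u : Conv n} (hd : Differentiable ℝ f)
    (hc : ConvexOn ℝ univ f) (h : ∀ p v, f (p + v) ≤ f p + supportValue u v) (p : Euc n) :
    gradient f p ∈ u := by
  refine mem_of_forall_inner_le_supportValue fun v => ?_
  rw [inner_gradient_left]
  have h1 := add_fderiv_le_of_convexOn hc (hd p) (p + v)
  rw [add_sub_cancel_left] at h1
  linarith [h p v]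

/-- The term `ε * ‖p‖` makes `f - ⟨y, ·⟩` coercive, so it attains a minimum, and there the gradient
of `f` is `y`. -/
theorem exists_gradient_eq {f : Euc n → ℝ} {u : Conv n} (hd : Differentiable ℝ f) {ε C : ℝ}
    (hε : 0 < ε) (h : ∀ p, supportValue u p + ε * ‖p‖ - C ≤ f p) {y : Euc n} (hy : y ∈ u) :
    ∃ p, gradient f p = y := by
  have hcoer : Filter.Tendsto (fun p => f p - inner ℝ y p) (Filter.cocompact (Euc n))
      Filter.atTop := by
    refine Filter.tendsto_atTop_mono (f := fun p : Euc n => ε * ‖p‖ + -C) (fun p => ?_)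
      (Filter.tendsto_atTop_add_const_right _ _
        ((tendsto_norm_cocompact_atTop).const_mul_atTop hε))
    have := inner_le_supportValue hy p
    linarith [h p]
  obtain ⟨p, hp⟩ := Continuous.exists_forall_le (f := fun p => f p - inner ℝ y p)
    (hd.continuous.sub (by fun_prop)) hcoer
  refine ⟨p, ?_⟩
  have hmin : IsLocalMin (fun p => f p - inner ℝ y p) p := Filter.Eventually.of_forall hp
  have hder : HasFDerivAt (fun p => f p - inner ℝ y p)
      (fderiv ℝ f p - innerSL ℝ y) p := (hd p).hasFDerivAt.sub (innerSL ℝ y).hasFDerivAt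
  have h0 := hmin.hasFDerivAt_eq_zero hder
  refine ext_inner_right ℝ fun v => ?_
  rw [inner_gradient_left, sub_eq_zero.1 h0]
  rfl

/-- Change of variables: strict convexity makes the gradient map injective, and convexity makes its
Jacobian nonnegative. -/
theorem lintegral_det_fderiv_gradient {f : Euc n → ℝ} (hf : ContDiff ℝ 2 f)
    (hc : StrictConvexOn ℝ univ f) :
    ∫⁻ p, ENNReal.ofReal (fderiv ℝ (gradient f) p).det = volume (range (gradient f)) := by
  have hinj : Function.Injective (gradient f) :=
    (InnerProductSpace.toDual ℝ (Euc n)).symm.injective.comp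
      (fderiv_injective_of_strictConvexOn hc (hf.differentiable (by norm_num)))
  rw [← image_univ, ← lintegral_abs_det_fderiv_eq_addHaar_image volume MeasurableSet.univ
    (fun p _ => (differentiable_gradient hf p).hasFDerivAt.hasFDerivWithinAt) hinj.injOn,
    Measure.restrict_univ]
  congr 1
  ext p
  rw [abs_of_nonneg (det_nonneg_of_inner_nonneg
    (inner_fderiv_gradient_nonneg hf hc.convexOn p))]

theorem continuous_det_fderiv_gradient {f : Euc n → ℝ} (hf : ContDiff ℝ 2 f) :
    Continuous fun p => (fderiv ℝ (gradient f) p).det := by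
  refine ContinuousLinearMap.continuous_det.comp ?_
  have h1 : ContDiff ℝ 1 (gradient f) :=
    (InnerProductSpace.toDual ℝ (Euc n)).symm.toContinuousLinearEquiv.contDiff.comp
      (hf.fderiv_right (m := 1) (by norm_num))
  exact h1.continuous_fderiv (by norm_num)

/-! ### Minkowski's polynomial expansion of the volume along `u + t w` -/

open Polynomial in
theorem exists_polynomial_det_add_smul (S T : Euc n →L[ℝ] Euc n) :
    ∃ P : ℝ[X], P.natDegree ≤ n ∧ ∀ t : ℝ, (S + t • T).det = P.eval t := by
  let b := (EuclideanSpace.basisFun (Fin n) ℝ).toBasis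
  let M := LinearMap.toMatrix b b (S : Euc n →ₗ[ℝ] Euc n)
  let K := LinearMap.toMatrix b b (T : Euc n →ₗ[ℝ] Euc n)
  refine ⟨((X : ℝ[X]) • K.map C + M.map C).det, ?_, fun t => ?_⟩
  · simpa using Polynomial.natDegree_det_X_add_C_le K M
  · have h1 : (S + t • T).det = (M + t • K).det := by
      rw [ContinuousLinearMap.det, ← LinearMap.det_toMatrix b]
      simp [M, K]
    rw [h1, ← Polynomial.coe_evalRingHom, RingHom.map_det]
    congr 1
    ext i j
    simp only [RingHom.mapMatrix_apply, Matrix.map_apply, Matrix.add_apply, Matrix.smul_apply,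
      smul_eq_mul, Polynomial.coe_evalRingHom, Polynomial.eval_add, Polynomial.eval_mul,
      Polynomial.eval_X, Polynomial.eval_C]
    ring

/-- The value at `t` of the Lagrange basis polynomial of the nodes `0, …, n` at the node `j`. -/
def lagrangeCoeff (n j : ℕ) : Polynomial ℝ :=
  Lagrange.basis (Finset.range (n + 1)) (fun i : ℕ => (i : ℝ)) j

/-- Having degree at most `n` is expressed as a fixed linear relation among values, a form that
survives integration in `p` and the limit `ε → 0`. -/
theorem eval_eq_sum_lagrangeCoeff {P : Polynomial ℝ} (hP : P.natDegree ≤ n) (t : ℝ) :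
    P.eval t = ∑ j ∈ Finset.range (n + 1), P.eval (j : ℝ) * (lagrangeCoeff n j).eval t := by
  have h := Lagrange.eq_interpolate (s := Finset.range (n + 1)) (v := fun i : ℕ => (i : ℝ))
    (f := P) (Nat.cast_injective.injOn) (by
      rw [Finset.card_range]
      exact lt_of_le_of_lt Polynomial.degree_le_natDegree (by exact_mod_cast Nat.lt_succ_of_le hP))
  conv_lhs => rw [h]
  rw [Lagrange.interpolate_apply, Polynomial.eval_finsetSum]
  simp [lagrangeCoeff]

theorem volume_ne_top (u : Conv n) : volume (u : Set (Euc n)) ≠ ⊤ := u.isCompact.measure_ne_top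

theorem vol_mono {u v : Conv n} (h : (u : Set (Euc n)) ⊆ v) : vol u ≤ vol v :=
  ENNReal.toNNReal_mono (volume_ne_top v) (measure_mono h)

open scoped Pointwise in
theorem coe_add_smul_unitBall (u : Conv n) (r : ℝ≥0) :
    ((u + r • unitBall n : Conv n) : Set (Euc n)) = Metric.cthickening r (u : Set (Euc n)) := by
  rw [← u.isCompact.add_closedBall_zero r.coe_nonneg, ConvexBody.coe_add, ConvexBody.coe_smul']
  congr 1
  change (r : ℝ) • Metric.closedBall (0 : Euc n) 1 = _
  rw [smul_closedBall _ _ zero_le_one]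
  simp

theorem tendsto_vol_add_smul_unitBall (u : Conv n) :
    Filter.Tendsto (fun r : ℝ≥0 => (vol (u + r • unitBall n) : ℝ)) (nhds 0) (nhds (vol u)) := by
  have h1 := tendsto_measure_cthickening_of_isCompact (μ := volume) u.isCompact
  have h2 : Filter.Tendsto (fun r : ℝ≥0 => (r : ℝ)) (nhds 0) (nhds 0) :=
    (NNReal.continuous_coe.tendsto 0)
  have h3 := (ENNReal.tendsto_toReal (volume_ne_top u)).comp (h1.comp h2)
  refine h3.congr fun r => ?_
  simp only [Function.comp, ← coe_add_smul_unitBall]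
  rfl

theorem strictConvexOn_smul_softNorm {ε : ℝ} (hε : 0 < ε) :
    StrictConvexOn ℝ univ (ε • softNorm : Euc n → ℝ) := by
  refine ⟨convex_univ, fun p hp q hq hpq a b ha hb hab => ?_⟩
  have := mul_lt_mul_of_pos_left (strictConvexOn_softNorm.2 hp hq hpq ha hb hab) hε
  simp only [Pi.smul_apply, smul_eq_mul] at this ⊢
  linarith

/-- For smooth strictly convex approximations the gradient image has volume `∫ det (S + t T)`, whose
integrand is polynomial in `t` of degree at most `n`. That image lies between the body and its
`ε`-thickening, so the relation passes to the limit. -/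
theorem vol_add_smul_eq_sum (u w : Conv n) (t : ℝ≥0) :
    (vol (u + t • w) : ℝ) = ∑ j ∈ Finset.range (n + 1),
      (vol (u + (j : ℝ≥0) • w) : ℝ) * (lagrangeCoeff n j).eval (t : ℝ) := by
  obtain ⟨f, hf⟩ := exists_isSmoothApprox u
  obtain ⟨g, hg⟩ := exists_isSmoothApprox w
  let F : ℝ≥0 → ℝ≥0 → Euc n → ℝ := fun ε t => f + (t : ℝ) • g + (ε : ℝ) • softNorm
  have hF : ∀ ε t, IsSmoothApprox (F ε t)
      (supportValue u + (t : ℝ) • supportValue w + (ε : ℝ) • norm) := fun ε t =>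
    (hf.add (hg.smul t.2)).add (isSmoothApprox_softNorm.smul ε.2)
  have hFs : ∀ ε t : ℝ≥0, 0 < ε → StrictConvexOn ℝ univ (F ε t) := fun ε t hε =>
    (hf.add (hg.smul t.2)).convex.add_strictConvexOn
      (strictConvexOn_smul_softNorm (NNReal.coe_pos.2 hε))
  let I : ℝ≥0 → ℝ≥0 → ℝ := fun ε t => (volume (range (gradient (F ε t)))).toReal
  have hlow : ∀ ε t : ℝ≥0, 0 < ε → ((u + t • w : Conv n) : Set (Euc n)) ⊆
      range (gradient (F ε t)) := by
    intro ε t hε y hy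
    obtain ⟨C, hC⟩ := (hF ε t).exists_le
    refine exists_gradient_eq ((hF ε t).contDiff.differentiable (by norm_num))
      (NNReal.coe_pos.2 hε) (C := C) (fun p => ?_) hy
    rw [supportValue_add, supportValue_smul]
    exact hC p
  have hup : ∀ ε t : ℝ≥0, range (gradient (F ε t)) ⊆
      (((u + t • w) + ε • unitBall n : Conv n) : Set (Euc n)) := by
    rintro ε t _ ⟨p, rfl⟩
    refine gradient_mem_of_add_le ((hF ε t).contDiff.differentiable (by norm_num))
      (hF ε t).convex (fun p v => ?_) p
    rw [supportValue_add, supportValue_add, supportValue_smul, supportValue_smul,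
      supportValue_unitBall]
    exact (hF ε t).add_le p v
  have hfin : ∀ ε t : ℝ≥0, volume (range (gradient (F ε t))) ≠ ⊤ := fun ε t =>
    ne_top_of_le_ne_top (volume_ne_top _) (measure_mono (hup ε t))
  have hlim : ∀ t, Filter.Tendsto (fun ε => I ε t) (nhdsWithin 0 (Ioi 0))
      (nhds (vol (u + t • w))) := by
    intro t
    refine tendsto_of_tendsto_of_tendsto_of_le_of_le' tendsto_const_nhds
      ((tendsto_vol_add_smul_unitBall (u + t • w)).mono_left nhdsWithin_le_nhds) ?_ ?_
    · filter_upwards [self_mem_nhdsWithin] with ε hε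
      exact ENNReal.toReal_mono (hfin ε t) (measure_mono (hlow ε t hε))
    · filter_upwards with ε
      exact ENNReal.toReal_mono (volume_ne_top _) (measure_mono (hup ε t))
  have hI : ∀ ε t : ℝ≥0, 0 < ε → Integrable (fun p => (fderiv ℝ (gradient (F ε t)) p).det) ∧
      I ε t = ∫ p, (fderiv ℝ (gradient (F ε t)) p).det := by
    intro ε t hε
    have h1 := lintegral_det_fderiv_gradient (hF ε t).contDiff (hFs ε t hε)
    have h2 := continuous_det_fderiv_gradient (hF ε t).contDiff
    have h3 : ∀ p, 0 ≤ (fderiv ℝ (gradient (F ε t)) p).det := fun p =>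
      det_nonneg_of_inner_nonneg
        (inner_fderiv_gradient_nonneg (hF ε t).contDiff (hF ε t).convex p)
    refine ⟨⟨h2.aestronglyMeasurable, ?_⟩, ?_⟩
    · rw [hasFiniteIntegral_iff_ofReal (Filter.Eventually.of_forall h3), h1]
      exact (hfin ε t).lt_top
    · rw [integral_eq_lintegral_of_nonneg_ae (Filter.Eventually.of_forall h3)
        h2.aestronglyMeasurable, h1]
  have hpoly : ∀ (ε t : ℝ≥0) (p : Euc n), (fderiv ℝ (gradient (F ε t)) p).det =
      ∑ j ∈ Finset.range (n + 1), (fderiv ℝ (gradient (F ε j)) p).det *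
        (lagrangeCoeff n j).eval (t : ℝ) := by
    intro ε t p
    have hsm : ContDiff ℝ 2 (f + (ε : ℝ) • softNorm) :=
      (hf.add (isSmoothApprox_softNorm.smul ε.2)).contDiff
    -- The Hessian of the approximation is affine in `t`, which makes its determinant a polynomial.
    have hgrad : ∀ t : ℝ≥0, fderiv ℝ (gradient (F ε t)) p =
        fderiv ℝ (gradient (f + (ε : ℝ) • softNorm)) p + (t : ℝ) • fderiv ℝ (gradient g) p := by
      intro t
      have e : gradient (F ε t) = gradient (f + (ε : ℝ) • softNorm) + (t : ℝ) • gradient g := by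
        funext q
        have e1 : F ε t = (f + (ε : ℝ) • softNorm) + (t : ℝ) • g := by
          simp only [F]
          abel
        have hg' : DifferentiableAt ℝ g q := hg.contDiff.differentiable (by norm_num) q
        rw [e1, Pi.add_apply, Pi.smul_apply, gradient, gradient, gradient,
          fderiv_add (hsm.differentiable (by norm_num) q) (hg'.const_smul _),
          fderiv_const_smul hg', map_add]
        simp
      rw [e, fderiv_add (differentiable_gradient hsm p)
        ((differentiable_gradient hg.contDiff p).const_smul _),
        fderiv_const_smul (differentiable_gradient hg.contDiff p)]
    obtain ⟨P, hP, hPe⟩ := exists_polynomial_det_add_smul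
      (fderiv ℝ (gradient (f + (ε : ℝ) • softNorm)) p) (fderiv ℝ (gradient g) p)
    simp only [hgrad, hPe, NNReal.coe_natCast]
    exact eval_eq_sum_lagrangeCoeff hP t
  have hsum : ∀ ε : ℝ≥0, 0 < ε → I ε t = ∑ j ∈ Finset.range (n + 1),
      I ε j * (lagrangeCoeff n j).eval (t : ℝ) := by
    intro ε hε
    rw [(hI ε t hε).2]
    simp only [hpoly ε t]
    rw [integral_finsetSum _ fun (j : ℕ) _ => (hI ε j hε).1.mul_const _]
    refine Finset.sum_congr rfl fun j _ => ?_
    rw [integral_mul_const, (hI ε j hε).2]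
  have hlim2 : Filter.Tendsto (fun ε => I ε t) (nhdsWithin 0 (Ioi 0))
      (nhds (∑ j ∈ Finset.range (n + 1),
        (vol (u + (j : ℝ≥0) • w) : ℝ) * (lagrangeCoeff n j).eval (t : ℝ))) := by
    have h1 := tendsto_finsetSum (Finset.range (n + 1)) fun j _ =>
      (hlim (j : ℝ≥0)).mul_const ((lagrangeCoeff n j).eval (t : ℝ))
    refine h1.congr' ?_
    filter_upwards [self_mem_nhdsWithin] with ε hε
    exact (hsum ε hε).symm
  exact tendsto_nhds_unique (hlim t) hlim2

/-- The polynomial `t ↦ V[u + t w]`. -/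
def volPoly (u w : Conv n) : Polynomial ℝ :=
  Lagrange.interpolate (Finset.range (n + 1)) (fun i : ℕ => (i : ℝ))
    fun j => (vol (u + (j : ℝ≥0) • w) : ℝ)

theorem eval_volPoly_eq_sum (u w : Conv n) (t : ℝ) :
    (volPoly u w).eval t = ∑ j ∈ Finset.range (n + 1),
      (vol (u + (j : ℝ≥0) • w) : ℝ) * (lagrangeCoeff n j).eval t := by
  rw [volPoly, Lagrange.interpolate_apply, Polynomial.eval_finsetSum]
  simp [lagrangeCoeff]

theorem eval_volPoly (u w : Conv n) (t : ℝ≥0) :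
    (volPoly u w).eval (t : ℝ) = vol (u + t • w) := by
  rw [vol_add_smul_eq_sum, eval_volPoly_eq_sum]

theorem natDegree_volPoly_le (u w : Conv n) : (volPoly u w).natDegree ≤ n := by
  have h := Lagrange.degree_interpolate_lt (s := Finset.range (n + 1))
    (v := fun i : ℕ => (i : ℝ)) (fun j => (vol (u + (j : ℝ≥0) • w) : ℝ))
    (Nat.cast_injective.injOn)
  rw [Finset.card_range] at h
  exact Polynomial.natDegree_le_of_degree_le (Order.lt_succ_iff.1 h)

/-! ### Regularity of the volume -/

theorem subset_add_smul_unitBall {u v : Conv n} {r : ℝ≥0} (h : dist u v ≤ r) :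
    (u : Set (Euc n)) ⊆ (v + r • unitBall n : Conv n) := by
  refine subset_of_supportValue_le fun p => ?_
  rw [supportValue_add, supportValue_smul, supportValue_unitBall]
  have h1 := supportValue_le_add_dist u v p
  have h2 := mul_le_mul_of_nonneg_right h (norm_nonneg p)
  linarith

theorem bodyNorm_le_add_dist (u v : Conv n) : (bodyNorm u : ℝ) ≤ bodyNorm v + dist u v := by
  change ‖supp u‖ ≤ ‖supp v‖ + dist u v
  rw [← isometry_supp.dist_eq u v, dist_eq_norm]
  have := norm_add_le (supp v) (supp u - supp v)
  rwa [add_sub_cancel] at this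

theorem Polynomial.exists_abs_eval_sub_le (P : Polynomial ℝ) :
    ∃ K : ℝ, 0 ≤ K ∧ ∀ d ∈ Icc (0 : ℝ) 1, |P.eval d - P.eval 0| ≤ K * d := by
  obtain ⟨K, hK⟩ := (isCompact_Icc (a := (0 : ℝ)) (b := 1)).exists_bound_of_continuousOn
    P.divX.continuous.continuousOn
  refine ⟨K, (norm_nonneg _).trans (hK 0 (by simp)), fun d hd => ?_⟩
  have h1 : P.eval d - P.eval 0 = P.divX.eval d * d := by
    conv_lhs => rw [← Polynomial.divX_mul_X_add P]
    simp
  rw [h1, abs_mul, abs_of_nonneg hd.1]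
  exact mul_le_mul_of_nonneg_right (hK d hd) hd.1

/-- If `d = dist u v` then `u ⊆ v + d B`, so `V[u] - V[v]` is at most the increment over `[0, d]` of
the Steiner polynomial of `v`. Its coefficients are bounded locally uniformly in `v`. -/
theorem locallyLipschitz_vol : LocallyLipschitz (vol : Conv n → ℝ≥0) := by
  choose K hK0 hK using fun j => Polynomial.exists_abs_eval_sub_le (lagrangeCoeff n j)
  intro u₀
  let R : ℝ≥0 := bodyNorm u₀ + 1
  -- This bounds the volumes of `v + j B` at all interpolation nodes `j ≤ n` when `v` has norm at
  -- most `R`.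
  let M : ℝ≥0 := vol (R • unitBall n + (n : ℝ≥0) • unitBall n)
  let L : ℝ := ∑ j ∈ Finset.range (n + 1), M * K j
  have hL : 0 ≤ L := Finset.sum_nonneg fun j _ => mul_nonneg M.2 (hK0 j)
  have key : ∀ u v : Conv n, bodyNorm v ≤ R → dist u v ≤ 1 →
      (vol u : ℝ) - vol v ≤ L * dist u v := by
    intro u v hv huv
    let d : ℝ≥0 := ⟨dist u v, dist_nonneg⟩
    have h1 : (vol u : ℝ) ≤ vol (v + d • unitBall n) := by
      exact_mod_cast vol_mono (subset_add_smul_unitBall (le_refl (dist u v)))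
    have h2 : (vol v : ℝ) = vol (v + (0 : ℝ≥0) • unitBall n) := by rw [zero_smul, add_zero]
    have h3 : ∀ j ∈ Finset.range (n + 1), (vol (v + (j : ℝ≥0) • unitBall n) : ℝ) ≤ M := by
      intro j hj
      have hjn : (j : ℝ≥0) ≤ n := by exact_mod_cast Nat.lt_succ_iff.1 (Finset.mem_range.1 hj)
      refine NNReal.coe_le_coe.2 (vol_mono (subset_of_supportValue_le fun p => ?_))
      simp only [supportValue_add, supportValue_smul, supportValue_unitBall]
      have h4 := (le_abs_self _).trans (abs_supportValue_le v p)
      have h5 : (bodyNorm v : ℝ) * ‖p‖ ≤ R * ‖p‖ := by gcongr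
      have h6 : ((j : ℝ≥0) : ℝ) * ‖p‖ ≤ ((n : ℝ≥0) : ℝ) * ‖p‖ := by gcongr
      linarith
    calc (vol u : ℝ) - vol v ≤ vol (v + d • unitBall n) - vol (v + (0 : ℝ≥0) • unitBall n) := by
          rw [← h2]; linarith
      _ = ∑ j ∈ Finset.range (n + 1), (vol (v + (j : ℝ≥0) • unitBall n) : ℝ) *
            ((lagrangeCoeff n j).eval (d : ℝ) - (lagrangeCoeff n j).eval 0) := by
          rw [vol_add_smul_eq_sum v _ d, vol_add_smul_eq_sum v _ 0, ← Finset.sum_sub_distrib]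
          simp only [mul_sub, NNReal.coe_zero]
      _ ≤ ∑ j ∈ Finset.range (n + 1), M * (K j * dist u v) := by
          refine Finset.sum_le_sum fun j hj => ?_
          have h4 : (lagrangeCoeff n j).eval (d : ℝ) - (lagrangeCoeff n j).eval 0 ≤
              K j * dist u v := (le_abs_self _).trans (hK j d ⟨d.2, huv⟩)
          exact (mul_le_mul_of_nonneg_left h4 (NNReal.coe_nonneg _)).trans
            (mul_le_mul_of_nonneg_right (h3 j hj) (mul_nonneg (hK0 j) dist_nonneg))
      _ = L * dist u v := by
          rw [Finset.sum_mul]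
          exact Finset.sum_congr rfl fun j _ => by ring
  -- Radius `1 / 2` keeps any two bodies at distance at most `1`, the range on which the Lagrange
  -- polynomials were estimated.
  refine ⟨⟨L, hL⟩, Metric.ball u₀ (1 / 2), Metric.ball_mem_nhds _ (by norm_num), ?_⟩
  have hR : ∀ u ∈ Metric.ball u₀ (1 / 2 : ℝ), bodyNorm u ≤ R := by
    intro u hu
    have h1 := bodyNorm_le_add_dist u u₀
    have h2 : dist u u₀ < 1 / 2 := hu
    rw [← NNReal.coe_le_coe]
    change (bodyNorm u : ℝ) ≤ bodyNorm u₀ + 1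
    linarith
  refine LipschitzOnWith.of_dist_le_mul fun u hu v hv => ?_
  have huv : dist u v ≤ 1 := by
    have h1 : dist u u₀ < 1 / 2 := hu
    have h2 : dist v u₀ < 1 / 2 := hv
    have := dist_triangle_right u v u₀
    linarith
  have h1 := key u v (hR v hv) huv
  have h2 := key v u (hR u hu) (by rwa [dist_comm])
  rw [dist_comm v u] at h2
  rw [NNReal.dist_eq, abs_le]
  change -(L * dist u v) ≤ _ ∧ _ ≤ L * dist u v
  constructor <;> linarith

theorem continuous_vol : Continuous (vol : Conv n → ℝ≥0) := locallyLipschitz_vol.continuous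

theorem hasDerivWithinAt_vol_add_smul (u w : Conv n) :
    HasDerivWithinAt (fun s : ℝ => (vol (u + s.toNNReal • w) : ℝ)) ((volPoly u w).coeff 1)
      (Ici 0) 0 := by
  have h1 : HasDerivAt (fun s => (volPoly u w).eval s) ((volPoly u w).derivative.eval 0) 0 :=
    (volPoly u w).hasDerivAt 0
  have h2 : (volPoly u w).derivative.eval 0 = (volPoly u w).coeff 1 := by
    rw [← Polynomial.coeff_zero_eq_eval_zero, Polynomial.coeff_derivative]
    simp
  rw [h2] at h1
  refine h1.hasDerivWithinAt.congr (fun s hs => ?_) ?_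
  · rw [← eval_volPoly, Real.coe_toNNReal s hs]
  · rw [← eval_volPoly]
    simp

/-! ### The first mixed volume -/

open scoped Pointwise in
theorem vol_smul (c : ℝ≥0) (u : Conv n) : vol (c • u) = c ^ n * vol u := by
  rw [vol, vol, ConvexBody.coe_smul']
  change (volume ((c : ℝ) • (u : Set (Euc n)))).toNNReal = _
  rw [Measure.addHaar_smul, ENNReal.toNNReal_mul, finrank_euclideanSpace_fin,
    abs_of_nonneg (by positivity), ENNReal.ofReal_pow (by positivity), ENNReal.toNNReal_pow,
    ENNReal.ofReal_coe_nnreal, ENNReal.toNNReal_coe]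

/-- Homogeneity of the volume: $V[w+xu]=x^nV[u+x^{-1}w]$ for $x>0$. -/
theorem volPoly_swap (u w : Conv n) : volPoly w u = (volPoly u w).reflect n := by
  refine Polynomial.eq_of_infinite_eval_eq _ _ ((Ioi_infinite (0 : ℝ)).mono fun x hx => ?_)
  have hx0 : (0 : ℝ) < x := hx
  lift x to ℝ≥0 using hx0.le
  have hx0' : x ≠ 0 := by
    rintro rfl
    exact lt_irrefl _ hx0
  change (volPoly w u).eval (x : ℝ) = ((volPoly u w).reflect n).eval (x : ℝ)
  let _ : Invertible ((x⁻¹ : ℝ≥0) : ℝ) := invertibleOfNonzero (by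
    simpa using hx0')
  have h := Polynomial.eval₂_reflect_mul_pow (RingHom.id ℝ) ((x⁻¹ : ℝ≥0) : ℝ) n (volPoly u w)
    (natDegree_volPoly_le u w)
  rw [invOf_eq_inv, NNReal.coe_inv, inv_inv] at h
  simp only [Polynomial.eval₂_id] at h
  rw [← NNReal.coe_inv, eval_volPoly] at h
  have e : w + x • u = x • (u + x⁻¹ • w) := by
    rw [smul_add, smul_smul, mul_inv_cancel₀ hx0', one_smul, add_comm]
  rw [eval_volPoly, e, vol_smul, NNReal.coe_mul, ← h]
  push_cast
  rw [mul_comm, mul_assoc, inv_pow, inv_mul_cancel₀ (by positivity), mul_one]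

theorem fwdDiff_iter_eval_eq_factorial_mul_coeff {P : Polynomial ℝ} {m : ℕ}
    (hP : P.natDegree ≤ m) (x : ℝ) : (fwdDiff (1 : ℝ))^[m] P.eval x = m.factorial * P.coeff m := by
  rcases hP.lt_or_eq with h | rfl
  · rw [Polynomial.fwdDiff_iter_eq_zero_of_degree_lt h,
      Polynomial.coeff_eq_zero_of_natDegree_lt h]
    simp
  · rw [Polynomial.fwdDiff_iter_degree_eq_factorial]
    simp [mul_comm]

/-- With `n = m + 1`, pair each index set avoiding the single slot of `w` with the one containing
it. The polarization sum becomes the `m`-th finite difference at `0` of $j\mapsto V[w+ju]-V[ju]$.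
This has degree at most `m`, so the difference is `m!` times its coefficient of degree `m`, which by
`volPoly_swap` is the linear coefficient of $V[u+tw]$. -/
theorem natCast_mul_mixedVolumeTwo_one (hn : 0 < n) (u w : Conv n) :
    n * mixedVolumeTwo 1 u w = (volPoly u w).coeff 1 := by
  obtain ⟨m, rfl⟩ : ∃ m, n = m + 1 := ⟨n - 1, by omega⟩
  let K : Fin (m + 1) → Conv (m + 1) := fun i => if (i : ℕ) < m + 1 - 1 then u else w
  let P := volPoly w u
  -- The coefficient of `X ^ (m + 1)` in `P` is `vol u`; subtracting that term lowers the degree to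
  -- `m`.
  let R : Polynomial ℝ := P - Polynomial.C (vol u : ℝ) * Polynomial.X ^ (m + 1)
  have hPc : ∀ i, P.coeff i = (volPoly u w).coeff (Polynomial.revAt (m + 1) i) := fun i => by
    simp only [P]
    rw [volPoly_swap, Polynomial.coeff_reflect]
  have hQ0 : (volPoly u w).coeff 0 = vol u := by
    rw [Polynomial.coeff_zero_eq_eval_zero]
    have := eval_volPoly u w 0
    simpa using this
  have hR : R.natDegree ≤ m := by
    rw [Polynomial.natDegree_le_iff_coeff_eq_zero]
    intro i hi
    have hi' : m + 1 ≤ i := hi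
    rcases hi'.eq_or_lt with rfl | hlt
    · simp [R, hPc, Polynomial.revAt_le, hQ0]
    · have h1 : P.coeff i = 0 := Polynomial.coeff_eq_zero_of_natDegree_lt
        ((natDegree_volPoly_le w u).trans_lt hlt)
      simp [R, h1, Polynomial.coeff_X_pow, hlt.ne']
  have hRm : R.coeff m = (volPoly u w).coeff 1 := by
    simp [R, hPc, Polynomial.coeff_X_pow, Polynomial.revAt_le]
  have hRe : ∀ j : ℕ, R.eval (j : ℝ) = vol (w + (j : ℝ≥0) • u) - vol ((j : ℝ≥0) • u) := by
    intro j
    have := eval_volPoly w u j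
    simp only [NNReal.coe_natCast] at this
    simp only [R, P, Polynomial.eval_sub, Polynomial.eval_mul, Polynomial.eval_C,
      Polynomial.eval_pow, Polynomial.eval_X, this, vol_smul, NNReal.coe_mul, NNReal.coe_pow,
      NNReal.coe_natCast]
    ring
  let s : Finset (Fin (m + 1)) := Finset.univ.erase (Fin.last m)
  have hs : s.card = m := by simp [s]
  have hsu : (Finset.univ : Finset (Finset (Fin (m + 1)))) =
      (insert (Fin.last m) s).powerset := by
    rw [Finset.insert_erase (Finset.mem_univ _)]
    simp
  have hK : ∀ S ∈ s.powerset, ∑ i ∈ S, K i = (S.card : ℝ≥0) • u := by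
    intro S hS
    rw [Finset.mem_powerset] at hS
    have : ∀ i ∈ S, K i = u := by
      intro i hi
      have h1 : i ≠ Fin.last m := Finset.ne_of_mem_erase (hS hi)
      have h2 : (i : ℕ) < m := Fin.val_lt_last h1
      simp [K, h2]
    rw [Finset.sum_congr rfl this, Finset.sum_const, Nat.cast_smul_eq_nsmul]
  have hlast : Fin.last m ∉ s := Finset.notMem_erase _ _
  have hKl : K (Fin.last m) = w := by simp [K]
  have hsum : ∑ S : Finset (Fin (m + 1)), (-1 : ℝ) ^ (m + 1 - S.card) *
      (vol (∑ i ∈ S, K i) : ℝ) = m.factorial * (volPoly u w).coeff 1 := by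
    rw [hsu, Finset.sum_powerset_insert hlast, ← Finset.sum_add_distrib]
    have h1 : ∀ S ∈ s.powerset, (-1 : ℝ) ^ (m + 1 - S.card) * (vol (∑ i ∈ S, K i) : ℝ) +
        (-1 : ℝ) ^ (m + 1 - (insert (Fin.last m) S).card) *
          (vol (∑ i ∈ insert (Fin.last m) S, K i) : ℝ) =
        (fun j : ℕ => (-1 : ℝ) ^ (m - j) * R.eval (j : ℝ)) S.card := by
      intro S hS
      have hnot : Fin.last m ∉ S := fun h => hlast (Finset.mem_powerset.1 hS h)
      have hle : S.card ≤ m := 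
        (Finset.card_le_card (Finset.mem_powerset.1 hS)).trans hs.le
      rw [Finset.sum_insert hnot, Finset.card_insert_of_notMem hnot, hK S hS, hKl]
      simp only [hRe]
      rw [show m + 1 - S.card = m - S.card + 1 by omega,
        show m + 1 - (S.card + 1) = m - S.card by omega, pow_succ]
      ring
    rw [Finset.sum_congr rfl h1,
      Finset.sum_powerset_apply_card (fun j : ℕ => (-1 : ℝ) ^ (m - j) * R.eval (j : ℝ)), hs, ← hRm,
      ← fwdDiff_iter_eval_eq_factorial_mul_coeff hR 0, fwdDiff_iter_eq_sum_shift]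
    refine Finset.sum_congr rfl fun j _ => ?_
    simp only [nsmul_eq_mul, zsmul_eq_mul, zero_add, mul_one]
    push_cast
    ring
  rw [mixedVolumeTwo, mixedVolume, hsum, Nat.factorial_succ]
  have hm : (m.factorial : ℝ) ≠ 0 := by exact_mod_cast m.factorial_ne_zero
  push_cast
  field_simp

/-! ### Linear images -/

theorem imageBody_add (B : Euc n →L[ℝ] Euc n) (u v : Conv n) :
    imageBody B (u + v) = imageBody B u + imageBody B v :=
  eq_of_supportValue_eq fun p => by simp only [supportValue_imageBody, supportValue_add]

theorem imageBody_smul (B : Euc n →L[ℝ] Euc n) (c : ℝ≥0) (u : Conv n) :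
    imageBody B (c • u) = c • imageBody B u :=
  eq_of_supportValue_eq fun p => by simp only [supportValue_imageBody, supportValue_smul]

theorem imageBody_comp (B D : Euc n →L[ℝ] Euc n) (u : Conv n) :
    imageBody B (imageBody D u) = imageBody (B * D) u :=
  ConvexBody.ext (by
    change B '' (D '' (u : Set (Euc n))) = (B * D) '' (u : Set (Euc n))
    rw [image_image]
    rfl)

theorem imageBody_one (u : Conv n) : imageBody 1 u = u :=
  ConvexBody.ext (by
    change (fun x => x) '' (u : Set (Euc n)) = u
    rw [image_id'])

theorem vol_imageBody (B : Euc n →L[ℝ] Euc n) (u : Conv n) :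
    (vol (imageBody B u) : ℝ) = |B.det| * vol u := by
  change (volume (B '' (u : Set (Euc n)))).toReal = |B.det| * (volume (u : Set (Euc n))).toReal
  rw [Measure.addHaar_image_continuousLinearMap, ENNReal.toReal_mul,
    ENNReal.toReal_ofReal (abs_nonneg _)]

theorem volPoly_imageBody (B : Euc n →L[ℝ] Euc n) (u w : Conv n) :
    volPoly (imageBody B u) (imageBody B w) = Polynomial.C |B.det| * volPoly u w := by
  refine Polynomial.eq_of_infinite_eval_eq _ _ ((Ioi_infinite (0 : ℝ)).mono fun x hx => ?_)
  lift x to ℝ≥0 using le_of_lt hx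
  change (volPoly _ _).eval (x : ℝ) = Polynomial.eval (x : ℝ) _
  rw [Polynomial.eval_mul, Polynomial.eval_C, eval_volPoly, eval_volPoly, ← vol_imageBody,
    imageBody_add, imageBody_smul]

theorem norm_imageBody_le (B : Euc n →L[ℝ] Euc n) (u : Conv n) :
    (bodyNorm (imageBody B u) : ℝ) ≤ ‖B‖ * bodyNorm u := by
  refine bodyNorm_le_of_forall_mem (by positivity) ?_
  rintro _ ⟨x, hx, rfl⟩
  exact (B.le_opNorm x).trans (by gcongr; exact norm_le_bodyNorm hx)

theorem dist_imageBody_le (B D : Euc n →L[ℝ] Euc n) (u v : Conv n) :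
    dist (imageBody B u) (imageBody D v) ≤ ‖B‖ * dist u v + ‖B - D‖ * bodyNorm v := by
  have key : ∀ u v : Conv n, ∀ B D : Euc n →L[ℝ] Euc n, ∀ x ∈ imageBody B u,
      ∃ y ∈ imageBody D v, dist x y ≤ ‖B‖ * dist u v + ‖B - D‖ * bodyNorm v := by
    rintro u v B D _ ⟨x, hx, rfl⟩
    obtain ⟨y, hy, hxy⟩ := exists_dist_le_of_mem (v := v) hx
    refine ⟨D y, mem_image_of_mem D hy, ?_⟩
    have h1 : B x - D y = B (x - y) + (B - D) y := by simp
    rw [dist_eq_norm, h1]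
    refine (norm_add_le _ _).trans (add_le_add ((B.le_opNorm _).trans ?_)
      (((B - D).le_opNorm _).trans ?_))
    · rw [← dist_eq_norm]
      gcongr
    · gcongr
      exact norm_le_bodyNorm hy
  refine Metric.hausdorffDist_le_of_mem_dist (by positivity) (key u v B D) ?_
  rintro _ ⟨y, hy, rfl⟩
  obtain ⟨x, hx, hxy⟩ := exists_dist_le_of_mem (v := u) hy
  refine ⟨B x, mem_image_of_mem B hx, ?_⟩
  have h1 : D y - B x = B (y - x) + (D - B) y := by simp
  rw [dist_eq_norm, h1]
  refine (norm_add_le _ _).trans (add_le_add ((B.le_opNorm _).trans ?_)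
    (((D - B).le_opNorm _).trans ?_))
  · rw [← dist_eq_norm, dist_comm u v]
    gcongr
  · rw [norm_sub_rev D B]
    gcongr
    exact norm_le_bodyNorm hy

/-! ### The semigroup `exp{𝒜 t}` -/

theorem exp_add_smul (A : Euc n →L[ℝ] Euc n) (s t : ℝ) :
    NormedSpace.exp ((s + t) • A) = NormedSpace.exp (s • A) * NormedSpace.exp (t • A) := by
  let _ : NormedAlgebra ℚ (Euc n →L[ℝ] Euc n) := .restrictScalars ℚ ℝ _
  rw [add_smul]
  exact NormedSpace.exp_add_of_commute (((Commute.refl A).smul_left s).smul_right t)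

theorem expBody_add (A : Euc n →L[ℝ] Euc n) (s t : ℝ) (u : Conv n) :
    expBody A (s + t) u = expBody A s (expBody A t u) := by
  rw [expBody, expBody, expBody, imageBody_comp, exp_add_smul]

theorem expBody_zero (A : Euc n →L[ℝ] Euc n) (u : Conv n) : expBody A 0 u = u := by
  rw [expBody, zero_smul, NormedSpace.exp_zero, imageBody_one]

theorem Matrix.differentiable_det :
    Differentiable ℝ (fun M : Fin n → Fin n → ℝ => (Matrix.of M).det) := by
  simp only [Matrix.det_apply, Matrix.of_apply]
  fun_prop

/-- The curves $e^{tA}$ and $1+tA$ have the same tangent at the identity, so the determinant has the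
same derivative along both. For the second it is read off from
$\det(1+tA)=1+t\,\mathrm{tr}A+O(t^2)$. -/
theorem hasDerivAt_det_exp_zero (A : Euc n →L[ℝ] Euc n) :
    HasDerivAt (fun t : ℝ => (NormedSpace.exp (t • A)).det)
      (LinearMap.trace ℝ (Euc n) (A : Euc n →ₗ[ℝ] Euc n)) 0 := by
  let b := (EuclideanSpace.basisFun (Fin n) ℝ).toBasis
  let toM : (Euc n →L[ℝ] Euc n) →ₗ[ℝ] (Fin n → Fin n → ℝ) :=
    (Matrix.ofLinearEquiv ℝ).symm.toLinearMap ∘ₗ (LinearMap.toMatrix b b).toLinearMap ∘ₗ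
      ContinuousLinearMap.coeLM ℝ
  let toMC : (Euc n →L[ℝ] Euc n) →L[ℝ] (Fin n → Fin n → ℝ) := LinearMap.toContinuousLinearMap toM
  have hdet : ∀ T : Euc n →L[ℝ] Euc n, T.det = (Matrix.of (toMC T)).det := fun T => by
    rw [ContinuousLinearMap.det, ← LinearMap.det_toMatrix b]
    rfl
  have hdiff : DifferentiableAt ℝ (fun T : Euc n →L[ℝ] Euc n => T.det) 1 := by
    have : (fun T : Euc n →L[ℝ] Euc n => T.det) =
        (fun M : Fin n → Fin n → ℝ => (Matrix.of M).det) ∘ toMC := funext hdet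
    rw [this]
    exact (Matrix.differentiable_det _).comp _ toMC.differentiableAt
  let D := fderiv ℝ (fun T : Euc n →L[ℝ] Euc n => T.det) 1
  have h1 : HasDerivAt (fun t : ℝ => (NormedSpace.exp (t • A)).det) (D A) 0 := by
    have h2 : HasDerivAt (fun t : ℝ => NormedSpace.exp (t • A)) A 0 := by
      simpa using hasDerivAt_exp_smul_const (𝕂 := ℝ) A 0
    have h3 : HasFDerivAt (fun T : Euc n →L[ℝ] Euc n => T.det) D
        (NormedSpace.exp ((0 : ℝ) • A)) := by
      rw [zero_smul, NormedSpace.exp_zero]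
      exact hdiff.hasFDerivAt
    exact h3.comp_hasDerivAt (0 : ℝ) h2
  have h2 : HasDerivAt (fun t : ℝ => (1 + t • A).det) (D A) 0 := by
    have h3 : HasDerivAt (fun t : ℝ => 1 + t • A) A 0 := by
      simpa using ((hasDerivAt_id (0 : ℝ)).smul_const A).const_add 1
    have h4 : HasFDerivAt (fun T : Euc n →L[ℝ] Euc n => T.det) D (1 + (0 : ℝ) • A) := by
      rw [zero_smul, add_zero]
      exact hdiff.hasFDerivAt
    exact h4.comp_hasDerivAt (0 : ℝ) h3
  let M := LinearMap.toMatrix b b (A : Euc n →ₗ[ℝ] Euc n)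
  have h3 : HasDerivAt (fun t : ℝ => (1 + t • A).det) M.trace 0 := by
    have e : (fun t : ℝ => (1 + t • A).det) = fun t => 1 + M.trace * t +
        (Matrix.det (1 + (Polynomial.X : Polynomial ℝ) •
          M.map Polynomial.C)).divX.divX.eval t * t ^ 2 := by
      funext t
      rw [← Matrix.det_one_add_smul, ContinuousLinearMap.det, ← LinearMap.det_toMatrix b]
      congr 1
      change LinearMap.toMatrix b b (1 + t • (A : Euc n →ₗ[ℝ] Euc n)) = _
      rw [map_add, map_smul, LinearMap.toMatrix_one]
    rw [e]
    have h4 := (((hasDerivAt_id (0 : ℝ)).const_mul M.trace).const_add 1).add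
      (((Matrix.det (1 + (Polynomial.X : Polynomial ℝ) •
          M.map Polynomial.C)).divX.divX.hasDerivAt 0).mul (hasDerivAt_pow 2 (0 : ℝ)))
    refine h4.congr_deriv ?_
    simp
  have h4 : D A = LinearMap.trace ℝ (Euc n) (A : Euc n →ₗ[ℝ] Euc n) := by
    rw [h2.unique h3, LinearMap.trace_eq_matrix_trace ℝ b]
  rwa [h4] at h1

/-- Multiplicativity propagates the derivative at `0` to every time, so the quotient of the two
sides has zero derivative and equals its value at `0`. -/
theorem det_exp_smul (A : Euc n →L[ℝ] Euc n) (t : ℝ) :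
    (NormedSpace.exp (t • A)).det =
      Real.exp (t * LinearMap.trace ℝ (Euc n) (A : Euc n →ₗ[ℝ] Euc n)) := by
  set τ := LinearMap.trace ℝ (Euc n) (A : Euc n →ₗ[ℝ] Euc n)
  have hmul : ∀ s t : ℝ, (NormedSpace.exp ((s + t) • A)).det =
      (NormedSpace.exp (s • A)).det * (NormedSpace.exp (t • A)).det := by
    intro s t
    rw [exp_add_smul]
    exact LinearMap.det_comp _ _
  have hder : ∀ t : ℝ, HasDerivAt (fun t : ℝ => (NormedSpace.exp (t • A)).det)
      ((NormedSpace.exp (t • A)).det * τ) t := by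
    intro t
    have h1 : HasDerivAt (fun s : ℝ => (NormedSpace.exp (t • A)).det *
        (NormedSpace.exp ((s - t) • A)).det) ((NormedSpace.exp (t • A)).det * τ) t := by
      refine HasDerivAt.const_mul _ ?_
      exact HasDerivAt.comp_sub_const t t (by
        rw [sub_self]
        exact hasDerivAt_det_exp_zero A)
    refine h1.congr_of_eventuallyEq (Filter.Eventually.of_forall fun s => ?_)
    change _ = _ * _
    rw [← hmul, add_sub_cancel]
  have hconst : ∀ t : ℝ, HasDerivAt (fun t : ℝ => (NormedSpace.exp (t • A)).det *
      Real.exp (-(t * τ))) 0 t := by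
    intro t
    have h1 : HasDerivAt (fun t : ℝ => Real.exp (-(t * τ))) (Real.exp (-(t * τ)) * -τ) t := by
      have := ((hasDerivAt_id t).mul_const τ).neg.exp
      simpa using this
    refine ((hder t).mul h1).congr_deriv ?_
    ring
  have h0 := is_const_of_deriv_eq_zero (fun t => (hconst t).differentiableAt)
    (fun t => (hconst t).deriv) t 0
  simp only [zero_smul, NormedSpace.exp_zero, zero_mul, neg_zero, Real.exp_zero, mul_one] at h0
  have h1 : (1 : Euc n →L[ℝ] Euc n).det = 1 := LinearMap.det_id
  rw [h1, Real.exp_neg] at h0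
  field_simp at h0
  exact h0

theorem vol_expBody (A : Euc n →L[ℝ] Euc n) (t : ℝ) (u : Conv n) :
    (vol (expBody A t u) : ℝ) =
      Real.exp (t * LinearMap.trace ℝ (Euc n) (A : Euc n →ₗ[ℝ] Euc n)) * vol u := by
  rw [expBody, vol_imageBody, det_exp_smul, abs_of_pos (Real.exp_pos _)]

theorem natCast_mul_mixedVolumeTwo_expBody (hn : 0 < n) (A : Euc n →L[ℝ] Euc n) (t : ℝ)
    (u w : Conv n) : n * mixedVolumeTwo 1 (expBody A t u) (expBody A t w) =
      Real.exp (t * LinearMap.trace ℝ (Euc n) (A : Euc n →ₗ[ℝ] Euc n)) *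
        (n * mixedVolumeTwo 1 u w) := by
  rw [natCast_mul_mixedVolumeTwo_one hn, natCast_mul_mixedVolumeTwo_one hn, expBody, expBody,
    volPoly_imageBody, Polynomial.coeff_C_mul, det_exp_smul, abs_of_pos (Real.exp_pos _)]

theorem locallyLipschitz_exp_smul (A : Euc n →L[ℝ] Euc n) :
    LocallyLipschitz fun t : ℝ => NormedSpace.exp (t • A) := by
  refine ContDiff.locallyLipschitz (𝕂 := ℝ) (contDiff_one_iff_deriv.2 ⟨fun t =>
    (hasDerivAt_exp_smul_const (𝕂 := ℝ) A t).differentiableAt, ?_⟩)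
  have h : deriv (fun t : ℝ => NormedSpace.exp (t • A)) =
      fun t : ℝ => NormedSpace.exp (t • A) * A :=
    funext fun t => (hasDerivAt_exp_smul_const (𝕂 := ℝ) A t).deriv
  rw [h]
  have h2 : Continuous fun t : ℝ => NormedSpace.exp (t • A) :=
    continuous_iff_continuousAt.2 fun t =>
      (hasDerivAt_exp_smul_const (𝕂 := ℝ) A t).continuousAt
  exact h2.mul continuous_const

theorem locallyLipschitz_expBody (A : Euc n →L[ℝ] Euc n) :
    LocallyLipschitz fun p : ℝ × Conv n => expBody A p.1 p.2 := by
  rintro ⟨t₀, u₀⟩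
  obtain ⟨K, s, hs, hK⟩ := locallyLipschitz_exp_smul A t₀
  let M : ℝ≥0 := ‖NormedSpace.exp (t₀ • A)‖₊ + 1
  let R : ℝ≥0 := bodyNorm u₀ + 1
  have hcont : Continuous fun t : ℝ => NormedSpace.exp (t • A) :=
    (locallyLipschitz_exp_smul A).continuous
  have hs2 : {t : ℝ | ‖NormedSpace.exp (t • A)‖ < M} ∈ nhds t₀ := by
    refine (isOpen_lt hcont.norm continuous_const).mem_nhds ?_
    change ‖NormedSpace.exp (t₀ • A)‖ < ‖NormedSpace.exp (t₀ • A)‖ + 1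
    linarith
  refine ⟨M + K * R, (s ∩ {t : ℝ | ‖NormedSpace.exp (t • A)‖ < M}) ×ˢ Metric.ball u₀ 1,
    prod_mem_nhds (Filter.inter_mem hs hs2) (Metric.ball_mem_nhds _ one_pos), ?_⟩
  refine LipschitzOnWith.of_dist_le_mul ?_
  rintro ⟨t, u⟩ ⟨⟨ht1, ht2⟩, hu⟩ ⟨t', u'⟩ ⟨⟨ht1', ht2'⟩, hu'⟩
  have h1 : dist t t' ≤ dist (t, u) (t', u') := le_max_left _ _
  have h2 : dist u u' ≤ dist (t, u) (t', u') := le_max_right _ _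
  have h3 : (bodyNorm u' : ℝ) ≤ R := by
    have h4 := bodyNorm_le_add_dist u' u₀
    have h5 : dist u' u₀ < 1 := hu'
    change _ ≤ (bodyNorm u₀ : ℝ) + 1
    linarith
  have h4 := hK.dist_le_mul t ht1 t' ht1'
  rw [dist_eq_norm] at h4
  have h5 : ‖NormedSpace.exp (t • A)‖ ≤ M := le_of_lt ht2
  refine (dist_imageBody_le _ _ u u').trans ?_
  have h6 : ‖NormedSpace.exp (t • A)‖ * dist u u' ≤ M * dist (t, u) (t', u') := by gcongr
  have h7 : ‖NormedSpace.exp (t • A) - NormedSpace.exp (t' • A)‖ * bodyNorm u' ≤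
      K * dist (t, u) (t', u') * R := by
    refine mul_le_mul (h4.trans (by gcongr)) h3 (NNReal.coe_nonneg _) (by positivity)
  push_cast
  linarith

theorem continuous_expBody (A : Euc n →L[ℝ] Euc n) :
    Continuous fun p : ℝ × Conv n => expBody A p.1 p.2 := (locallyLipschitz_expBody A).continuous

/-! ### Ordinary differential equations in a closed convex cone -/

section Cone

variable {X E : Type*} [MetricSpace X] [NormedAddCommGroup E] [NormedSpace ℝ E]

/-- `ι` embeds `X` isometrically onto a convex cone. -/
structure IsConeEmbedding (ι : X → E) : Prop where
  isometry : Isometry ι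
  add_mem : ∀ x y, ι x + ι y ∈ range ι
  smul_mem : ∀ (c : ℝ) (x : X), 0 ≤ c → c • ι x ∈ range ι

/-- `x` is a continuous curve on `[0, T)` with right derivative `g ∘ x` that starts at `x₀`. -/
structure IsCurve (ι : X → E) (g : X → X) (x₀ : X) (T : ℝ) (x : ℝ → X) : Prop where
  zero : x 0 = x₀
  continuousOn : ContinuousOn x (Ico 0 T)
  hasDeriv : ∀ t ∈ Ico 0 T, HasDerivWithinAt (fun s => ι (x s)) (ι (g (x t))) (Ici t) t

theorem IsConeEmbedding.convex_range {ι : X → E} (hι : IsConeEmbedding ι) :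
    Convex ℝ (range ι) := by
  rintro _ ⟨x, rfl⟩ _ ⟨y, rfl⟩ a b ha hb -
  obtain ⟨x', hx'⟩ := hι.smul_mem a x ha
  obtain ⟨y', hy'⟩ := hι.smul_mem b y hb
  rw [← hx', ← hy']
  exact hι.add_mem x' y'

/-- The integral is `t` times an average, and averages of a closed convex set remain in it. -/
theorem IsConeEmbedding.integral_mem [CompleteSpace X] [CompleteSpace E] {ι : X → E}
    (hι : IsConeEmbedding ι) {f : ℝ → X} {t : ℝ} (ht : 0 ≤ t) (hf : ContinuousOn f (Icc 0 t)) :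
    ∫ s in (0 : ℝ)..t, ι (f s) ∈ range ι := by
  rcases ht.eq_or_lt with rfl | hpos
  · rw [intervalIntegral.integral_same, ← zero_smul ℝ (ι (f 0))]
    exact hι.smul_mem 0 _ le_rfl
  · have hc : ContinuousOn (fun s => ι (f s)) (Icc 0 t) :=
      hι.isometry.continuous.comp_continuousOn hf
    have hint : IntegrableOn (fun s => ι (f s)) (Ioc 0 t) :=
      hc.integrableOn_Icc.mono_set Ioc_subset_Icc_self
    have h1 := hι.convex_range.set_average_mem (μ := volume) (t := Ioc 0 t)
      (f := fun s => ι (f s)) hι.isometry.isClosedEmbedding.isClosed_range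
      (by simp [hpos]) (by simp) (Filter.Eventually.of_forall fun s => mem_range_self _) hint
    obtain ⟨y, hy⟩ := h1
    have h2 : ∫ s in (0 : ℝ)..t, ι (f s) = t • ι y := by
      rw [hy, setAverage_eq, intervalIntegral.integral_of_le ht, smul_smul]
      simp [hpos.ne', ht]
    rw [h2]
    exact hι.smul_mem t y ht

/-- Picard iteration carried out in `X` itself: `integral_mem` and closure of the cone under
addition lift the integral operator in `E` to a contraction of `X`-valued curves. -/
theorem exists_isCurve_local [CompleteSpace X] [CompleteSpace E] {ι : X → E}
    (hι : IsConeEmbedding ι) {g : X → X} (hg : LocallyLipschitz g) (x₀ : X) :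
    ∃ δ > 0, ∃ x, IsCurve ι g x₀ δ x := by
  obtain ⟨K, s, hs, hK⟩ := hg x₀
  obtain ⟨r, hr, hrs⟩ := Metric.nhds_basis_closedBall.mem_iff.1 hs
  replace hK := hK.mono hrs
  have hgc : Continuous g := hg.continuous
  let M : ℝ := ‖ι (g x₀)‖ + K * r + 1
  have hM0 : 0 < M := by positivity
  have hM : ∀ x ∈ Metric.closedBall x₀ r, ‖ι (g x)‖ ≤ M := by
    intro x hx
    have h1 := hK.dist_le_mul x hx x₀ (Metric.mem_closedBall_self hr.le)
    have h2 : (K : ℝ) * dist x x₀ ≤ K * r := by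
      gcongr
      exact hx
    rw [← hι.isometry.dist_eq, dist_eq_norm] at h1
    have h3 := norm_sub_norm_le (ι (g x)) (ι (g x₀))
    simp only [M]
    linarith
  -- The first bound keeps the iterates in the closed ball of radius `r`; the second makes the
  -- contraction constant `1 / 2`.
  let δ : ℝ := min (r / M) (1 / (2 * (K + 1)))
  have hδ : 0 < δ := lt_min (div_pos hr hM0) (by positivity)
  have hδM : M * δ ≤ r := by
    have : δ ≤ r / M := min_le_left _ _
    rwa [le_div_iff₀ hM0, mul_comm] at this
  have hδK : K * δ ≤ 1 / 2 := by
    have h1 : δ ≤ 1 / (2 * (K + 1)) := min_le_right _ _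
    rw [le_div_iff₀ (by positivity)] at h1
    nlinarith
  let Z : Set C(Icc (0 : ℝ) δ, X) := {x | ∀ t, x t ∈ Metric.closedBall x₀ r}
  have hZ : IsClosed Z := by
    have : Z = ⋂ t, (fun x : C(Icc (0 : ℝ) δ, X) => x t) ⁻¹' Metric.closedBall x₀ r := by
      ext x
      simp [Z]
    rw [this]
    exact isClosed_iInter fun t => Metric.isClosed_closedBall.preimage (by fun_prop)
  have : CompleteSpace Z := hZ.completeSpace_coe
  have : Nonempty Z := ⟨⟨ContinuousMap.const _ x₀, fun t => Metric.mem_closedBall_self hr.le⟩⟩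
  let ext : C(Icc (0 : ℝ) δ, X) → ℝ → X := fun x s => x (projIcc 0 δ hδ.le s)
  have hext : ∀ x, Continuous (ext x) := fun x => x.continuous.comp continuous_projIcc
  have hextZ : ∀ x ∈ Z, ∀ s, ext x s ∈ Metric.closedBall x₀ r := fun x hx s => hx _
  have hcont : ∀ x, Continuous fun s => ι (g (ext x s)) := fun x =>
    hι.isometry.continuous.comp (hgc.comp (hext x))
  have hstep : ∀ x : Z, ∃ y : Z, ∀ t : Icc (0 : ℝ) δ,
      ι (y.1 t) = ι x₀ + ∫ s in (0 : ℝ)..t, ι (g (ext x.1 s)) := by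
    intro x
    have h1 : ∀ t : Icc (0 : ℝ) δ, ∃ z, ι z = ι x₀ + ∫ s in (0 : ℝ)..t, ι (g (ext x.1 s)) := by
      intro t
      obtain ⟨w, hw⟩ := hι.integral_mem (f := fun s => g (ext x.1 s)) t.2.1
        (hgc.comp (hext x.1)).continuousOn
      rw [← hw]
      exact hι.add_mem _ _
    choose y hy using h1
    have hyc : Continuous y := by
      rw [hι.isometry.isEmbedding.continuous_iff]
      have e : ι ∘ y = fun t : Icc (0 : ℝ) δ => ι x₀ + ∫ s in (0 : ℝ)..t, ι (g (ext x.1 s)) :=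
        funext hy
      rw [e]
      have h2 : Continuous fun t : ℝ => ∫ s in (0 : ℝ)..t, ι (g (ext x.1 s)) :=
        intervalIntegral.continuous_primitive
          (fun a b => (hcont x.1).intervalIntegrable a b) 0
      exact continuous_const.add (h2.comp continuous_subtype_val)
    refine ⟨⟨⟨y, hyc⟩, fun t => ?_⟩, hy⟩
    rw [Metric.mem_closedBall]
    change dist (y t) x₀ ≤ r
    rw [← hι.isometry.dist_eq, hy, dist_eq_norm, add_sub_cancel_left]
    refine (intervalIntegral.norm_integral_le_of_norm_le_const
      fun s _ => hM _ (hextZ x.1 x.2 s)).trans ?_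
    rw [sub_zero, abs_of_nonneg t.2.1]
    exact (mul_le_mul_of_nonneg_left t.2.2 hM0.le).trans hδM
  choose Φ hΦ using hstep
  have hcontr : ContractingWith (1 / 2) Φ := by
    refine ⟨by norm_num, LipschitzWith.of_dist_le_mul fun x y => ?_⟩
    have hd : ((1 / 2 : ℝ≥0) : ℝ) * dist x y = 1 / 2 * dist x.1 y.1 := by
      rw [Subtype.dist_eq]
      norm_num
    rw [hd, Subtype.dist_eq, ContinuousMap.dist_le (by positivity)]
    intro t
    rw [← hι.isometry.dist_eq, hΦ, hΦ, dist_add_left, dist_eq_norm,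
      ← intervalIntegral.integral_sub ((hcont x.1).intervalIntegrable _ _)
        ((hcont y.1).intervalIntegrable _ _)]
    refine (intervalIntegral.norm_integral_le_of_norm_le_const (C := K * dist x.1 y.1)
      fun s _ => ?_).trans ?_
    · rw [← dist_eq_norm, hι.isometry.dist_eq]
      refine (hK.dist_le_mul _ (hextZ x.1 x.2 s) _ (hextZ y.1 y.2 s)).trans ?_
      gcongr
      exact ContinuousMap.dist_apply_le_dist _
    · rw [sub_zero, abs_of_nonneg t.2.1]
      have h1 : (K : ℝ) * t ≤ 1 / 2 := (mul_le_mul_of_nonneg_left t.2.2 K.2).trans hδK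
      have h2 := mul_le_mul_of_nonneg_right h1 (dist_nonneg (x := x.1) (y := y.1))
      linarith
  let x := hcontr.fixedPoint
  have hx : Φ x = x := hcontr.fixedPoint_isFixedPt
  have hxi : ∀ t ∈ Icc (0 : ℝ) δ,
      ι (ext x.1 t) = ι x₀ + ∫ s in (0 : ℝ)..t, ι (g (ext x.1 s)) := by
    intro t ht
    have h1 := hΦ x ⟨t, ht⟩
    rw [hx] at h1
    have h2 : ext x.1 t = x.1 ⟨t, ht⟩ := by
      simp only [ext]
      rw [projIcc_of_mem hδ.le ht]
    rw [h2, h1]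
  refine ⟨δ, hδ, ext x.1, ?_, (hext x.1).continuousOn, fun t ht => ?_⟩
  · have h1 := hxi 0 ⟨le_rfl, hδ.le⟩
    rw [intervalIntegral.integral_same, add_zero] at h1
    exact hι.isometry.injective h1
  · have h1 : HasDerivAt (fun t => ι x₀ + ∫ s in (0 : ℝ)..t, ι (g (ext x.1 s)))
        (ι (g (ext x.1 t))) t :=
      (intervalIntegral.integral_hasDerivAt_right ((hcont x.1).intervalIntegrable _ _)
        ((hcont x.1).stronglyMeasurableAtFilter _ _) (hcont x.1).continuousAt).const_add _
    refine h1.hasDerivWithinAt.congr_of_eventuallyEq ?_ (hxi t ⟨ht.1, ht.2.le⟩)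
    filter_upwards [Icc_mem_nhdsGE_of_mem ht] with s hs
    exact hxi s hs

theorem IsCurve.mono {ι : X → E} {g : X → X} {x₀ : X} {T T' : ℝ} {x : ℝ → X}
    (h : IsCurve ι g x₀ T x) (hT : T' ≤ T) : IsCurve ι g x₀ T' x :=
  ⟨h.zero, h.continuousOn.mono (Ico_subset_Ico_right hT),
    fun t ht => h.hasDeriv t (Ico_subset_Ico_right hT ht)⟩

/-- A locally Lipschitz field is Lipschitz on the compact union of the two trajectories, so
Gronwall's uniqueness theorem applies. The field lives only on the image of `ι` and is transported
there by an inverse function of `ι`. -/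
theorem IsCurve.eqOn {ι : X → E} (hι : Isometry ι) {g : X → X} (hg : LocallyLipschitz g) {x₀ : X}
    {T : ℝ} {x y : ℝ → X} (hx : IsCurve ι g x₀ T x) (hy : IsCurve ι g x₀ T y) :
    EqOn x y (Ico 0 T) := by
  intro b hb
  have hsub : Icc 0 b ⊆ Ico 0 T := Icc_subset_Ico_right hb.2
  have hxc := hx.continuousOn.mono hsub
  have hyc := hy.continuousOn.mono hsub
  let S : Set X := x '' Icc 0 b ∪ y '' Icc 0 b
  have hS : IsCompact S := (isCompact_Icc.image_of_continuousOn hxc).union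
    (isCompact_Icc.image_of_continuousOn hyc)
  obtain ⟨K, hK⟩ := hg.locallyLipschitzOn.exists_lipschitzOnWith_of_compact hS
  have : Nonempty X := ⟨x₀⟩
  have hinv : ∀ z, Function.invFun ι (ι z) = z := Function.leftInverse_invFun hι.injective
  have hbIco : Ico 0 b ⊆ Ico 0 T := Ico_subset_Ico_right hb.2.le
  have h := ODE_solution_unique_of_mem_Icc_right (K := K) (a := 0) (b := b)
    (v := fun _ e => ι (g (Function.invFun ι e))) (s := fun _ => ι '' S)
    (f := fun t => ι (x t)) (g := fun t => ι (y t)) (fun t _ => by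
      refine LipschitzOnWith.of_dist_le_mul ?_
      rintro _ ⟨p, hp, rfl⟩ _ ⟨q, hq, rfl⟩
      simp only [hinv]
      rw [hι.dist_eq, hι.dist_eq]
      exact hK.dist_le_mul p hp q hq)
    (hι.continuous.comp_continuousOn hxc)
    (fun t ht => by simp only [hinv]; exact hx.hasDeriv t (hbIco ht))
    (fun t ht => ⟨x t, Or.inl ⟨t, Ico_subset_Icc_self ht, rfl⟩, rfl⟩)
    (hι.continuous.comp_continuousOn hyc)
    (fun t ht => by simp only [hinv]; exact hy.hasDeriv t (hbIco ht))
    (fun t ht => ⟨y t, Or.inr ⟨t, Ico_subset_Icc_self ht, rfl⟩, rfl⟩)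
    (by simp only [hx.zero, hy.zero])
  exact hι.injective (h ⟨hb.1, le_rfl⟩)

/-- Bounded velocity makes the curve Lipschitz, hence convergent at `T`. The equation is autonomous,
so a local solution from the limit, shifted in time, continues it. -/
theorem IsCurve.exists_extension [CompleteSpace X] [CompleteSpace E] {ι : X → E}
    (hι : IsConeEmbedding ι) {g : X → X} (hg : LocallyLipschitz g) {x₀ : X} {T : ℝ} (hT : 0 < T)
    {x : ℝ → X} (hx : IsCurve ι g x₀ T x) {M : ℝ}
    (hM : ∀ t ∈ Ico 0 T, ‖ι (g (x t))‖ ≤ M) : ∃ δ > 0, ∃ y, IsCurve ι g x₀ (T + δ) y := by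
  have hM0 : 0 ≤ M := (norm_nonneg _).trans (hM 0 ⟨le_rfl, hT⟩)
  have hlip : LipschitzOnWith ⟨M, hM0⟩ x (Ico 0 T) := by
    have key : ∀ a ∈ Ico 0 T, ∀ b ∈ Ico 0 T, a ≤ b → dist (x b) (x a) ≤ M * (b - a) := by
      intro a ha b hb hab
      rw [← hι.isometry.dist_eq, dist_eq_norm]
      have hsub : Icc a b ⊆ Ico 0 T := Icc_subset_Ico_iff hab |>.2 ⟨ha.1, hb.2⟩
      exact norm_image_sub_le_of_norm_deriv_right_le_segment (f := fun t => ι (x t))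
        (hι.isometry.continuous.comp_continuousOn (hx.continuousOn.mono hsub))
        (fun t ht => hx.hasDeriv t (hsub (Ico_subset_Icc_self ht)))
        (fun t ht => hM t (hsub (Ico_subset_Icc_self ht))) b ⟨hab, le_rfl⟩
    refine LipschitzOnWith.of_dist_le_mul fun a ha b hb => ?_
    change _ ≤ M * dist a b
    rcases le_total a b with h | h
    · rw [dist_comm, dist_comm a b, Real.dist_eq, abs_of_nonneg (sub_nonneg.2 h)]
      exact key a ha b hb h
    · rw [Real.dist_eq, abs_of_nonneg (sub_nonneg.2 h)]
      exact key b hb a ha h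
  have hne : (nhdsWithin T (Ico 0 T)).NeBot := by
    rw [← mem_closure_iff_nhdsWithin_neBot, closure_Ico hT.ne]
    exact ⟨hT.le, le_rfl⟩
  have hcau : Cauchy (Filter.map x (nhdsWithin T (Ico 0 T))) :=
    (cauchy_nhds.mono nhdsWithin_le_nhds).map_of_le hlip.uniformContinuousOn
      (Filter.le_principal_iff.2 self_mem_nhdsWithin)
  obtain ⟨x₁, hx₁⟩ := CompleteSpace.complete hcau
  obtain ⟨δ, hδ, z, hz⟩ := exists_isCurve_local hι hg x₁
  let y : ℝ → X := fun t => if t < T then x t else z (t - T)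
  have hy1 : ∀ t < T, y t = x t := fun t ht => if_pos ht
  have hy2 : ∀ t, T ≤ t → y t = z (t - T) := fun t ht => if_neg ht.not_gt
  refine ⟨δ, hδ, y, by rw [hy1 0 hT, hx.zero], ?_, ?_⟩
  · have h1 : ContinuousOn y (Icc 0 T) := by
      intro t ht
      rcases ht.2.lt_or_eq with hlt | rfl
      · have h2 : ContinuousWithinAt x (Icc 0 T) t := by
          refine (hx.continuousOn t ⟨ht.1, hlt⟩).mono_of_mem_nhdsWithin ?_
          filter_upwards [self_mem_nhdsWithin,
            mem_nhdsWithin_of_mem_nhds (Iio_mem_nhds hlt)] with s hs hs2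
          exact ⟨hs.1, hs2⟩
        refine h2.congr_of_eventuallyEq ?_ (hy1 t hlt)
        filter_upwards [mem_nhdsWithin_of_mem_nhds (Iio_mem_nhds hlt)] with s hs
        exact hy1 s hs
      · have e : Icc 0 t = insert t (Ico 0 t) := by
          rw [← Ico_union_right ht.1, union_singleton]
        rw [e, continuousWithinAt_insert_self, ContinuousWithinAt, hy2 t le_rfl, sub_self, hz.zero]
        refine Filter.Tendsto.congr' ?_ hx₁
        filter_upwards [self_mem_nhdsWithin] with s hs
        exact (hy1 s hs.2).symm
    have h2 : ContinuousOn y (Ico T (T + δ)) := by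
      have : ContinuousOn (fun t => z (t - T)) (Ico T (T + δ)) := by
        refine hz.continuousOn.comp (by fun_prop) ?_
        intro t ht
        exact ⟨sub_nonneg.2 ht.1, by linarith [ht.2]⟩
      exact this.congr fun t ht => hy2 t ht.1
    intro t ht
    rcases lt_trichotomy t T with h | rfl | h
    · refine (h1 t ⟨ht.1, h.le⟩).mono_of_mem_nhdsWithin ?_
      filter_upwards [self_mem_nhdsWithin,
        mem_nhdsWithin_of_mem_nhds (Iio_mem_nhds h)] with s hs hs2
      exact ⟨hs.1, le_of_lt hs2⟩
    · have h3 := (h1 t ⟨ht.1, le_rfl⟩).union (h2 t ⟨le_rfl, ht.2⟩)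
      rwa [Icc_union_Ico_eq_Ico ht.1 ht.2] at h3
    · refine (h2 t ⟨h.le, ht.2⟩).mono_of_mem_nhdsWithin ?_
      filter_upwards [self_mem_nhdsWithin,
        mem_nhdsWithin_of_mem_nhds (Ioi_mem_nhds h)] with s hs hs2
      exact ⟨le_of_lt hs2, hs.2⟩
  · intro t ht
    rcases lt_or_ge t T with h | h
    · rw [hy1 t h]
      refine (hx.hasDeriv t ⟨ht.1, h⟩).congr_of_eventuallyEq ?_ (by simp only [hy1 t h])
      filter_upwards [mem_nhdsWithin_of_mem_nhds (Iio_mem_nhds h)] with s hs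
      simp only [hy1 s hs]
    · rw [hy2 t h]
      have h1 := hz.hasDeriv (t - T) ⟨sub_nonneg.2 h, by linarith [ht.2]⟩
      have h2 : HasDerivWithinAt (fun s : ℝ => s - T) 1 (Ici t) t :=
        ((hasDerivAt_id t).sub_const T).hasDerivWithinAt
      have h3 := h1.scomp t h2 (fun s hs => by
        change t - T ≤ s - T
        exact sub_le_sub_right hs T)
      rw [one_smul] at h3
      exact h3.congr (fun s hs => by simp only [hy2 s (h.trans hs), Function.comp])
        (by simp only [hy2 t h, Function.comp])

/-- Uniqueness glues all curves into one on the interval up to the supremum of the attainable times;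
if the supremum were below `T`, the bound would allow an extension past it. -/
theorem exists_isCurve_of_bounded [CompleteSpace X] [CompleteSpace E] {ι : X → E}
    (hι : IsConeEmbedding ι) {g : X → X} (hg : LocallyLipschitz g) {x₀ : X} {T : ℝ} (hT : 0 < T)
    (hbd : ∀ τ, 0 < τ → τ ≤ T → ∀ x, IsCurve ι g x₀ τ x →
      ∃ M, ∀ t ∈ Ico 0 τ, ‖ι (g (x t))‖ ≤ M) : ∃ x, IsCurve ι g x₀ T x := by
  let S : Set ℝ := {τ | 0 < τ ∧ τ ≤ T ∧ ∃ x, IsCurve ι g x₀ τ x}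
  have hSb : BddAbove S := ⟨T, fun τ hτ => hτ.2.1⟩
  have hSn : ∃ τ, τ ∈ S := by
    obtain ⟨δ, hδ, x, hx⟩ := exists_isCurve_local hι hg x₀
    exact ⟨min δ T, lt_min hδ hT, min_le_right _ _, x, hx.mono (min_le_left _ _)⟩
  obtain ⟨τ₀, hτ₀⟩ := hSn
  have hpos : 0 < sSup S := hτ₀.1.trans_le (le_csSup hSb hτ₀)
  have hleT : sSup S ≤ T := csSup_le ⟨τ₀, hτ₀⟩ fun τ hτ => hτ.2.1
  have hcurve : ∀ t, ∃ z : X, ∀ τ x, IsCurve ι g x₀ τ x → t ∈ Ico 0 τ → x t = z := by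
    intro t
    by_cases h : ∃ τ x, IsCurve ι g x₀ τ x ∧ t ∈ Ico 0 τ
    · obtain ⟨τ, x, hx, ht⟩ := h
      refine ⟨x t, fun τ' x' hx' ht' => ?_⟩
      exact (hx'.mono (min_le_left τ' τ)).eqOn hι.isometry hg (hx.mono (min_le_right τ' τ))
        ⟨ht.1, lt_min ht'.2 ht.2⟩
    · exact ⟨x₀, fun τ x hx ht => (h ⟨τ, x, hx, ht⟩).elim⟩
  choose y hy using hcurve
  have hyc : IsCurve ι g x₀ (sSup S) y := by
    have hloc : ∀ t ∈ Ico 0 (sSup S), ∃ τ x, t < τ ∧ IsCurve ι g x₀ τ x := by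
      intro t ht
      obtain ⟨τ, hτ, hlt⟩ := exists_lt_of_lt_csSup ⟨τ₀, hτ₀⟩ ht.2
      obtain ⟨-, -, x, hx⟩ := hτ
      exact ⟨τ, x, hlt, hx⟩
    refine ⟨?_, fun t ht => ?_, fun t ht => ?_⟩
    · obtain ⟨τ, x, hlt, hx⟩ := hloc 0 ⟨le_rfl, hpos⟩
      rw [← hy 0 τ x hx ⟨le_rfl, hlt⟩, hx.zero]
    · obtain ⟨τ, x, hlt, hx⟩ := hloc t ht
      have h1 : ContinuousWithinAt x (Ico 0 (sSup S)) t := by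
        refine (hx.continuousOn t ⟨ht.1, hlt⟩).mono_of_mem_nhdsWithin ?_
        filter_upwards [self_mem_nhdsWithin,
          mem_nhdsWithin_of_mem_nhds (Iio_mem_nhds hlt)] with s hs hs2
        exact ⟨hs.1, hs2⟩
      refine h1.congr_of_eventuallyEq ?_ (hy t τ x hx ⟨ht.1, hlt⟩).symm
      filter_upwards [self_mem_nhdsWithin,
        mem_nhdsWithin_of_mem_nhds (Iio_mem_nhds hlt)] with s hs hs2
      exact (hy s τ x hx ⟨hs.1, hs2⟩).symm
    · obtain ⟨τ, x, hlt, hx⟩ := hloc t ht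
      have e := hy t τ x hx ⟨ht.1, hlt⟩
      rw [← e]
      refine (hx.hasDeriv t ⟨ht.1, hlt⟩).congr_of_eventuallyEq ?_ (by simp only [e])
      filter_upwards [self_mem_nhdsWithin,
        mem_nhdsWithin_of_mem_nhds (Iio_mem_nhds hlt)] with s hs hs2
      rw [hy s τ x hx ⟨ht.1.trans hs, hs2⟩]
  rcases hleT.eq_or_lt with h | h
  · rw [← h]
    exact ⟨y, hyc⟩
  · obtain ⟨M, hM⟩ := hbd _ hpos hleT y hyc
    obtain ⟨δ, hδ, z, hz⟩ := hyc.exists_extension hι hg hpos hM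
    have hmem : min (sSup S + δ) T ∈ S :=
      ⟨lt_min (by linarith) hT, min_le_right _ _, z, hz.mono (min_le_left _ _)⟩
    have h1 := le_csSup hSb hmem
    have h2 : sSup S < min (sSup S + δ) T := lt_min (by linarith) h
    exact (h2.not_ge h1).elim

end Cone

/-! ### Comparison theorems -/

theorem locallyLipschitz_mul_real {X : Type*} [PseudoMetricSpace X] {f g : X → ℝ}
    (hf : LocallyLipschitz f) (hg : LocallyLipschitz g) : LocallyLipschitz fun x => f x * g x :=
  (ContDiff.locallyLipschitz (𝕂 := ℝ) (contDiff_mul (𝔸 := ℝ) (n := 1))).comp (hf.prodMk hg)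

theorem locallyLipschitz_coe_nnreal : LocallyLipschitz (fun x : ℝ≥0 => (x : ℝ)) :=
  (isometry_subtype_coe (s := {x : ℝ | 0 ≤ x})).lipschitz.locallyLipschitz

theorem locallyLipschitz_volumeRHS (A : Euc n →L[ℝ] Euc n) {φ g : ℝ≥0 → ℝ≥0}
    (hφ : LocallyLipschitz φ) (hg : LocallyLipschitz g) (t : ℝ) :
    LocallyLipschitz (volumeRHS A φ g t) :=
  (locallyLipschitz_mul_real (locallyLipschitz_mul_real (LocallyLipschitz.const _)
    (locallyLipschitz_coe_nnreal.comp hφ)) locallyLipschitz_coe_nnreal).add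
    (locallyLipschitz_coe_nnreal.comp hg)

/-- Raising `y` by a small exponential with rate above the Lipschitz constant makes the differential
inequality strict at any contact point, which excludes crossing; the perturbation then tends to
zero. -/
theorem le_of_deriv_right_le_of_le_deriv_right {f : ℝ≥0 → ℝ} (hf : LocallyLipschitz f) {b : ℝ}
    {x y : ℝ → ℝ≥0} {x' y' : ℝ → ℝ} (hx : ContinuousOn x (Icc 0 b)) (hy : ContinuousOn y (Icc 0 b))
    (hx' : ∀ t ∈ Ico 0 b, HasDerivWithinAt (fun s => (x s : ℝ)) (x' t) (Ici t) t)
    (hy' : ∀ t ∈ Ico 0 b, HasDerivWithinAt (fun s => (y s : ℝ)) (y' t) (Ici t) t)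
    (hxf : ∀ t ∈ Ico 0 b, x' t ≤ f (x t)) (hyf : ∀ t ∈ Ico 0 b, f (y t) ≤ y' t)
    (h0 : x 0 ≤ y 0) : ∀ t ∈ Icc 0 b, x t ≤ y t := by
  have hxc : ContinuousOn (fun t => (x t : ℝ)) (Icc 0 b) :=
    NNReal.continuous_coe.comp_continuousOn hx
  have hyc : ContinuousOn (fun t => (y t : ℝ)) (Icc 0 b) :=
    NNReal.continuous_coe.comp_continuousOn hy
  obtain ⟨Y, hY⟩ := isCompact_Icc.exists_bound_of_continuousOn hyc
  -- At a contact point `x` exceeds `y` by at most `η ≤ 1`, so both values lie in `[0, R]`.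
  let R : ℝ≥0 := Y.toNNReal + 1
  obtain ⟨K, hK⟩ := hf.locallyLipschitzOn.exists_lipschitzOnWith_of_compact
    (isCompact_Icc (a := (0 : ℝ≥0)) (b := R))
  intro t₀ ht₀
  rw [← NNReal.coe_le_coe]
  have hb : 0 ≤ b := ht₀.1.trans ht₀.2
  let c : ℝ := K + 1
  have key : ∀ η : ℝ, 0 < η → η ≤ 1 →
      (x t₀ : ℝ) ≤ y t₀ + η := by
    intro η hη hη1
    -- Centring the exponential at `b` gives `e ≤ η` on the whole interval.
    let e : ℝ → ℝ := fun t => η * Real.exp (c * (t - b))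
    have he0 : ∀ t, 0 < e t := fun t => by positivity
    have hc0 : 0 ≤ c := by positivity
    have heη : ∀ t ∈ Icc 0 b, e t ≤ η := by
      intro t ht
      refine mul_le_of_le_one_right hη.le (Real.exp_le_one_iff.2 ?_)
      exact mul_nonpos_of_nonneg_of_nonpos hc0 (sub_nonpos.2 ht.2)
    have hed : ∀ t, HasDerivAt e (c * e t) t := by
      intro t
      have h1 : HasDerivAt (fun t => c * (t - b)) c t := by
        simpa using ((hasDerivAt_id t).sub_const b).const_mul c
      refine (h1.exp.const_mul η).congr_deriv ?_
      simp only [e]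
      ring
    have h := image_le_of_deriv_right_lt_deriv_boundary' (f := fun t => (x t : ℝ)) (f' := x')
      (B := fun t => (y t : ℝ) + e t) (B' := fun t => y' t + c * e t) hxc hx' (by
        have h1 : (x 0 : ℝ) ≤ y 0 := h0
        have := he0 0
        linarith) (hyc.add fun t _ => (hed t).continuousAt.continuousWithinAt)
      (fun t ht => (hy' t ht).add (hed t).hasDerivWithinAt) (by
        intro t ht heq
        have ht' := Ico_subset_Icc_self ht
        have hyR : (y t : ℝ) + 1 ≤ R := by
          have h1 := (le_abs_self _).trans (hY t ht')
          have h2 := Real.le_coe_toNNReal Y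
          simp only [R]
          push_cast
          linarith
        have hyt : y t ∈ Icc 0 R := ⟨zero_le, by
          rw [← NNReal.coe_le_coe]
          linarith⟩
        have hxt : x t ∈ Icc 0 R := ⟨zero_le, by
          rw [← NNReal.coe_le_coe]
          have := heη t ht'
          linarith⟩
        have h1 := hK.dist_le_mul _ hxt _ hyt
        rw [NNReal.dist_eq, heq, add_sub_cancel_left, abs_of_pos (he0 t), Real.dist_eq] at h1
        have h2 := (le_abs_self _).trans h1
        have h3 := hxf t ht
        have h4 := hyf t ht
        have h5 := he0 t
        have h6 : c * e t = K * e t + e t := by simp only [c]; ring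
        linarith) ht₀
    have h1 := heη t₀ ht₀
    have h2 : (x t₀ : ℝ) ≤ y t₀ + e t₀ := h
    linarith
  refine le_of_forall_pos_le_add fun η hη => ?_
  refine (key (min η 1) (lt_min hη one_pos) (min_le_right _ _)).trans ?_
  have := min_le_left η 1
  linarith

theorem IsODESolution.continuousOn {f : ℝ → ℝ≥0 → ℝ} {x₀ : ℝ≥0} {I : Set ℝ} {x : ℝ → ℝ≥0}
    (h : IsODESolution f x₀ I x) : ContinuousOn x I := fun t ht => by
  have h1 := (h.2 t ht).continuousWithinAt
  exact NNReal.isEmbedding_coe.continuousWithinAt_iff.2 h1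

/-- Monotone iteration: a continuous subsolution of an integral equation with a bounded
nondecreasing right-hand side lies below some continuous solution. -/
theorem exists_solution_ge_of_integral_le {b w₀ C : ℝ} (hb : 0 ≤ b) {c : ℝ → ℝ}
    (hc : Continuous c) (hc0 : ∀ t, 0 ≤ c t) {H : ℝ → ℝ → ℝ}
    (hH : Continuous fun p : ℝ × ℝ => H p.1 p.2) (hmono : ∀ t, Monotone (H t))
    (hC : ∀ t r, |H t r| ≤ C) {q : ℝ → ℝ} (hq : Continuous q)
    (hle : ∀ t ∈ Icc 0 b, q t ≤ c t * (w₀ + ∫ s in (0 : ℝ)..t, H s (q s))) :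
    ∃ y : ℝ → ℝ, Continuous y ∧ (∀ t ∈ Icc 0 b, q t ≤ y t) ∧
      ∀ t ∈ Icc 0 b, y t = c t * (w₀ + ∫ s in (0 : ℝ)..t, H s (y s)) := by
  -- Clamping time to `[0, b]` makes every iterate a continuous function on all of `ℝ`.
  let π : ℝ → ℝ := fun t => max 0 (min t b)
  have hπ : Continuous π := by fun_prop
  have hπm : ∀ t, π t ∈ Icc 0 b := fun t => ⟨le_max_left _ _, max_le hb (min_le_right _ _)⟩
  have hπe : ∀ t ∈ Icc 0 b, π t = t := fun t ht => by
    simp only [π]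
    rw [min_eq_left ht.2, max_eq_right ht.1]
  let Ψ : (ℝ → ℝ) → ℝ → ℝ := fun y t => c (π t) * (w₀ + ∫ s in (0 : ℝ)..π t, H s (y s))
  have hint : ∀ y : ℝ → ℝ, Measurable y → ∀ a b : ℝ,
      IntervalIntegrable (fun s => H s (y s)) volume a b := by
    intro y hy a b
    have hm : Measurable fun s => H s (y s) := hH.measurable.comp (measurable_id.prodMk hy)
    exact (intervalIntegrable_const (c := C)).mono_fun hm.aestronglyMeasurable
      (Filter.Eventually.of_forall fun s => by
        have := hC s (y s)
        have h0 : 0 ≤ C := (abs_nonneg _).trans this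
        simpa [abs_of_nonneg h0] using this)
  have hΨc : ∀ y : ℝ → ℝ, Measurable y → Continuous (Ψ y) := by
    intro y hy
    exact (hc.comp hπ).mul (continuous_const.add
      ((intervalIntegral.continuous_primitive (hint y hy) 0).comp hπ))
  let y : ℕ → ℝ → ℝ := fun k => Ψ^[k] (q ∘ π)
  have hy0 : y 0 = q ∘ π := rfl
  have hys : ∀ k, y (k + 1) = Ψ (y k) := fun k => Function.iterate_succ_apply' _ _ _
  have hyc : ∀ k, Continuous (y k) := by
    intro k
    induction k with
    | zero => exact hq.comp hπ
    | succ k ih =>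
      rw [hys]
      exact hΨc _ ih.measurable
  have hΨmono : ∀ u v : ℝ → ℝ, Measurable u → Measurable v → (∀ t, u t ≤ v t) →
      ∀ t, Ψ u t ≤ Ψ v t := by
    intro u v hu hv huv t
    refine mul_le_mul_of_nonneg_left (add_le_add le_rfl ?_) (hc0 _)
    exact intervalIntegral.integral_mono_on (hπm t).1 (hint u hu _ _) (hint v hv _ _)
      fun s _ => hmono s (huv s)
  have hstep : ∀ k t, y k t ≤ y (k + 1) t := by
    intro k
    induction k with
    | zero =>
      intro t
      rw [hys, hy0]
      refine (hle (π t) (hπm t)).trans (le_of_eq ?_)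
      simp only [Ψ]
      congr 2
      refine intervalIntegral.integral_congr fun s hs => ?_
      rw [uIcc_of_le (hπm t).1] at hs
      simp only [Function.comp, hπe s ⟨hs.1, hs.2.trans (hπm t).2⟩]
    | succ k ih =>
      intro t
      rw [hys k, hys (k + 1)]
      exact hΨmono _ _ (hyc k).measurable (hyc (k + 1)).measurable ih t
  have hmonoy : ∀ t, Monotone fun k => y k t := fun t => monotone_nat_of_le_succ fun k => hstep k t
  have hbdd : ∀ t, BddAbove (range fun k => y k t) := by
    intro t
    refine ⟨c (π t) * (w₀ + C * b), ?_⟩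
    rintro _ ⟨k, rfl⟩
    refine (hstep k t).trans ?_
    rw [hys]
    refine mul_le_mul_of_nonneg_left (add_le_add le_rfl ?_) (hc0 _)
    have h1 := intervalIntegral.norm_integral_le_of_norm_le_const (a := 0) (b := π t) (C := C)
      (f := fun s => H s (y k s)) fun s _ => hC s _
    rw [sub_zero, abs_of_nonneg (hπm t).1] at h1
    have hC0 : 0 ≤ C := (abs_nonneg _).trans (hC 0 0)
    exact (le_abs_self _).trans (h1.trans (mul_le_mul_of_nonneg_left (hπm t).2 hC0))
  let z : ℝ → ℝ := fun t => ⨆ k, y k t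
  have hlim : ∀ t, Filter.Tendsto (fun k => y k t) Filter.atTop (nhds (z t)) :=
    fun t => tendsto_atTop_ciSup (hmonoy t) (hbdd t)
  have hzm : Measurable z := measurable_of_tendsto_metrizable (fun k => (hyc k).measurable)
    (tendsto_pi_nhds.2 hlim)
  have hzΨ : ∀ t, z t = Ψ z t := by
    intro t
    refine tendsto_nhds_unique ((hlim t).comp (Filter.tendsto_add_atTop_nat 1)) ?_
    have h1 : Filter.Tendsto (fun k => ∫ s in (0 : ℝ)..π t, H s (y k s)) Filter.atTop
        (nhds (∫ s in (0 : ℝ)..π t, H s (z s))) := by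
      refine intervalIntegral.tendsto_integral_filter_of_dominated_convergence (fun _ => C)
        (Filter.Eventually.of_forall fun k => (hH.measurable.comp
          (measurable_id.prodMk (hyc k).measurable)).aestronglyMeasurable)
        (Filter.Eventually.of_forall fun k => Filter.Eventually.of_forall fun s _ => hC s _)
        intervalIntegrable_const (Filter.Eventually.of_forall fun s _ => ?_)
      have h2 : Continuous fun r => H s r := hH.comp (Continuous.prodMk_right s)
      exact (h2.tendsto _).comp (hlim s)
    have h2 := (h1.const_add w₀).const_mul (c (π t))
    refine h2.congr fun k => ?_
    simp only [Function.comp, hys]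
    rfl
  have hzc : Continuous z := by
    have : z = Ψ z := funext hzΨ
    rw [this]
    exact hΨc z hzm
  refine ⟨z, hzc, fun t ht => ?_, fun t ht => ?_⟩
  · have h1 : y 0 t ≤ z t := le_ciSup (hbdd t) 0
    rwa [hy0, Function.comp, hπe t ht] at h1
  · have h1 := hzΨ t
    simp only [Ψ] at h1
    rwa [hπe t ht] at h1

/-- Only an integral inequality is known for `q`. After truncating `G` at a level `M`, monotone
iteration gives a solution `y ≥ q` of the integral equation. While `y ≤ M`, the function `y / N`
(written `z`) solves the equation of `ω`, so maximality gives `y ≤ N ω < M` and the truncation is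
never active. -/
theorem le_mul_of_integral_le {N w₀ : ℝ≥0} {a : ℝ → ℝ} {G : ℝ → ℝ≥0 → ℝ≥0}
    (hG : ContinuousOn (fun p : ℝ × ℝ≥0 => G p.1 p.2) (Ici 0 ×ˢ univ))
    (hGm : ∀ t, 0 ≤ t → Monotone (G t)) {ω : ℝ → ℝ≥0}
    (hω : IsGlobalMaximalSolution (fun t w => a t * w + G t (N * w)) w₀ ω)
    {T : ℝ} (ha : ContinuousOn a (Ico 0 T)) {q : ℝ → ℝ≥0} (hq : ContinuousOn q (Ico 0 T))
    (hle : ∀ t ∈ Ico 0 T, (q t : ℝ) ≤ N * Real.exp (∫ s in (0 : ℝ)..t, a s) *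
      (w₀ + ∫ s in (0 : ℝ)..t, Real.exp (-∫ r in (0 : ℝ)..s, a r) * G s (q s))) :
    ∀ t ∈ Ico 0 T, q t ≤ N * ω t := by
  intro t₀ ht₀
  obtain ⟨b, hb1, hb2⟩ := exists_between ht₀.2
  have hb : 0 < b := ht₀.1.trans_lt hb1
  have hsub : Icc 0 b ⊆ Ico 0 T := Icc_subset_Ico_right hb2
  let π : ℝ → ℝ := fun t => max 0 (min t b)
  have hπ : Continuous π := by fun_prop
  have hπm : ∀ t, π t ∈ Icc 0 b := fun t => ⟨le_max_left _ _, max_le hb.le (min_le_right _ _)⟩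
  have hπe : ∀ t ∈ Icc 0 b, π t = t := fun t ht => by
    simp only [π]
    rw [min_eq_left ht.2, max_eq_right ht.1]
  let a' : ℝ → ℝ := fun t => a (π t)
  have ha' : Continuous a' := ha.comp_continuous hπ fun t => hsub (hπm t)
  let q' : ℝ → ℝ := fun t => q (π t)
  have hq' : Continuous q' :=
    NNReal.continuous_coe.comp (hq.comp_continuous hπ fun t => hsub (hπm t))
  let L : ℝ → ℝ := fun t => ∫ s in (0 : ℝ)..t, a' s
  have hLd : ∀ t, HasDerivAt L (a' t) t := fun t =>
    intervalIntegral.integral_hasDerivAt_right (ha'.intervalIntegrable _ _)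
      (ha'.stronglyMeasurableAtFilter _ _) ha'.continuousAt
  have hLc : Continuous L := continuous_iff_continuousAt.2 fun t => (hLd t).continuousAt
  have hLe : ∀ t ∈ Icc 0 b, L t = ∫ s in (0 : ℝ)..t, a s := by
    intro t ht
    refine intervalIntegral.integral_congr fun s hs => ?_
    rw [uIcc_of_le ht.1] at hs
    simp only [a', hπe s ⟨hs.1, hs.2.trans ht.2⟩]
  have hωc : ContinuousOn ω (Icc 0 b) := hω.1.continuousOn.mono fun t ht => ht.1
  obtain ⟨W, hW⟩ := isCompact_Icc.bddAbove_image hωc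
  obtain ⟨Q, hQ⟩ := isCompact_Icc.bddAbove_image (hq.mono hsub)
  -- Above `q`, so truncation leaves its inequality intact, and strictly above `N ω`, so `y` cannot
  -- reach the level.
  let M : ℝ≥0 := N * W + Q + 1
  have hWM : ∀ t ∈ Icc 0 b, N * ω t < M := by
    intro t ht
    have h1 : N * ω t ≤ N * W := mul_le_mul_right (hW (mem_image_of_mem _ ht)) N
    exact (h1.trans (le_add_of_nonneg_right zero_le)).trans_lt (lt_add_one _)
  have hQM : ∀ t ∈ Icc 0 b, q t ≤ M := by
    intro t ht
    have h1 : q t ≤ Q := hQ (mem_image_of_mem _ ht)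
    exact (h1.trans (le_add_of_nonneg_left zero_le)).trans
      (le_add_of_nonneg_right zero_le_one)
  let H : ℝ → ℝ → ℝ := fun s r => Real.exp (-L (π s)) * G (π s) (min M r.toNNReal)
  have hGc : Continuous fun p : ℝ × ℝ≥0 => G (π p.1) p.2 :=
    hG.comp_continuous ((hπ.comp continuous_fst).prodMk continuous_snd)
      fun p => ⟨(hπm p.1).1, mem_univ _⟩
  have hH : Continuous fun p : ℝ × ℝ => H p.1 p.2 := by
    refine (Real.continuous_exp.comp ((hLc.comp hπ).neg.comp continuous_fst)).mul
      (NNReal.continuous_coe.comp ?_)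
    exact hGc.comp (continuous_fst.prodMk
      (continuous_const.min (continuous_real_toNNReal.comp continuous_snd)))
  have hHm : ∀ t, Monotone (H t) := by
    intro t r r' hrr
    refine mul_le_mul_of_nonneg_left (NNReal.coe_le_coe.2 (hGm _ (hπm t).1 ?_))
      (Real.exp_pos _).le
    exact min_le_min le_rfl (Real.toNNReal_mono hrr)
  have hH0 : ∀ t r, 0 ≤ H t r := fun t r => mul_nonneg (Real.exp_pos _).le (NNReal.coe_nonneg _)
  obtain ⟨C, hC⟩ := (isCompact_Icc (a := (0 : ℝ)) (b := b)).exists_bound_of_continuousOn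
    (f := fun t => H t M) (hH.comp (continuous_id.prodMk continuous_const)).continuousOn
  have hHC : ∀ t r, |H t r| ≤ C := by
    intro t r
    rw [abs_of_nonneg (hH0 t r)]
    have h1 : H t r ≤ H (π t) M := by
      have h2 : H (π t) M = H t M := by
        simp only [H, hπe _ (hπm t)]
      rw [h2]
      refine mul_le_mul_of_nonneg_left (NNReal.coe_le_coe.2 (hGm _ (hπm t).1 ?_))
        (Real.exp_pos _).le
      rw [Real.toNNReal_coe, min_self]
      exact min_le_left _ _
    exact h1.trans ((le_abs_self _).trans (hC _ (hπm t)))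
  obtain ⟨y, hyc, hqy, hyi⟩ := exists_solution_ge_of_integral_le (b := b) (w₀ := w₀) hb.le
    (c := fun t => N * Real.exp (L t)) (by fun_prop)
    (fun t => mul_nonneg N.2 (Real.exp_pos _).le) hH hHm hHC hq' (by
      intro t ht
      have h1 := hle t (hsub ht)
      simp only [q', hπe t ht, hLe t ht]
      refine h1.trans (le_of_eq ?_)
      congr 2
      refine intervalIntegral.integral_congr fun s hs => ?_
      rw [uIcc_of_le ht.1] at hs
      have hs' : s ∈ Icc 0 b := ⟨hs.1, hs.2.trans ht.2⟩
      simp only [H, hπe s hs', hLe s hs', Real.toNNReal_coe, min_eq_right (hQM s hs')])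
  let z : ℝ → ℝ := fun t => Real.exp (L t) * (w₀ + ∫ s in (0 : ℝ)..t, H s (y s))
  have hyz : ∀ t ∈ Icc 0 b, y t = N * z t := fun t ht => by
    rw [hyi t ht]
    simp only [z]
    ring
  have hz0 : ∀ t ∈ Icc 0 b, 0 ≤ z t := fun t ht =>
    mul_nonneg (Real.exp_pos _).le (add_nonneg w₀.2
      (intervalIntegral.integral_nonneg ht.1 fun s _ => hH0 _ _))
  have hHy : Continuous fun s => H s (y s) := hH.comp (continuous_id.prodMk hyc)
  have hzd : ∀ t ∈ Icc 0 b, HasDerivAt z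
      (a t * z t + G t (min M (N * (z t).toNNReal))) t := by
    intro t ht
    have h1 : HasDerivAt (fun t => (w₀ : ℝ) + ∫ s in (0 : ℝ)..t, H s (y s)) (H t (y t)) t :=
      (intervalIntegral.integral_hasDerivAt_right (hHy.intervalIntegrable _ _)
        (hHy.stronglyMeasurableAtFilter _ _) hHy.continuousAt).const_add _
    refine ((hLd t).exp.mul h1).congr_deriv ?_
    have h2 : H t (y t) = Real.exp (-L t) * G t (min M (N * (z t).toNNReal)) := by
      simp only [H, hπe t ht]
      rw [hyz t ht, Real.toNNReal_mul N.coe_nonneg, Real.toNNReal_coe]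
    rw [h2, ← mul_assoc (Real.exp (L t)), ← Real.exp_add, add_neg_cancel, Real.exp_zero, one_mul]
    simp only [a', hπe t ht, z]
    ring
  have hcomp : ∀ τ, 0 < τ → τ ≤ b → (∀ s ∈ Ico 0 τ, y s < M) → ∀ s ∈ Ico 0 τ, y s ≤ N * ω s := by
    intro τ hτ hτb hyM s hs
    have hsb : Ico 0 τ ⊆ Icc 0 b := fun t ht => ⟨ht.1, ht.2.le.trans hτb⟩
    have hsol : IsODESolution (fun t w => a t * w + G t (N * w)) w₀ (Ico 0 τ)
        (fun t => (z t).toNNReal) := by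
      refine ⟨?_, fun t ht => ?_⟩
      · simp [z, L]
      · have htb := hsb ht
        have h1 : N * (z t).toNNReal ≤ M := by
          rw [← NNReal.coe_le_coe, NNReal.coe_mul, Real.coe_toNNReal _ (hz0 t htb), ← hyz t htb]
          exact (hyM t ht).le
        have h2 := (hzd t htb).hasDerivWithinAt (s := Ico 0 τ)
        rw [min_eq_right h1] at h2
        have h3 := h2.congr (f₁ := fun t => ((z t).toNNReal : ℝ))
          (fun r hr => Real.coe_toNNReal _ (hz0 r (hsb hr))) (Real.coe_toNNReal _ (hz0 t htb))
        refine h3.congr_deriv ?_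
        simp only [Real.coe_toNNReal _ (hz0 t htb)]
    have h1 := hω.2 τ hτ _ hsol s hs
    rw [← NNReal.coe_le_coe, Real.coe_toNNReal _ (hz0 s (hsb hs))] at h1
    rw [hyz s (hsb hs)]
    exact mul_le_mul_of_nonneg_left h1 N.2
  -- At the first time `y` reaches `M`, the comparison valid before it passes to the limit and gives
  -- `y ≤ N ω < M`.
  have hlt : ∀ t ∈ Icc 0 b, y t < M := by
    by_contra! hcon
    obtain ⟨t₁, ht₁, hMt₁⟩ := hcon
    have hcl : IsCompact {t | t ∈ Icc 0 b ∧ (M : ℝ) ≤ y t} :=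
      isCompact_Icc.of_isClosed_subset
        (isClosed_Icc.inter (isClosed_le continuous_const hyc)) fun t ht => ht.1
    obtain ⟨τ, ⟨hτb, hτM⟩, hτmin⟩ := hcl.exists_isLeast ⟨t₁, ht₁, hMt₁⟩
    have hτ0 : 0 < τ := by
      refine lt_of_le_of_ne hτb.1 ?_
      rintro rfl
      have h1 := hyi 0 hτb
      have h2 : (N : ℝ) * w₀ < M := by
        have h3 := hWM 0 hτb
        rw [hω.1.1] at h3
        exact_mod_cast h3
      have h3 : L 0 = 0 := intervalIntegral.integral_same
      rw [intervalIntegral.integral_same, h3, Real.exp_zero, mul_one, add_zero] at h1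
      rw [h1] at hτM
      exact hτM.not_gt h2
    have h1 := hcomp τ hτ0 hτb.2 fun s hs => by
      by_contra! h
      exact (hτmin ⟨⟨hs.1, hs.2.le.trans hτb.2⟩, h⟩).not_gt hs.2
    have h2 : y τ ≤ N * ω τ := by
      have hne : (nhdsWithin τ (Ico 0 τ)).NeBot := by
        rw [← mem_closure_iff_nhdsWithin_neBot, closure_Ico hτ0.ne]
        exact ⟨hτ0.le, le_rfl⟩
      have hω' : ContinuousWithinAt (fun t => (N : ℝ) * ω t) (Ico 0 τ) τ :=
        (continuousWithinAt_const.mul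
          (NNReal.continuous_coe.continuousAt.comp_continuousWithinAt (hωc τ hτb))).mono
          fun t ht => ⟨ht.1, ht.2.le.trans hτb.2⟩
      refine le_of_tendsto_of_tendsto (hyc.continuousWithinAt (s := Ico 0 τ)) hω' ?_
      filter_upwards [self_mem_nhdsWithin] with s hs
      exact h1 s hs
    have h3 : (N : ℝ) * ω τ < M := by exact_mod_cast hWM τ hτb
    linarith
  have ht₀b : t₀ ∈ Icc 0 b := ⟨ht₀.1, hb1.le⟩
  have h1 := hcomp b hb le_rfl (fun s hs => hlt s (Ico_subset_Icc_self hs)) t₀ ⟨ht₀.1, hb1⟩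
  have h2 := hqy t₀ ht₀b
  simp only [q', hπe t₀ ht₀b] at h2
  rw [← NNReal.coe_le_coe, NNReal.coe_mul]
  exact h2.trans h1

/-! ### The flow as an ordinary differential equation in `ℝ × conv(ℝⁿ)` -/

theorem hasDerivWithinAt_integral_Ico {E : Type*} [NormedAddCommGroup E] [NormedSpace ℝ E]
    [CompleteSpace E] {f : ℝ → E} {T : ℝ} (hf : ContinuousOn f (Ico 0 T)) {t : ℝ}
    (ht : t ∈ Ico 0 T) :
    HasDerivWithinAt (fun t => ∫ s in (0 : ℝ)..t, f s) (f t) (Ico 0 T) t := by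
  obtain ⟨b, hb1, hb2⟩ := exists_between ht.2
  have hb : 0 < b := ht.1.trans_lt hb1
  let π : ℝ → ℝ := fun t => max 0 (min t b)
  have hπ : Continuous π := by fun_prop
  have hπm : ∀ t, π t ∈ Ico 0 T := fun t =>
    ⟨le_max_left _ _, (max_le hb.le (min_le_right _ _)).trans_lt hb2⟩
  have hπe : ∀ t ∈ Icc 0 b, π t = t := fun t ht => by
    simp only [π]
    rw [min_eq_left ht.2, max_eq_right ht.1]
  have hf' : Continuous fun s => f (π s) := hf.comp_continuous hπ hπm
  have h1 : HasDerivAt (fun t => ∫ s in (0 : ℝ)..t, f (π s)) (f (π t)) t :=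
    intervalIntegral.integral_hasDerivAt_right (hf'.intervalIntegrable _ _)
      (hf'.stronglyMeasurableAtFilter _ _) hf'.continuousAt
  rw [hπe t ⟨ht.1, hb1.le⟩] at h1
  have h2 : ∀ s ∈ Icc 0 b, ∫ r in (0 : ℝ)..s, f r = ∫ r in (0 : ℝ)..s, f (π r) := by
    intro s hs
    refine intervalIntegral.integral_congr fun r hr => ?_
    rw [uIcc_of_le hs.1] at hr
    simp only [hπe r ⟨hr.1, hr.2.trans hs.2⟩]
  refine h1.hasDerivWithinAt.congr_of_eventuallyEq ?_ (h2 t ⟨ht.1, hb1.le⟩)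
  filter_upwards [self_mem_nhdsWithin, mem_nhdsWithin_of_mem_nhds (Iio_mem_nhds hb1)] with s hs hs2
  exact h2 s ⟨hs.1, le_of_lt hs2⟩

theorem intervalIntegrable_of_continuousOn_Ico {E : Type*} [NormedAddCommGroup E] {f : ℝ → E}
    {T : ℝ} (hf : ContinuousOn f (Ico 0 T)) {s t : ℝ} (hs : s ∈ Ico 0 T) (ht : t ∈ Ico 0 T) :
    IntervalIntegrable f volume s t :=
  (hf.mono (ordConnected_Ico.uIcc_subset hs ht)).intervalIntegrable

/-- The homogeneous extension turns the linear image into evaluation at the adjoint image of `p`,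
and such evaluations commute with the integral. -/
theorem supp_expBody_of_eq_add_integral (A : Euc n →L[ℝ] Euc n) (r : ℝ) {v w : Conv n}
    {f : ℝ → Conv n} {t : ℝ} (ht : 0 ≤ t) (hf : ContinuousOn f (Icc 0 t))
    (h : supp v = supp w + ∫ s in (0 : ℝ)..t, supp (f s)) :
    supp (expBody A r v) = supp (expBody A r w) +
      ∫ s in (0 : ℝ)..t, supp (expBody A r (f s)) := by
  have hc : ∀ k : ℝ → Conv n, ContinuousOn k (Icc 0 t) →
      IntervalIntegrable (fun s => supp (k s)) volume 0 t := fun k hk => by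
    refine ContinuousOn.intervalIntegrable ?_
    rw [uIcc_of_le ht]
    exact isometry_supp.continuous.comp_continuousOn hk
  have hcomm : ∀ (p : Euc n) (k : ℝ → Conv n), ContinuousOn k (Icc 0 t) →
      homEval p (∫ s in (0 : ℝ)..t, supp (k s)) = ∫ s in (0 : ℝ)..t, supportValue (k s) p := by
    intro p k hk
    rw [← ContinuousLinearMap.intervalIntegral_comp_comm _ (hc k hk)]
    simp only [homEval_supp]
  have hf' : ContinuousOn (fun s => expBody A r (f s)) (Icc 0 t) :=
    (continuous_expBody A).comp_continuousOn (continuousOn_const.prodMk hf)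
  refine ext_homEval fun p => ?_
  have h1 := congrArg (homEval ((NormedSpace.exp (r • A)).adjoint p)) h
  rw [map_add, hcomm _ _ hf, homEval_supp, homEval_supp] at h1
  rw [map_add, hcomm _ _ hf', homEval_supp, homEval_supp]
  simp only [expBody, supportValue_imageBody]
  exact h1

/-- `ℝ × conv(ℝⁿ)` inside the Banach space `ℝ × C(Sⁿ⁻¹)`. -/
def stateEmbedding (n : ℕ) : ℝ × Conv n → ℝ × C(Metric.sphere (0 : Euc n) 1, ℝ) :=
  Prod.map id supp

theorem isConeEmbedding_stateEmbedding : IsConeEmbedding (stateEmbedding n) where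
  isometry := isometry_id.prodMap isometry_supp
  add_mem := fun x y => ⟨(x.1 + y.1, x.2 + y.2), by
    simp [stateEmbedding, Prod.map, supp_add]⟩
  smul_mem := fun c x hc => ⟨(c * x.1, c.toNNReal • x.2), by
    simp [stateEmbedding, Prod.map, supp_smul, hc]⟩

/-- The vector field of the clock `c` and of the body `w = exp{-𝒜 c} u`. -/
def stateField (A : Euc n →L[ℝ] Euc n) (φ : ℝ≥0 → ℝ≥0) (F : ℝ≥0 → Conv n → Conv n)
    (x : ℝ × Conv n) : ℝ × Conv n :=
  ((φ (vol (expBody A x.1 x.2)) : ℝ),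
    expBody A (-x.1) (F (vol (expBody A x.1 x.2)) (expBody A x.1 x.2)))

theorem locallyLipschitz_stateField (A : Euc n →L[ℝ] Euc n) {φ : ℝ≥0 → ℝ≥0}
    (hφ : LocallyLipschitz φ) {F : ℝ≥0 → Conv n → Conv n}
    (hF : LocallyLipschitz fun p : ℝ≥0 × Conv n => F p.1 p.2) :
    LocallyLipschitz (stateField A φ F) := by
  have hu := locallyLipschitz_expBody A
  have hV := locallyLipschitz_vol.comp hu
  have hneg : LocallyLipschitz fun x : ℝ × Conv n => -x.1 :=
    (LipschitzWith.id.neg.comp LipschitzWith.prod_fst).locallyLipschitz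
  exact (locallyLipschitz_coe_nnreal.comp (hφ.comp hV)).prodMk
    (hu.comp (hneg.prodMk (hF.comp (hV.prodMk hu))))

section Flow

variable {A : Euc n →L[ℝ] Euc n} {φ : ℝ≥0 → ℝ≥0} {F : ℝ≥0 → Conv n → Conv n} {u₀ : Conv n} {T : ℝ}

theorem expBody_neg_cancel (A : Euc n →L[ℝ] Euc n) (c : ℝ) (u : Conv n) :
    expBody A c (expBody A (-c) u) = u := by
  rw [← expBody_add, add_neg_cancel, expBody_zero]

theorem clock_eq_sub {u : ℝ → Conv n} (hφ : Continuous φ) (hu : ContinuousOn u (Ico 0 T))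
    {s t : ℝ} (hs : s ∈ Ico 0 T) (ht : t ∈ Ico 0 T) :
    clock φ u s t = clock φ u 0 t - clock φ u 0 s := by
  have hc : ContinuousOn (fun τ => (φ (vol (u τ)) : ℝ)) (Ico 0 T) :=
    (NNReal.continuous_coe.comp (hφ.comp continuous_vol)).comp_continuousOn hu
  have h0 : (0 : ℝ) ∈ Ico 0 T := ⟨le_rfl, ht.1.trans_lt ht.2⟩
  exact (intervalIntegral.integral_interval_sub_left
    (intervalIntegrable_of_continuousOn_Ico hc h0 ht)
    (intervalIntegrable_of_continuousOn_Ico hc h0 hs)).symm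

/-- Applying $\exp\{-\mathcal A c(t)\}$ leaves an integrand independent of $t$, because
$\int_s^t\varphi=c(t)-c(s)$; the fundamental theorem of calculus then gives the differential
equation. -/
theorem IsSolution.isCurve (hφ : Continuous φ)
    (hF : Continuous fun p : ℝ≥0 × Conv n => F p.1 p.2) (hT : 0 < T) {u : ℝ → Conv n}
    (hu : IsSolution A φ F u₀ T u) :
    IsCurve (stateEmbedding n) (stateField A φ F) (0, u₀) T
      (fun t => (clock φ u 0 t, expBody A (-clock φ u 0 t) (u t))) := by
  obtain ⟨huc, hui⟩ := hu
  have hφc : ContinuousOn (fun τ => (φ (vol (u τ)) : ℝ)) (Ico 0 T) :=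
    (NNReal.continuous_coe.comp (hφ.comp continuous_vol)).comp_continuousOn huc
  have hcd : ∀ t ∈ Ico 0 T, HasDerivWithinAt (fun t => clock φ u 0 t) (φ (vol (u t)))
      (Ico 0 T) t := fun t ht => hasDerivWithinAt_integral_Ico hφc ht
  have hcc : ContinuousOn (fun t => clock φ u 0 t) (Ico 0 T) :=
    fun t ht => (hcd t ht).continuousWithinAt
  have hFc : ContinuousOn (fun s => F (vol (u s)) (u s)) (Ico 0 T) :=
    hF.comp_continuousOn ((continuous_vol.comp_continuousOn huc).prodMk huc)
  have hGc : ContinuousOn (fun s => expBody A (-clock φ u 0 s) (F (vol (u s)) (u s))) (Ico 0 T) :=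
    (continuous_expBody A).comp_continuousOn (hcc.neg.prodMk hFc)
  have hw : ∀ t ∈ Ico 0 T, supp (expBody A (-clock φ u 0 t) (u t)) = supp u₀ +
      ∫ s in (0 : ℝ)..t, supp (expBody A (-clock φ u 0 s) (F (vol (u s)) (u s))) := by
    intro t ht
    have hsub : Icc 0 t ⊆ Ico 0 T := Icc_subset_Ico_right ht.2
    have hclk : ∀ s ∈ Icc 0 t, clock φ u s t = clock φ u 0 t - clock φ u 0 s := fun s hs =>
      clock_eq_sub hφ huc (hsub hs) ht
    have hfc : ContinuousOn (fun s => expBody A (clock φ u s t) (F (vol (u s)) (u s)))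
        (Icc 0 t) := by
      refine (continuous_expBody A).comp_continuousOn (ContinuousOn.prodMk ?_ (hFc.mono hsub))
      exact (continuousOn_const.sub (hcc.mono hsub)).congr hclk
    rw [supp_expBody_of_eq_add_integral A (-clock φ u 0 t) ht.1 hfc (hui t ht), ← expBody_add,
      neg_add_cancel, expBody_zero]
    congr 1
    refine intervalIntegral.integral_congr fun s hs => ?_
    rw [uIcc_of_le ht.1] at hs
    simp only [← expBody_add, hclk s hs]
    rw [show -clock φ u 0 t + (clock φ u 0 t - clock φ u 0 s) = -clock φ u 0 s by ring]
  refine ⟨?_, hcc.prodMk ((continuous_expBody A).comp_continuousOn (hcc.neg.prodMk huc)),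
    fun t ht => ?_⟩
  · have h0 : clock φ u 0 0 = 0 := intervalIntegral.integral_same
    have h1 := hw 0 ⟨le_rfl, hT⟩
    rw [intervalIntegral.integral_same, add_zero] at h1
    rw [isometry_supp.injective h1, h0]
  · have hmem : Ico 0 T ∈ nhdsWithin t (Ici t) := Ico_mem_nhdsGE_of_mem ht
    have h1 : HasDerivWithinAt (fun t => supp (expBody A (-clock φ u 0 t) (u t)))
        (supp (expBody A (-clock φ u 0 t) (F (vol (u t)) (u t)))) (Ico 0 T) t := by
      have h2 := (hasDerivWithinAt_integral_Ico
        (isometry_supp.continuous.comp_continuousOn hGc) ht).const_add (supp u₀)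
      exact h2.congr hw (hw t ht)
    have h3 := ((hcd t ht).prodMk h1).mono_of_mem_nhdsWithin hmem
    simp only [stateField, expBody_neg_cancel]
    exact h3

theorem IsCurve.hasDerivWithinAt_fst {x : ℝ → ℝ × Conv n}
    (hx : IsCurve (stateEmbedding n) (stateField A φ F) (0, u₀) T x) {t : ℝ} (ht : t ∈ Ico 0 T) :
    HasDerivWithinAt (fun s => (x s).1) (φ (vol (expBody A (x t).1 (x t).2))) (Ici t) t :=
  (ContinuousLinearMap.fst ℝ ℝ C(Metric.sphere (0 : Euc n) 1, ℝ)).hasFDerivAt.comp_hasDerivWithinAt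
    t (hx.hasDeriv t ht)

theorem IsCurve.hasDerivWithinAt_snd {x : ℝ → ℝ × Conv n}
    (hx : IsCurve (stateEmbedding n) (stateField A φ F) (0, u₀) T x) {t : ℝ} (ht : t ∈ Ico 0 T) :
    HasDerivWithinAt (fun s => supp (x s).2) (supp (expBody A (-(x t).1)
      (F (vol (expBody A (x t).1 (x t).2)) (expBody A (x t).1 (x t).2)))) (Ici t) t :=
  (ContinuousLinearMap.snd ℝ ℝ C(Metric.sphere (0 : Euc n) 1, ℝ)).hasFDerivAt.comp_hasDerivWithinAt
    t (hx.hasDeriv t ht)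

theorem IsCurve.continuousOn_body {x : ℝ → ℝ × Conv n}
    (hx : IsCurve (stateEmbedding n) (stateField A φ F) (0, u₀) T x) :
    ContinuousOn (fun t => expBody A (x t).1 (x t).2) (Ico 0 T) :=
  (continuous_expBody A).comp_continuousOn hx.continuousOn

theorem IsCurve.clock_eq (hφ : Continuous φ) {x : ℝ → ℝ × Conv n}
    (hx : IsCurve (stateEmbedding n) (stateField A φ F) (0, u₀) T x) {s t : ℝ} (hs : 0 ≤ s)
    (hst : s ≤ t) (ht : t < T) :
    clock φ (fun t => expBody A (x t).1 (x t).2) s t = (x t).1 - (x s).1 := by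
  have hsub : Icc s t ⊆ Ico 0 T := (Icc_subset_Ico_iff hst).2 ⟨hs, ht⟩
  refine intervalIntegral.integral_eq_sub_of_hasDeriv_right_of_le hst
    ((continuous_fst.comp_continuousOn hx.continuousOn).mono hsub)
    (fun r hr => (hx.hasDerivWithinAt_fst (hsub (Ioo_subset_Icc_self hr))).mono
      Ioi_subset_Ici_self)
    (intervalIntegrable_of_continuousOn_Ico (T := T) ?_ ⟨hs, hst.trans_lt ht⟩ ⟨hs.trans hst, ht⟩)
  exact (NNReal.continuous_coe.comp (hφ.comp continuous_vol)).comp_continuousOn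
    hx.continuousOn_body

theorem IsCurve.isSolution (hφ : Continuous φ)
    (hF : Continuous fun p : ℝ≥0 × Conv n => F p.1 p.2) {x : ℝ → ℝ × Conv n}
    (hx : IsCurve (stateEmbedding n) (stateField A φ F) (0, u₀) T x) :
    IsSolution A φ F u₀ T (fun t => expBody A (x t).1 (x t).2) := by
  refine ⟨hx.continuousOn_body, fun t ht => ?_⟩
  have hsub : Icc 0 t ⊆ Ico 0 T := Icc_subset_Ico_right ht.2
  have huc := hx.continuousOn_body
  let G : ℝ → Conv n := fun s => expBody A (-(x s).1)
    (F (vol (expBody A (x s).1 (x s).2)) (expBody A (x s).1 (x s).2))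
  have hGc : ContinuousOn G (Ico 0 T) :=
    (continuous_expBody A).comp_continuousOn
      ((continuous_fst.comp_continuousOn hx.continuousOn).neg.prodMk
        (hF.comp_continuousOn ((continuous_vol.comp_continuousOn huc).prodMk huc)))
  have hw : supp (x t).2 = supp u₀ + ∫ s in (0 : ℝ)..t, supp (G s) := by
    have h1 := intervalIntegral.integral_eq_sub_of_hasDeriv_right_of_le
      (f := fun s => supp (x s).2) (f' := fun s => supp (G s)) ht.1
      ((isometry_supp.continuous.comp continuous_snd).comp_continuousOn
        (hx.continuousOn.mono hsub))
      (fun r hr => (hx.hasDerivWithinAt_snd (hsub (Ioo_subset_Icc_self hr))).mono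
        Ioi_subset_Ici_self)
      (intervalIntegrable_of_continuousOn_Ico (isometry_supp.continuous.comp_continuousOn hGc)
        ⟨le_rfl, ht.1.trans_lt ht.2⟩ ht)
    rw [h1, hx.zero]
    simp
  have hc0 : (x 0).1 = 0 := by rw [hx.zero]
  rw [supp_expBody_of_eq_add_integral A (x t).1 ht.1 (hGc.mono hsub) hw,
    hx.clock_eq hφ le_rfl ht.1 ht.2, hc0, sub_zero]
  congr 1
  refine intervalIntegral.integral_congr fun s hs => ?_
  rw [uIcc_of_le ht.1] at hs
  simp only [G]
  rw [hx.clock_eq hφ hs.1 hs.2 ht.2, ← expBody_add, ← sub_eq_add_neg]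

end Flow

/-! ### Evolution of the volume -/

/-- Near `t` the curve differs by `o(s - t)` from the Minkowski segment `w t + (s - t) G`, and the
volume is locally Lipschitz. Only the right derivative is available, since the segment needs `s ≥
t`. -/
theorem hasDerivWithinAt_vol (hn : 0 < n) {w : ℝ → Conv n} {G : Conv n} {t : ℝ}
    (hw : HasDerivWithinAt (fun s => supp (w s)) (supp G) (Ici t) t) :
    HasDerivWithinAt (fun s => (vol (w s) : ℝ)) (n * mixedVolumeTwo 1 (w t) G) (Ici t) t := by
  rw [natCast_mul_mixedVolumeTwo_one hn]
  let v : ℝ → Conv n := fun s => w t + (s - t).toNNReal • G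
  have hv : HasDerivWithinAt (fun s => (vol (v s) : ℝ)) ((volPoly (w t) G).coeff 1) (Ici t) t := by
    have h1 := hasDerivWithinAt_vol_add_smul (w t) G
    have h1 : HasDerivWithinAt (fun s : ℝ => (vol (w t + s.toNNReal • G) : ℝ))
        ((volPoly (w t) G).coeff 1) (Ici 0) ((fun s : ℝ => s - t) t) := by
      simpa only [sub_self] using h1
    have h2 : HasDerivWithinAt (fun s : ℝ => s - t) 1 (Ici t) t :=
      ((hasDerivAt_id t).sub_const t).hasDerivWithinAt
    have h3 := HasDerivWithinAt.scomp (h := fun s : ℝ => s - t) t h1 h2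
      fun s hs => mem_Ici.2 (sub_nonneg.2 hs)
    rwa [one_smul] at h3
  have hvt : v t = w t := by simp [v]
  have hvs : ∀ s ∈ Ici t, supp (v s) = supp (w t) + (s - t) • supp G := by
    intro s hs
    simp only [v]
    rw [supp_add, supp_smul, Real.coe_toNNReal _ (sub_nonneg.2 hs)]
  obtain ⟨K, S, hS, hK⟩ := locallyLipschitz_vol (w t)
  have hwS : ∀ᶠ s in nhdsWithin t (Ici t), w s ∈ S := by
    have h1 : ContinuousWithinAt w (Ici t) t :=
      isometry_supp.isEmbedding.continuousWithinAt_iff.2 hw.continuousWithinAt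
    exact h1 hS
  have hvS : ∀ᶠ s in nhdsWithin t (Ici t), v s ∈ S := by
    have h1 : ContinuousWithinAt (fun s => supp (v s)) (Ici t) t := by
      have h2 : Continuous fun s : ℝ => supp (w t) + (s - t) • supp G := by fun_prop
      exact h2.continuousWithinAt.congr hvs (hvs t self_mem_Ici)
    have h2 : ContinuousWithinAt v (Ici t) t :=
      isometry_supp.isEmbedding.continuousWithinAt_iff.2 h1
    rw [← hvt] at hS
    exact h2 hS
  rw [hasDerivWithinAt_iff_isLittleO] at hw hv ⊢
  have hdiff : (fun s => (vol (w s) : ℝ) - vol (v s)) =o[nhdsWithin t (Ici t)]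
      fun s => s - t := by
    refine Asymptotics.IsBigO.trans_isLittleO (Asymptotics.IsBigO.of_bound K ?_) hw
    filter_upwards [hwS, hvS, self_mem_nhdsWithin] with s h1 h2 hs
    have h3 := hK.dist_le_mul _ h1 _ h2
    rw [← isometry_supp.dist_eq, dist_eq_norm, hvs s hs, ← sub_sub, NNReal.dist_eq] at h3
    exact h3
  refine (hdiff.add hv).congr_left fun s => ?_
  rw [hvt]
  ring

/-- Product rule for $V[u]=e^{c\,\mathrm{tr}A}V[w]$; the first mixed volume scales by the same
factor, which turns $V_1[w,w']$ into $V_1[u,F]$. -/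
theorem IsCurve.hasDerivWithinAt_vol (hn : 0 < n) {A : Euc n →L[ℝ] Euc n} {φ : ℝ≥0 → ℝ≥0}
    {F : ℝ≥0 → Conv n → Conv n} {u₀ : Conv n} {T : ℝ} {x : ℝ → ℝ × Conv n}
    (hx : IsCurve (stateEmbedding n) (stateField A φ F) (0, u₀) T x) {u : ℝ → Conv n}
    (hu : u = fun t => expBody A (x t).1 (x t).2) {t : ℝ} (ht : t ∈ Ico 0 T) :
    HasDerivWithinAt (fun s => (vol (u s) : ℝ))
      (LinearMap.trace ℝ (Euc n) (A : Euc n →ₗ[ℝ] Euc n) * φ (vol (u t)) * vol (u t) +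
        n * mixedVolumeTwo 1 (u t) (F (vol (u t)) (u t))) (Ici t) t := by
  set τ := LinearMap.trace ℝ (Euc n) (A : Euc n →ₗ[ℝ] Euc n) with hτ
  have h1 := hx.hasDerivWithinAt_fst ht
  have h2 := ConvFlow.hasDerivWithinAt_vol hn (hx.hasDerivWithinAt_snd ht)
  have h3 := (h1.mul_const τ).exp.mul h2
  have e : (fun s => (vol (u s) : ℝ)) = fun s => Real.exp ((x s).1 * τ) * vol (x s).2 := by
    funext s
    rw [hu, vol_expBody]
  rw [e]
  refine h3.congr_deriv ?_
  have hut : u t = expBody A (x t).1 (x t).2 := by rw [hu]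
  have h4 := natCast_mul_mixedVolumeTwo_expBody hn A (x t).1 (x t).2
    (expBody A (-(x t).1) (F (vol (u t)) (u t)))
  rw [expBody_neg_cancel, ← hut, ← hτ] at h4
  have h5 := vol_expBody A (x t).1 (x t).2
  rw [← hut, ← hτ] at h5
  rw [h4, ← hut, h5]
  ring

/-! ### A priori bounds -/

theorem IsODESolution.hasDerivWithinAt_Ici {f : ℝ → ℝ≥0 → ℝ} {x₀ : ℝ≥0} {x : ℝ → ℝ≥0}
    (h : IsODESolution f x₀ (Ici 0) x) {t : ℝ} (ht : 0 ≤ t) :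
    HasDerivWithinAt (fun s => (x s : ℝ)) (f t (x t)) (Ici t) t :=
  (h.2 t ht).mono (Ici_subset_Ici.2 ht)

/-- Parametrizing a moving interval by the fixed interval `[0, 1]` reduces continuity of `rateBound`
to that of extrema over a fixed compact set. -/
theorem Icc_eq_image_nnreal {a b : ℝ≥0} (hab : a ≤ b) :
    Icc a b = (fun θ : ℝ≥0 => a + θ * (b - a)) '' Icc 0 1 := by
  ext r
  constructor
  · rintro ⟨h1, h2⟩
    rcases hab.eq_or_lt with rfl | hlt
    · exact ⟨0, by simp, by simpa using le_antisymm h1 h2⟩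
    · have hpos : 0 < b - a := tsub_pos_of_lt hlt
      refine ⟨(r - a) / (b - a), ⟨zero_le, ?_⟩, ?_⟩
      · exact div_le_one_of_le₀ (tsub_le_tsub_right h2 a) zero_le
      · simp only
        rw [div_mul_cancel₀ _ hpos.ne', add_tsub_cancel_of_le h1]
  · rintro ⟨θ, ⟨-, hθ⟩, rfl⟩
    refine ⟨le_add_of_nonneg_right zero_le, ?_⟩
    calc a + θ * (b - a) ≤ a + 1 * (b - a) := by gcongr
      _ = b := by rw [one_mul, add_tsub_cancel_of_le hab]

theorem continuousOn_rateBound (α : ℝ) {φ : ℝ≥0 → ℝ≥0} (hφ : Continuous φ) {χ ζ : ℝ → ℝ≥0}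
    {s : Set ℝ} (hχ : ContinuousOn χ s) (hζ : ContinuousOn ζ s) (h : ∀ t ∈ s, χ t ≤ ζ t) :
    ContinuousOn (rateBound α φ χ ζ) s := by
  let f : ℝ≥0 × ℝ≥0 → ℝ≥0 → ℝ≥0 := fun p θ => φ (p.1 + θ * (p.2 - p.1))
  have hf : Continuous fun q : (ℝ≥0 × ℝ≥0) × ℝ≥0 => f q.1 q.2 := by
    refine hφ.comp ?_
    fun_prop
  have himg : ∀ t ∈ s, φ '' Icc (χ t) (ζ t) = f (χ t, ζ t) '' Icc 0 1 := by
    intro t ht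
    rw [Icc_eq_image_nnreal (h t ht), image_image]
  by_cases hα : 0 < α
  · have h1 : Continuous fun p => sSup (f p '' Icc 0 1) := isCompact_Icc.continuous_sSup hf
    refine (h1.comp_continuousOn (hχ.prodMk hζ)).congr fun t ht => ?_
    simp only [rateBound, if_pos hα, himg t ht, Function.comp]
  · have h1 : Continuous fun p => sInf (f p '' Icc 0 1) := isCompact_Icc.continuous_sInf hf
    refine (h1.comp_continuousOn (hχ.prodMk hζ)).congr fun t ht => ?_
    simp only [rateBound, if_neg hα, himg t ht, Function.comp]

theorem mul_le_mul_rateBound (α : ℝ) {φ : ℝ≥0 → ℝ≥0} (hφ : Continuous φ) {χ ζ : ℝ → ℝ≥0}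
    {t : ℝ} {r : ℝ≥0} (hr : r ∈ Icc (χ t) (ζ t)) : α * φ r ≤ α * rateBound α φ χ ζ t := by
  have hmem : φ r ∈ φ '' Icc (χ t) (ζ t) := mem_image_of_mem φ hr
  by_cases hα : 0 < α
  · rw [rateBound, if_pos hα]
    refine mul_le_mul_of_nonneg_left (NNReal.coe_le_coe.2 (le_csSup ?_ hmem)) hα.le
    exact (isCompact_Icc.image hφ).bddAbove
  · rw [rateBound, if_neg hα]
    exact mul_le_mul_of_nonpos_left (NNReal.coe_le_coe.2 (csInf_le' hmem)) (not_lt.1 hα)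

theorem continuous_bodyNorm : Continuous (bodyNorm : Conv n → ℝ≥0) :=
  continuous_nnnorm.comp isometry_supp.continuous

section Bounds

variable {A : Euc n →L[ℝ] Euc n} {φ : ℝ≥0 → ℝ≥0} {F : ℝ≥0 → Conv n → Conv n} {u₀ : Conv n} {T : ℝ}
  {x : ℝ → ℝ × Conv n} {u : ℝ → Conv n}

theorem IsCurve.body_zero (hx : IsCurve (stateEmbedding n) (stateField A φ F) (0, u₀) T x)
    (hu : u = fun t => expBody A (x t).1 (x t).2) : u 0 = u₀ := by
  rw [hu]
  simp only [hx.zero, expBody_zero]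

theorem IsCurve.vol_le (hn : 0 < n)
    (hx : IsCurve (stateEmbedding n) (stateField A φ F) (0, u₀) T x)
    (hu : u = fun t => expBody A (x t).1 (x t).2) (hφ : LocallyLipschitz φ) {g : ℝ≥0 → ℝ≥0}
    (hg : LocallyLipschitz g)
    (hgF : ∀ u : Conv n, n * mixedVolumeTwo 1 u (F (vol u) u) ≤ g (vol u)) {ζ : ℝ → ℝ≥0}
    (hζ : IsODESolution (volumeRHS A φ g) (vol u₀) (Ici 0) ζ) {t : ℝ} (ht : t ∈ Ico 0 T) :
    vol (u t) ≤ ζ t := by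
  have hsub : Icc 0 t ⊆ Ico 0 T := Icc_subset_Ico_right ht.2
  have huc : ContinuousOn u (Ico 0 T) := hu ▸ hx.continuousOn_body
  refine le_of_deriv_right_le_of_le_deriv_right (locallyLipschitz_volumeRHS A hφ hg 0)
    (x := fun t => vol (u t)) (y := ζ)
    (continuous_vol.comp_continuousOn (huc.mono hsub))
    (hζ.continuousOn.mono fun s hs => hs.1)
    (fun s hs => hx.hasDerivWithinAt_vol hn hu (hsub (Ico_subset_Icc_self hs)))
    (fun s hs => hζ.hasDerivWithinAt_Ici hs.1) (fun s _ => ?_) (fun s _ => le_rfl) ?_ t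
    ⟨ht.1, le_rfl⟩
  · exact add_le_add le_rfl (hgF (u s))
  · simp only [hx.body_zero hu, hζ.1, le_refl]

theorem IsCurve.le_vol (hn : 0 < n)
    (hx : IsCurve (stateEmbedding n) (stateField A φ F) (0, u₀) T x)
    (hu : u = fun t => expBody A (x t).1 (x t).2) (hφ : LocallyLipschitz φ) {g : ℝ≥0 → ℝ≥0}
    (hg : LocallyLipschitz g)
    (hgF : ∀ u : Conv n, (g (vol u) : ℝ) ≤ n * mixedVolumeTwo 1 u (F (vol u) u)) {χ : ℝ → ℝ≥0}
    (hχ : IsODESolution (volumeRHS A φ g) (vol u₀) (Ici 0) χ) {t : ℝ} (ht : t ∈ Ico 0 T) :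
    χ t ≤ vol (u t) := by
  have hsub : Icc 0 t ⊆ Ico 0 T := Icc_subset_Ico_right ht.2
  have huc : ContinuousOn u (Ico 0 T) := hu ▸ hx.continuousOn_body
  refine le_of_deriv_right_le_of_le_deriv_right (locallyLipschitz_volumeRHS A hφ hg 0)
    (x := χ) (y := fun t => vol (u t)) (hχ.continuousOn.mono fun s hs => hs.1)
    (continuous_vol.comp_continuousOn (huc.mono hsub))
    (fun s hs => hχ.hasDerivWithinAt_Ici hs.1)
    (fun s hs => hx.hasDerivWithinAt_vol hn hu (hsub (Ico_subset_Icc_self hs)))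
    (fun s _ => le_rfl) (fun s _ => ?_) ?_ t ⟨ht.1, le_rfl⟩
  · exact add_le_add le_rfl (hgF (u s))
  · simp only [hx.body_zero hu, hχ.1, le_refl]

/-- Take norms in the integral equation. The exponent `α ∫ φ` over `[s, t]` is at most `∫ a`, which
splits into a factor at `t` and one at `s`. -/
theorem IsSolution.bodyNorm_le (hφ : Continuous φ) (hu : IsSolution A φ F u₀ T u)
    {N : ℝ≥0} {α : ℝ}
    (hA : ∀ t : ℝ, 0 ≤ t → ‖NormedSpace.exp (t • A)‖ ≤ N * Real.exp (α * t)) {a : ℝ → ℝ}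
    (ha : ContinuousOn a (Ico 0 T)) (haφ : ∀ t ∈ Ico 0 T, α * φ (vol (u t)) ≤ a t)
    {G : ℝ → ℝ≥0 → ℝ≥0} (hG : ContinuousOn (fun p : ℝ × ℝ≥0 => G p.1 p.2) (Ici 0 ×ˢ univ))
    (hFG : ∀ t ∈ Ico 0 T, bodyNorm (F (vol (u t)) (u t)) ≤ G t (bodyNorm (u t))) :
    ∀ t ∈ Ico 0 T, (bodyNorm (u t) : ℝ) ≤ N * Real.exp (∫ s in (0 : ℝ)..t, a s) *
      (bodyNorm u₀ + ∫ s in (0 : ℝ)..t,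
        Real.exp (-∫ r in (0 : ℝ)..s, a r) * G s (bodyNorm (u s))) := by
  intro t ht
  have h0 : (0 : ℝ) ∈ Ico 0 T := ⟨le_rfl, ht.1.trans_lt ht.2⟩
  have huc := hu.1
  have hφc : ContinuousOn (fun τ => (φ (vol (u τ)) : ℝ)) (Ico 0 T) :=
    (NNReal.continuous_coe.comp (hφ.comp continuous_vol)).comp_continuousOn huc
  have hLc : ContinuousOn (fun t => ∫ s in (0 : ℝ)..t, a s) (Ico 0 T) :=
    fun t ht => (hasDerivWithinAt_integral_Ico ha ht).continuousWithinAt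
  have hGc : ContinuousOn (fun s => G s (bodyNorm (u s))) (Ico 0 T) :=
    hG.comp (continuousOn_id.prodMk (continuous_bodyNorm.comp_continuousOn huc))
      fun s hs => ⟨hs.1, mem_univ _⟩
  have hexp : ∀ s ∈ Icc 0 t, ‖NormedSpace.exp (clock φ u s t • A)‖ ≤
      N * Real.exp ((∫ r in (0 : ℝ)..t, a r) - ∫ r in (0 : ℝ)..s, a r) := by
    intro s hs
    have hs' : s ∈ Ico 0 T := ⟨hs.1, hs.2.trans_lt ht.2⟩
    refine (hA _ (intervalIntegral.integral_nonneg hs.2 fun r _ => NNReal.coe_nonneg _)).trans ?_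
    refine mul_le_mul_of_nonneg_left (Real.exp_le_exp.2 ?_) N.coe_nonneg
    rw [intervalIntegral.integral_interval_sub_left
      (intervalIntegrable_of_continuousOn_Ico ha h0 ht)
      (intervalIntegrable_of_continuousOn_Ico ha h0 hs'),
      ← intervalIntegral.integral_const_mul]
    refine intervalIntegral.integral_mono_on hs.2
      ((intervalIntegrable_of_continuousOn_Ico hφc hs' ht).const_mul α)
      (intervalIntegrable_of_continuousOn_Ico ha hs' ht) fun r hr => ?_
    exact haφ r ⟨hs.1.trans hr.1, hr.2.trans_lt ht.2⟩
  have hbody : ∀ s ∈ Icc 0 t, ∀ v : Conv n, ‖supp (expBody A (clock φ u s t) v)‖ ≤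
      N * Real.exp (∫ r in (0 : ℝ)..t, a r) *
        (Real.exp (-∫ r in (0 : ℝ)..s, a r) * bodyNorm v) := by
    intro s hs v
    refine (norm_imageBody_le _ v).trans ?_
    have h1 := mul_le_mul_of_nonneg_right (hexp s hs) (NNReal.coe_nonneg (bodyNorm v))
    refine h1.trans (le_of_eq ?_)
    rw [sub_eq_add_neg, Real.exp_add]
    ring
  have hnorm : (bodyNorm (u t) : ℝ) = ‖supp (u t)‖ := rfl
  rw [hnorm, hu.2 t ht]
  refine (norm_add_le _ _).trans ?_
  rw [mul_add, ← intervalIntegral.integral_const_mul]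
  refine add_le_add ?_ ?_
  · have h1 := hbody 0 ⟨le_rfl, ht.1⟩ u₀
    rwa [intervalIntegral.integral_same, neg_zero, Real.exp_zero, one_mul] at h1
  · refine intervalIntegral.norm_integral_le_of_norm_le ht.1
      (Filter.Eventually.of_forall fun s hs => ?_) ?_
    · have hs' : s ∈ Icc 0 t := Ioc_subset_Icc_self hs
      refine (hbody s hs' _).trans ?_
      gcongr
      exact hFG s ⟨hs'.1, hs'.2.trans_lt ht.2⟩
    · refine intervalIntegrable_of_continuousOn_Ico (T := T) ?_ h0 ht
      exact continuousOn_const.mul ((Real.continuous_exp.comp_continuousOn hLc.neg).mul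
        (NNReal.continuous_coe.comp_continuousOn hGc))

/-- The clock stays in a bounded interval because the volume is bounded. The operators $e^{-cA}$ run
backwards, so they are bounded by compactness of that interval instead of by the semigroup estimate.
-/
theorem IsCurve.exists_norm_field_le (hφ : Continuous φ) (hT : 0 < T)
    (hx : IsCurve (stateEmbedding n) (stateField A φ F) (0, u₀) T x)
    (hu : u = fun t => expBody A (x t).1 (x t).2) {V : ℝ≥0}
    (hV : ∀ t ∈ Ico 0 T, vol (u t) ≤ V) {D : ℝ}
    (hD : ∀ t ∈ Ico 0 T, (bodyNorm (F (vol (u t)) (u t)) : ℝ) ≤ D) :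
    ∃ M, ∀ t ∈ Ico 0 T, ‖stateEmbedding n (stateField A φ F (x t))‖ ≤ M := by
  obtain ⟨P, hP⟩ := (isCompact_Icc (a := (0 : ℝ≥0)) (b := V)).bddAbove_image hφ.continuousOn
  have hφP : ∀ t ∈ Ico 0 T, φ (vol (u t)) ≤ P := fun t ht =>
    hP (mem_image_of_mem φ ⟨zero_le, hV t ht⟩)
  have hc : ∀ t ∈ Ico 0 T, -(x t).1 ∈ Icc (-(P * T)) 0 := by
    intro t ht
    have h1 := hx.clock_eq hφ le_rfl ht.1 ht.2
    have h2 : (x 0).1 = 0 := by rw [hx.zero]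
    rw [h2, sub_zero, ← hu] at h1
    have h3 : 0 ≤ clock φ u 0 t :=
      intervalIntegral.integral_nonneg ht.1 fun r _ => NNReal.coe_nonneg _
    have h4 : ‖clock φ u 0 t‖ ≤ P * |t - 0| := by
      refine intervalIntegral.norm_integral_le_of_norm_le_const fun r hr => ?_
      rw [uIoc_of_le ht.1] at hr
      rw [Real.norm_of_nonneg (NNReal.coe_nonneg _)]
      exact NNReal.coe_le_coe.2 (hφP r ⟨hr.1.le, hr.2.trans_lt ht.2⟩)
    rw [sub_zero, abs_of_nonneg ht.1, Real.norm_of_nonneg h3] at h4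
    have h5 : (P : ℝ) * t ≤ P * T := mul_le_mul_of_nonneg_left ht.2.le P.coe_nonneg
    rw [← h1]
    constructor <;> linarith
  obtain ⟨B, hB⟩ := (isCompact_Icc (a := -((P : ℝ) * T)) (b := 0)).exists_bound_of_continuousOn
    (locallyLipschitz_exp_smul A).continuous.continuousOn
  have hB0 : 0 ≤ B := (norm_nonneg _).trans (hB _ (hc 0 ⟨le_rfl, hT⟩))
  refine ⟨max P (B * D), fun t ht => ?_⟩
  have hut : u t = expBody A (x t).1 (x t).2 := by rw [hu]
  rw [stateField, ← hut, stateEmbedding, Prod.map, Prod.norm_def]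
  refine max_le_max ?_ ?_
  · simp only [id, Real.norm_of_nonneg (NNReal.coe_nonneg _)]
    exact NNReal.coe_le_coe.2 (hφP t ht)
  · refine (norm_imageBody_le _ _).trans ?_
    exact mul_le_mul (hB _ (hc t ht)) (hD t ht) (NNReal.coe_nonneg _) hB0

end Bounds

end ConvFlow

end

/-! ### Global existence and uniqueness of the flow -/

open ConvFlow in
theorem theorem4p3 {n : ℕ} (hn : 0 < n)
    (A : ConvFlow.Euc n →L[ℝ] ConvFlow.Euc n)
    (φ : ℝ≥0 → ℝ≥0) (hφ : LocallyLipschitz φ)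
    (F : ℝ≥0 → ConvFlow.Conv n → ConvFlow.Conv n)
    (hF : LocallyLipschitz (fun p : ℝ≥0 × ConvFlow.Conv n => F p.1 p.2))
    (u₀ : ConvFlow.Conv n)
    -- (1) the exponential bound
    (N : ℝ≥0) (hN : 0 < N) (α : ℝ)
    (hA : ∀ t : ℝ, 0 ≤ t → ‖NormedSpace.exp (t • A)‖ ≤ N * Real.exp (α * t))
    -- (2) the two-sided bound on the first mixed volume
    (gLow gUp : ℝ≥0 → ℝ≥0) (hgLow : LocallyLipschitz gLow) (hgUp : LocallyLipschitz gUp)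
    (hg : ∀ u : ConvFlow.Conv n,
      (gLow (ConvFlow.vol u) : ℝ) ≤ n * ConvFlow.mixedVolumeTwo 1 u (F (ConvFlow.vol u) u) ∧
        n * ConvFlow.mixedVolumeTwo 1 u (F (ConvFlow.vol u) u) ≤ (gUp (ConvFlow.vol u) : ℝ))
    -- (3) the extremal solutions of the comparison equations for the volume
    (ζ χ : ℝ → ℝ≥0)
    (hζ : ConvFlow.IsGlobalMaximalSolution (ConvFlow.volumeRHS A φ gUp) (ConvFlow.vol u₀) ζ)
    (hχ : ConvFlow.IsGlobalMinimalSolution (ConvFlow.volumeRHS A φ gLow) (ConvFlow.vol u₀) χ)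
    -- (4) the bound on the norm of `F`
    (Fplus : ℝ → ℝ≥0 → ℝ≥0)
    (hFplus_cont : ContinuousOn (fun p : ℝ × ℝ≥0 => Fplus p.1 p.2) (Ici 0 ×ˢ univ))
    (hFplus_mono : ∀ t : ℝ, 0 ≤ t → Monotone (Fplus t))
    (hFplus : ∀ t : ℝ, 0 ≤ t → ∀ u : ConvFlow.Conv n, ∀ s ∈ Icc (χ t) (ζ t),
      ConvFlow.bodyNorm (F s u) ≤ Fplus t (ConvFlow.bodyNorm u))
    -- (5) the maximal solution of the comparison equation for the norm
    (ω : ℝ → ℝ≥0)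
    (hω : ConvFlow.IsGlobalMaximalSolution (ConvFlow.normRHS α N φ χ ζ Fplus)
      (ConvFlow.bodyNorm u₀) ω) :
    ∀ t : ℝ, 0 ≤ t → ∃! v : ConvFlow.Conv n, ConvFlow.IsFlowValue A φ F t u₀ v := by
  have hφc := hφ.continuous
  have hFc := hF.continuous
  have hfield := locallyLipschitz_stateField A hφ hF
  have hζc : ContinuousOn ζ (Ici 0) := hζ.1.continuousOn
  have hχc : ContinuousOn χ (Ici 0) := hχ.1.continuousOn
  have hωc : ContinuousOn ω (Ici 0) := hω.1.continuousOn
  have hbound : ∀ τ, 0 < τ → ∀ x, IsCurve (stateEmbedding n) (stateField A φ F) (0, u₀) τ x →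
      ∃ M, ∀ t ∈ Ico 0 τ, ‖stateEmbedding n (stateField A φ F (x t))‖ ≤ M := by
    intro τ hτ x hx
    obtain ⟨u, hu⟩ : ∃ u : ℝ → Conv n, u = fun t => expBody A (x t).1 (x t).2 := ⟨_, rfl⟩
    have hsol : IsSolution A φ F u₀ τ u := hu ▸ hx.isSolution hφc hFc
    have hvol : ∀ t ∈ Ico 0 τ, vol (u t) ∈ Icc (χ t) (ζ t) := fun t ht =>
      ⟨hx.le_vol hn hu hφ hgLow (fun v => (hg v).1) hχ.1 ht,
        hx.vol_le hn hu hφ hgUp (fun v => (hg v).2) hζ.1 ht⟩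
    have hsub : Ico 0 τ ⊆ Ici 0 := fun t ht => ht.1
    -- The ordering `χ ≤ ζ` needed for continuity of the rate is inferred from the volume lying
    -- between them.
    have hrate : ContinuousOn (fun t => α * (rateBound α φ χ ζ t : ℝ)) (Ico 0 τ) :=
      continuousOn_const.mul (NNReal.continuous_coe.comp_continuousOn
        (continuousOn_rateBound α hφc (hχc.mono hsub) (hζc.mono hsub)
          fun t ht => (hvol t ht).1.trans (hvol t ht).2))
    have hFu : ∀ t ∈ Ico 0 τ, bodyNorm (F (vol (u t)) (u t)) ≤ Fplus t (bodyNorm (u t)) :=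
      fun t ht => hFplus t ht.1 _ _ (hvol t ht)
    have hnorm : ∀ t ∈ Ico 0 τ, bodyNorm (u t) ≤ N * ω t :=
      le_mul_of_integral_le hFplus_cont hFplus_mono hω hrate
        (continuous_bodyNorm.comp_continuousOn hsol.1)
        (hsol.bodyNorm_le hφc hA hrate
          (fun t ht => mul_le_mul_rateBound α hφc (hvol t ht)) hFplus_cont hFu)
    obtain ⟨V, hV⟩ := isCompact_Icc.bddAbove_image (hζc.mono fun t (ht : t ∈ Icc 0 τ) => ht.1)
    have hFω : ContinuousOn (fun t => Fplus t (N * ω t)) (Icc 0 τ) :=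
      hFplus_cont.comp (continuousOn_id.prodMk
        (continuousOn_const.mul (hωc.mono Icc_subset_Ici_self))) fun t ht => ⟨ht.1, mem_univ _⟩
    obtain ⟨D, hD⟩ := isCompact_Icc.bddAbove_image hFω
    refine hx.exists_norm_field_le hφc hτ hu (V := V) (D := D)
      (fun t ht => (hvol t ht).2.trans (hV (mem_image_of_mem ζ (Ico_subset_Icc_self ht))))
      fun t ht => NNReal.coe_le_coe.2 ?_
    refine (hFu t ht).trans ((hFplus_mono t ht.1 (hnorm t ht)).trans ?_)
    exact hD (mem_image_of_mem (fun t => Fplus t (N * ω t)) (Ico_subset_Icc_self ht))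
  intro t ht
  -- Any horizon beyond `t` suffices.
  obtain ⟨x, hx⟩ := exists_isCurve_of_bounded isConeEmbedding_stateEmbedding hfield
    (T := t + 1) (by linarith) fun τ hτ _ x hx => hbound τ hτ x hx
  refine ⟨expBody A (x t).1 (x t).2,
    ⟨t + 1, by linarith, _, hx.isSolution hφc hFc, rfl⟩, ?_⟩
  -- A competing solution yields a curve of the same field from the same initial state; the two
  -- agree at `t`, and undoing the substitution recovers `u t`.
  rintro _ ⟨T, hT, u, hu, rfl⟩
  have hy := hu.isCurve hφc hFc (ht.trans_lt hT)
  have h := (hx.mono (min_le_left (t + 1) T)).eqOn isConeEmbedding_stateEmbedding.isometry hfield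
    (hy.mono (min_le_right (t + 1) T)) ⟨ht, lt_min (by linarith) hT⟩
  rw [h, expBody_neg_cancel]
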